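/- Let $K(z)=e^{-z}$ for $z>0$ and $K(z)=0$ for $z\le 0$, and let $*$ denote convolution in $x$. For $u_0\in L^1(\mathbb R)$ consider the augmented Burgers equation $$u_t=uu_x+u_{xx}+K*u-u+u_x\quad\text{in }(0,\infty)\times\mathbb R,\qquad u(0,\cdot)=u_0 .$$ A solution is a function $u\in C([0,\infty),L^1(\mathbb R))\cap L^2_{loc}((0,\infty);L^2(\mathbb R))$ (that is, $\int_a^b\|u(t)\|_2^2\,dt<\infty$ whenever $0<a<b<\infty$) with $u(0)=u_0$ that satisfies the equation in the sense of distributions, with $uu_x$ read as $(u^2/2)_x$: for all $\phi\in C_c^\infty((0,\infty)\times\mathbb R)$, $$-\int_0^\infty\!\!\int_{\mathbb R}u\,\phi_t=-\frac12\int_0^\infty\!\!\int_{\mathbb R}u^2\phi_x+\int_0^\infty\!\!\int_{\mathbb R}u\,\phi_{xx}+\int_0^\infty\!\!\int_{\mathbb R}(K*u-u)\phi-\int_0^\infty\!\!\int_{\mathbb R}u\,\phi_x .$$ **Theorem.** For every $p\in[1,\infty]$ there is a constant $C=C(p)>0$, depending only on $p$, such that for every $u_0\in L^1(\mathbb R)$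 and every solution $u$ with initial datum $u_0$, $$\|u(t)\|_p\le C\,\|u_0\|_1\,t^{-\frac12\left(1-\frac1p\right)}\qquad\text{for all }t>0 ,$$ where $1/p=0$ if $p=\infty$. -/

import Mathlib

open MeasureTheory Set
open scoped ENNReal Convolution

noncomputable section

namespace AugmentedBurgers

/-- The relaxation kernel `K(z) = e^{-z}` for `z > 0` and `K(z) = 0` elsewhere. -/
def K (z : ℝ) : ℝ := if 0 < z then Real.exp (-z) else 0

/-- The convolution `(K * f)(x) = ∫ K(y) f(x - y) dy` in the space variable. -/
def convK (f : ℝ → ℝ) : ℝ → ℝ := K ⋆[ContinuousLinearMap.mul ℝ ℝ, volume] f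

/-- Test functions `φ(t, x)` of class `C_c^∞((0, ∞) × ℝ)`. -/
structure IsTestFunction (φ : ℝ → ℝ → ℝ) : Prop where
  smooth : ContDiff ℝ (⊤ : ℕ∞) (fun z : ℝ × ℝ => φ z.1 z.2)
  compact : HasCompactSupport (fun z : ℝ × ℝ => φ z.1 z.2)
  support : tsupport (fun z : ℝ × ℝ => φ z.1 z.2) ⊆ Ioi (0 : ℝ) ×ˢ (univ : Set ℝ)

/-- `u` is a solution of the Cauchy problem
`u_t = u u_x + u_xx + K * u - u + u_x` on `(0, ∞) × ℝ`, `u(0) = u₀`, with `u₀ ∈ L¹(ℝ)`: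
`u` is continuous from `[0, ∞)` to `L¹(ℝ)`, equals `u₀` at time `0`, and satisfies the equation
in the sense of distributions on `(0, ∞) × ℝ`, the nonlinear term being read as `(u² / 2)_x`.
Square integrability on strips `[a, b] × ℝ`, `0 < a < b`, makes this term meaningful.
The values `u t` with `t < 0` are irrelevant. -/
structure IsSolution (u₀ : ℝ →₁[volume] ℝ) (u : ℝ → (ℝ →₁[volume] ℝ)) : Prop where
  continuousOn : ContinuousOn u (Ici 0)
  initial : u 0 = u₀
  sq_integrable : ∀ a b : ℝ, 0 < a → a < b →
    ∫⁻ t in Icc a b, eLpNorm (u t) 2 volume ^ 2 < (⊤ : ℝ≥0∞)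
  equation : ∀ φ : ℝ → ℝ → ℝ, IsTestFunction φ →
    -(∫ t in Ioi (0 : ℝ), ∫ x, u t x * deriv (fun s => φ s x) t)
      = -(1 / 2) * (∫ t in Ioi (0 : ℝ), ∫ x, (u t x) ^ 2 * deriv (φ t) x)
        + (∫ t in Ioi (0 : ℝ), ∫ x, u t x * iteratedDeriv 2 (φ t) x)
        + (∫ t in Ioi (0 : ℝ), ∫ x, (convK (u t) x - u t x) * φ t x)
        - (∫ t in Ioi (0 : ℝ), ∫ x, u t x * deriv (φ t) x)

end AugmentedBurgers

end

section

open Filter Topology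
open scoped ContDiff

noncomputable section

namespace AugmentedBurgers

/-! A solution is only known to lie in C(L¹) ∩ L²_loc(L²), so each formal computation is done on a
space-time mollification v of u. The price is a single error term, R = (mollified u²) − v², called
`defect`. It is a variance, hence nonnegative, and its integral tends to 0 with the mollification
scale because u is square integrable on strips.

Boundedness for positive times. Let V be the x-primitive of v and W = exp(V/2). The Cole–Hopf
substitution removes the quadratic term: W_t = W_xx + W_x + (W/2)(R/2 + K*V − V), where V is bounded
by the mass. Pairing W with the backward drifted heat kernel at two centres and subtracting gives a
Lipschitz bound for W. The bounded source costs only the integrable singularity (T − r)^(-1/2), and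
R disappears in the limit as long as the kernel is kept away from its singular time. Since u = 2 W_x
/ W, u is bounded on compact subintervals of (0, ∞) (`StripSolution.ae_abs_le`). This bound is
exponential in the mass; it serves only to justify what follows.

Entropies. For convex β the terms u u_x and u_x integrate to zero against β'(u), diffusion yields −∫
β''(u) u_x², and ∫ β'(u)(K*u − u) ≤ 0 by Jensen, K being a probability density. Boundedness of u
makes the contribution of R a multiple of ∫ R (`energy_rate_le`). Letting β approach |x| gives
‖u(t)‖₁ ≤ ‖u₀‖₁ (`norm_solution_le`).

Decay. For β = x^(2q), put y = ∫ u^(2q) and let m bound ∫ |u|^q. Nash's inequality applied to u^q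
turns the entropy inequality into y' ≤ −y³/(4m⁴), whence y(t) ≤ 3m²/√(t − s)
(`integral_pow_double_le`). Iterating over q = 2^k with shrinking time steps
(`integral_pow_solution_le`) and letting k → ∞ gives |u(t)| ≤ 24‖u₀‖₁/√t. Interpolation with the
mass bound covers every p, with the same constant 24. -/

theorem abs_integral_le_of_abs_le {α : Type*} [MeasurableSpace α] {μ : Measure α} {g h : α → ℝ}
    (hh : Integrable h μ) (hle : ∀ x, |g x| ≤ h x) : |∫ x, g x ∂μ| ≤ ∫ x, h x ∂μ :=
  norm_integral_le_of_norm_le (f := g) hh (ae_of_all _ hle)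

/-! ### Convolution with tensor products -/

/-- Continuous bounded functions on the line. -/
def IsBddCont (A : ℝ → ℝ) : Prop := Continuous A ∧ ∃ C, ∀ x, |A x| ≤ C

theorem IsBddCont.add {A B : ℝ → ℝ} (hA : IsBddCont A) (hB : IsBddCont B) :
    IsBddCont (fun x => A x + B x) := by
  obtain ⟨hA, C, hC⟩ := hA
  obtain ⟨hB, D, hD⟩ := hB
  exact ⟨hA.add hB, C + D, fun x => (abs_add_le _ _).trans (add_le_add (hC x) (hD x))⟩

theorem IsBddCont.sub {A B : ℝ → ℝ} (hA : IsBddCont A) (hB : IsBddCont B) :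
    IsBddCont (fun x => A x - B x) := by
  obtain ⟨hA, C, hC⟩ := hA
  obtain ⟨hB, D, hD⟩ := hB
  exact ⟨hA.sub hB, C + D, fun x => (abs_sub _ _).trans (add_le_add (hC x) (hD x))⟩

theorem isBddCont_of_compact {A : ℝ → ℝ} (hA : Continuous A) (hc : HasCompactSupport A) :
    IsBddCont A := by
  obtain ⟨C, hC⟩ := hA.bounded_above_of_compact_support hc
  exact ⟨hA, C, fun x => by simpa using hC x⟩

/-- Space-time convolution of `f` with the product kernel `A(t) B(x)`. -/
def conv2 (A B : ℝ → ℝ) (f : ℝ × ℝ → ℝ) (t x : ℝ) : ℝ :=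
  ∫ z : ℝ × ℝ, A (t - z.1) * B (x - z.2) * f z

/-- The spatial majorant of `conv2 A B f`. -/
def convDom (B : ℝ → ℝ) (f : ℝ × ℝ → ℝ) (x : ℝ) : ℝ :=
  ∫ z : ℝ × ℝ, |B (x - z.2)| * |f z|

variable {A A' B B' : ℝ → ℝ} {f : ℝ × ℝ → ℝ}

theorem continuous_kernel (hA : Continuous A) (hB : Continuous B) (t x : ℝ) :
    Continuous (fun z : ℝ × ℝ => A (t - z.1) * B (x - z.2)) := by fun_prop

theorem conv2_integrable (hA : IsBddCont A) (hB : IsBddCont B) (hf : Integrable f) (t x : ℝ) :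
    Integrable (fun z : ℝ × ℝ => A (t - z.1) * B (x - z.2) * f z) := by
  obtain ⟨hA, C, hC⟩ := hA
  obtain ⟨hB, D, hD⟩ := hB
  refine hf.bdd_mul (c := C * D) (continuous_kernel hA hB t x).aestronglyMeasurable
    (ae_of_all _ fun z => ?_)
  rw [Real.norm_eq_abs, abs_mul]
  exact mul_le_mul (hC _) (hD _) (abs_nonneg _) ((abs_nonneg _).trans (hC 0))

theorem conv2_bound {C D : ℝ} (hC : ∀ x, |A x| ≤ C) (hD : ∀ x, |B x| ≤ D) (t x : ℝ) (z : ℝ × ℝ) :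
    ‖A (t - z.1) * B (x - z.2) * f z‖ ≤ C * D * |f z| := by
  rw [Real.norm_eq_abs, abs_mul, abs_mul]
  exact mul_le_mul_of_nonneg_right
    (mul_le_mul (hC _) (hD _) (abs_nonneg _) ((abs_nonneg _).trans (hC 0))) (abs_nonneg _)

theorem conv2_abs_le (hA : IsBddCont A) (hB : IsBddCont B) (hf : Integrable f) :
    ∃ C, ∀ t x, |conv2 A B f t x| ≤ C := by
  obtain ⟨hA, C, hC⟩ := hA
  obtain ⟨hB, D, hD⟩ := hB
  refine ⟨∫ z, C * D * |f z|, fun t x => ?_⟩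
  exact norm_integral_le_of_norm_le (hf.abs.const_mul _)
    (ae_of_all _ fun z => conv2_bound hC hD t x z)

theorem conv2_continuous (hA : IsBddCont A) (hB : IsBddCont B) (hf : Integrable f) :
    Continuous (fun p : ℝ × ℝ => conv2 A B f p.1 p.2) := by
  have h1 := fun t x => (conv2_integrable hA hB hf t x).aestronglyMeasurable
  obtain ⟨hA, C, hC⟩ := hA
  obtain ⟨hB, D, hD⟩ := hB
  refine continuous_of_dominated (bound := fun z => C * D * |f z|) (fun p => h1 p.1 p.2)
    (fun p => ae_of_all _ fun z => conv2_bound hC hD p.1 p.2 z) (hf.abs.const_mul _)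
    (ae_of_all _ fun z => by fun_prop)

theorem conv2_hasDerivAt_time (hA : IsBddCont A) (hA' : IsBddCont A') (hB : IsBddCont B)
    (hd : ∀ s, HasDerivAt A (A' s) s) (hf : Integrable f) (t x : ℝ) :
    HasDerivAt (fun t => conv2 A B f t x) (conv2 A' B f t x) t := by
  have h1 := fun t => (conv2_integrable hA hB hf t x)
  have h2 := (conv2_integrable hA' hB hf t x)
  obtain ⟨hA, C, hC⟩ := hA'
  obtain ⟨hB, D, hD⟩ := hB
  refine (hasDerivAt_integral_of_dominated_loc_of_deriv_le (s := univ)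
    (F := fun t z => A (t - z.1) * B (x - z.2) * f z)
    (F' := fun t z => A' (t - z.1) * B (x - z.2) * f z)
    (bound := fun z => C * D * |f z|) univ_mem
    (Eventually.of_forall fun t => (h1 t).aestronglyMeasurable) (h1 t) h2.aestronglyMeasurable
    (ae_of_all _ fun z t _ => conv2_bound hC hD t x z) (hf.abs.const_mul _)
    (ae_of_all _ fun z s _ => ?_)).2
  exact (((hd (s - z.1)).comp_sub_const s z.1).mul_const _).mul_const _

theorem conv2_hasDerivAt_space (hA : IsBddCont A) (hB : IsBddCont B) (hB' : IsBddCont B')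
    (hd : ∀ s, HasDerivAt B (B' s) s) (hf : Integrable f) (t x : ℝ) :
    HasDerivAt (fun x => conv2 A B f t x) (conv2 A B' f t x) x := by
  have h1 := fun x => (conv2_integrable hA hB hf t x)
  have h2 := (conv2_integrable hA hB' hf t x)
  obtain ⟨hA, C, hC⟩ := hA
  obtain ⟨hB, D, hD⟩ := hB'
  refine (hasDerivAt_integral_of_dominated_loc_of_deriv_le (s := univ)
    (F := fun x z => A (t - z.1) * B (x - z.2) * f z)
    (F' := fun x z => A (t - z.1) * B' (x - z.2) * f z)
    (bound := fun z => C * D * |f z|) univ_mem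
    (Eventually.of_forall fun t => (h1 t).aestronglyMeasurable) (h1 x) h2.aestronglyMeasurable
    (ae_of_all _ fun z x _ => conv2_bound hC hD t x z) (hf.abs.const_mul _)
    (ae_of_all _ fun z s _ => ?_)).2
  exact (((hd (s - z.2)).comp_sub_const s z.2).const_mul _).mul_const _

theorem convDom_prod_integrable (hB : IsBddCont B) (hBi : Integrable B) (hf : Integrable f) :
    Integrable (fun p : ℝ × (ℝ × ℝ) => |B (p.1 - p.2.2)| * |f p.2|) (volume.prod volume) := by
  have hm : AEStronglyMeasurable (fun p : ℝ × (ℝ × ℝ) => |B (p.1 - p.2.2)| * |f p.2|)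
      (volume.prod volume) := by
    refine AEStronglyMeasurable.mul ?_ ?_
    · have := hB.1
      exact Continuous.aestronglyMeasurable (by fun_prop)
    · exact hf.abs.aestronglyMeasurable.comp_snd
  rw [← integrable_swap_iff]
  refine (integrable_prod_iff hm.prod_swap).2 ⟨ae_of_all _ fun z => ?_, ?_⟩
  · exact ((hBi.comp_sub_right z.2).abs).mul_const |f z|
  · have : (fun z : ℝ × ℝ => ∫ x, ‖(fun p : ℝ × (ℝ × ℝ) => |B (p.1 - p.2.2)| * |f p.2|)
        (Prod.swap (z, x))‖) = fun z => (∫ x, |B x|) * |f z| := by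
      funext z
      simp only [Prod.swap_prod_mk, norm_mul, Real.norm_eq_abs, abs_abs]
      rw [integral_mul_const, integral_sub_right_eq_self (fun x => |B x|)]
    exact Eq.mpr (congrArg (fun g => Integrable g) this) (hf.abs.const_mul _)

theorem convDom_integrable (hB : IsBddCont B) (hBi : Integrable B) (hf : Integrable f) :
    Integrable (convDom B f) :=
  (convDom_prod_integrable hB hBi hf).integral_prod_left

/-- The majorant is integrable in x and independent of t. This is what permits differentiating
x-integrals of mollified quantities in time. -/
theorem conv2_le_convDom {C : ℝ} (hC : ∀ x, |A x| ≤ C) (hB : IsBddCont B)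
    (hf : Integrable f) (t x : ℝ) : |conv2 A B f t x| ≤ C * convDom B f x := by
  unfold convDom
  rw [← integral_const_mul]
  refine abs_integral_le_of_abs_le ?_ (fun z => ?_)
  · refine Integrable.const_mul ?_ _
    obtain ⟨hB, D, hD⟩ := hB
    exact hf.abs.bdd_mul (c := D) (Continuous.aestronglyMeasurable (by fun_prop))
      (ae_of_all _ fun z => by simpa using hD _)
  · rw [abs_mul, abs_mul, mul_assoc]
    exact mul_le_mul_of_nonneg_right (hC _) (by positivity)

theorem conv2_slice_continuous (hA : IsBddCont A) (hB : IsBddCont B) (hf : Integrable f) (t : ℝ) :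
    Continuous (conv2 A B f t) :=
  (conv2_continuous hA hB hf).comp (Continuous.prodMk_right t)

theorem conv2_integrable_slice (hA : IsBddCont A) (hB : IsBddCont B) (hBi : Integrable B)
    (hf : Integrable f) (t : ℝ) : Integrable (conv2 A B f t) := by
  obtain ⟨C, hC⟩ := hA.2
  refine ((convDom_integrable hB hBi hf).const_mul C).mono'
    (conv2_slice_continuous hA hB hf t).aestronglyMeasurable
    (ae_of_all _ fun x => conv2_le_convDom hC hB hf t x)

theorem conv2_eq_iterated (hA : IsBddCont A) (hB : IsBddCont B) (hf : Integrable f) (t x : ℝ) :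
    conv2 A B f t x = ∫ s, A (t - s) * ∫ y, B (x - y) * f (s, y) := by
  have := conv2_integrable hA hB hf t x
  unfold conv2
  rw [Measure.volume_eq_prod] at this ⊢
  rw [integral_prod _ this]
  congr 1
  funext s
  rw [← integral_const_mul]
  congr 1
  funext y
  ring

/-- Averaging in time against a probability density costs nothing, so only the sup of B and the mass
of the slices enter. Unlike `conv2_abs_le`, the constant does not blow up as A concentrates. -/
theorem conv2_abs_le_of_slices {C M : ℝ} (hA : IsBddCont A) (hA0 : ∀ x, 0 ≤ A x)
    (hAi : Integrable A) (hA1 : ∫ x, A x = 1)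
    (hB : IsBddCont B) (hC : ∀ x, |B x| ≤ C) (hf : Integrable f)
    (hs : ∀ s, Integrable fun y => f (s, y)) (hM : ∀ s, ∫ y, |f (s, y)| ≤ M) (t x : ℝ) :
    |conv2 A B f t x| ≤ C * M := by
  have hC0 : 0 ≤ C := (abs_nonneg _).trans (hC 0)
  have h2 : ∀ s, |∫ y, B (x - y) * f (s, y)| ≤ C * M := fun s => by
    calc |∫ y, B (x - y) * f (s, y)| ≤ ∫ y, C * |f (s, y)| :=
          abs_integral_le_of_abs_le ((hs s).abs.const_mul C) (fun y => by
            rw [abs_mul]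
            exact mul_le_mul_of_nonneg_right (hC _) (abs_nonneg _))
      _ = C * ∫ y, |f (s, y)| := integral_const_mul _ _
      _ ≤ C * M := mul_le_mul_of_nonneg_left (hM s) hC0
  have hAt : Integrable (fun s => A (t - s)) := hAi.comp_sub_left t
  calc |conv2 A B f t x| ≤ ∫ s, A (t - s) * (C * M) := by
        rw [conv2_eq_iterated hA hB hf]
        refine abs_integral_le_of_abs_le (hAt.mul_const _) (fun s => ?_)
        rw [abs_mul, abs_of_nonneg (hA0 _)]
        exact mul_le_mul_of_nonneg_left (h2 s) (hA0 _)
    _ = C * M := by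
        rw [integral_mul_const, integral_sub_left_eq_self A volume t, hA1, one_mul]

theorem conv2_linear_kernel (hA : IsBddCont A) (hB : IsBddCont B) (hB' : IsBddCont B')
    (hf : Integrable f) (t x : ℝ) :
    conv2 A (fun y => B y - B' y) f t x = conv2 A B f t x - conv2 A B' f t x := by
  unfold conv2
  rw [← integral_sub (conv2_integrable hA hB hf t x) (conv2_integrable hA hB' hf t x)]
  congr 1
  funext z
  ring

end AugmentedBurgers

namespace AugmentedBurgers

/-! ### The kernel `K` -/

theorem K_eq_indicator : K = (Ioi (0 : ℝ)).indicator (fun z => Real.exp (-z)) := by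
  funext z
  simp [K, indicator, mem_Ioi]

theorem K_nonneg (z : ℝ) : 0 ≤ K z := by
  unfold K
  split_ifs
  · exact (Real.exp_pos _).le
  · exact le_rfl

theorem K_integrable : Integrable K := by
  rw [K_eq_indicator, integrable_indicator_iff measurableSet_Ioi]
  exact integrableOn_exp_neg_Ioi 0

theorem K_integral : ∫ z, K z = 1 := by
  rw [K_eq_indicator, integral_indicator measurableSet_Ioi, integral_exp_neg_Ioi_zero]

/-- Convolution of a bounded continuous function with `K`. -/
def smear (B : ℝ → ℝ) (z : ℝ) : ℝ := ∫ w, K w * B (z - w)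

variable {A B : ℝ → ℝ}

theorem smear_abs_le {C : ℝ} (hC : ∀ x, |B x| ≤ C) (z : ℝ) : |smear B z| ≤ C := by
  calc |smear B z| ≤ ∫ w, K w * C := by
        refine abs_integral_le_of_abs_le (K_integrable.mul_const C) fun w => ?_
        rw [abs_mul, abs_of_nonneg (K_nonneg w)]
        exact mul_le_mul_of_nonneg_left (hC _) (K_nonneg w)
    _ = C := by rw [integral_mul_const, K_integral, one_mul]

theorem smear_integrand_integrable (hB : IsBddCont B) (z : ℝ) :
    Integrable (fun w => K w * B (z - w)) := by
  obtain ⟨hB, C, hC⟩ := hB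
  exact K_integrable.mul_bdd (c := C) (Continuous.aestronglyMeasurable (by fun_prop))
    (ae_of_all _ fun w => hC _)

theorem smear_isBddCont (hB : IsBddCont B) : IsBddCont (smear B) := by
  have h1 := fun z => (smear_integrand_integrable hB z).aestronglyMeasurable
  obtain ⟨hB, C, hC⟩ := hB
  refine ⟨?_, C, smear_abs_le hC⟩
  refine continuous_of_dominated (bound := fun w => K w * C) h1
    (fun z => ae_of_all _ fun w => ?_) (K_integrable.mul_const C)
    (ae_of_all _ fun w => by fun_prop)
  rw [Real.norm_eq_abs, abs_mul, abs_of_nonneg (K_nonneg w)]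
  exact mul_le_mul_of_nonneg_left (hC _) (K_nonneg w)

theorem convK_apply (g : ℝ → ℝ) (y : ℝ) : convK g y = ∫ w, K w * g (y - w) := rfl

theorem convK_prod_integrable {g : ℝ → ℝ} (hg : Integrable g) :
    Integrable (fun p : ℝ × ℝ => K p.2 * g (p.1 - p.2)) (volume.prod volume) :=
  K_integrable.convolution_integrand (ContinuousLinearMap.mul ℝ ℝ) hg

theorem convK_integrable {g : ℝ → ℝ} (hg : Integrable g) : Integrable (convK g) :=
  (convK_prod_integrable hg).integral_prod_left

/-- Fubini and a translation move K from g onto the kernel. No reflection of K appears because the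
kernel is evaluated at x − y: this is commutativity and associativity of convolution. Only
boundedness of B is used, since `smear B` has no compact support in general. -/
theorem integral_convK_mul {g : ℝ → ℝ} (hg : Integrable g) (hB : IsBddCont B) (x : ℝ) :
    ∫ y, convK g y * B (x - y) = ∫ y, g y * smear B (x - y) := by
  obtain ⟨C, hC⟩ := hB.2
  have hBc := hB.1
  have h1 : Integrable (fun p : ℝ × ℝ => K p.2 * g (p.1 - p.2) * B (x - p.1))
      (volume.prod volume) :=
    (convK_prod_integrable hg).mul_bdd (c := C) (Continuous.aestronglyMeasurable (by fun_prop))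
      (ae_of_all _ fun w => hC _)
  have h2 : Integrable (fun p : ℝ × ℝ => K p.2 * g p.1 * B (x - p.1 - p.2))
      (volume.prod volume) := by
    refine Integrable.mul_bdd (c := C) ?_ (Continuous.aestronglyMeasurable (by fun_prop))
      (ae_of_all _ fun w => hC _)
    exact ((K_integrable.mul_prod hg).swap).congr (ae_of_all _ fun p => rfl)
  calc ∫ y, convK g y * B (x - y) = ∫ y, ∫ w, K w * g (y - w) * B (x - y) := by
        simp_rw [convK_apply, integral_mul_const]
    _ = ∫ w, ∫ y, K w * g (y - w) * B (x - y) := integral_integral_swap h1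
    _ = ∫ w, ∫ y, K w * g y * B (x - y - w) := by
        congr 1
        funext w
        rw [← integral_sub_right_eq_self (fun y => K w * g y * B (x - y - w)) w]
        congr 1
        funext y
        rw [show x - (y - w) - w = x - y by ring]
    _ = ∫ y, ∫ w, K w * g y * B (x - y - w) := (integral_integral_swap h2).symm
    _ = ∫ y, g y * smear B (x - y) := by
        congr 1
        funext y
        unfold smear
        rw [← integral_const_mul]
        congr 1
        funext w
        ring

/-! ### Solutions on a strip -/

/-- A jointly measurable representative, on the strip `[a, b] × ℝ`, of a solution
with mass at most `M`; the equation is tested against product kernels. -/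
structure StripSolution (a b M : ℝ) (f : ℝ × ℝ → ℝ) : Prop where
  measurable : Measurable f
  integrable : Integrable f
  sq_integrable : Integrable (fun z => f z ^ 2)
  slice : ∀ t, Integrable (fun y => f (t, y))
  mass : ∀ t, ∫ y, |f (t, y)| ≤ M
  cont : ∀ t ∈ Ioo a b, ∀ δ > 0, ∃ ε > 0, ∀ s, |s - t| < ε → ∫ y, |f (s, y) - f (t, y)| ≤ δ
  eqn : ∀ A B : ℝ → ℝ, ContDiff ℝ ∞ A → HasCompactSupport A → ContDiff ℝ ∞ B →
    HasCompactSupport B → ∀ t x, (∀ s, t - s ∈ tsupport A → s ∈ Ioo a b) →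
    conv2 (deriv A) B f t x = 1 / 2 * conv2 A (deriv B) (fun z => f z ^ 2) t x
      + conv2 A (deriv (deriv B)) f t x + (conv2 A (smear B) f t x - conv2 A B f t x)
      + conv2 A (deriv B) f t x

theorem iterated_eq_conv2 {a b : ℝ} (ha : 0 < a) {U : ℝ → ℝ → ℝ} {f : ℝ × ℝ → ℝ}
    (hU : ∀ s ∈ Icc a b, (fun y => U s y) =ᵐ[volume] fun y => f (s, y))
    (hA : IsBddCont A) (hB : IsBddCont B) (hf : Integrable f) {t : ℝ}
    (hA0 : ∀ s, s ∉ Icc a b → A (t - s) = 0) (x : ℝ) :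
    ∫ s in Ioi (0 : ℝ), ∫ y, U s y * (A (t - s) * B (x - y)) = conv2 A B f t x := by
  have h1 : ∀ s, (∫ y, U s y * (A (t - s) * B (x - y)))
      = A (t - s) * ∫ y, B (x - y) * f (s, y) := fun s => by
    by_cases hs : s ∈ Icc a b
    · rw [← integral_const_mul]
      refine integral_congr_ae ?_
      filter_upwards [hU s hs] with y hy
      rw [hy]
      ring
    · simp [hA0 s hs]
  simp_rw [h1]
  rw [conv2_eq_iterated hA hB hf]
  refine setIntegral_eq_integral_of_forall_compl_eq_zero fun s hs => ?_
  rw [hA0 s fun h => hs (ha.trans_le h.1), zero_mul]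

theorem isTestFunction_kernel {a b : ℝ} (ha : 0 < a) (hA : ContDiff ℝ ∞ A)
    (hAc : HasCompactSupport A) (hB : ContDiff ℝ ∞ B) (hBc : HasCompactSupport B) {t x : ℝ}
    (ht : ∀ s, t - s ∈ tsupport A → s ∈ Ioo a b) :
    IsTestFunction (fun s y => A (t - s) * B (x - y)) where
  smooth := by
    have h1 : ContDiff ℝ ∞ (fun z : ℝ × ℝ => A (t - z.1)) :=
      hA.comp (contDiff_const.sub contDiff_fst)
    have h2 : ContDiff ℝ ∞ (fun z : ℝ × ℝ => B (x - z.2)) :=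
      hB.comp (contDiff_const.sub contDiff_snd)
    exact h1.mul h2
  compact := by
    have hK : IsCompact (((fun s => t - s) '' tsupport A) ×ˢ ((fun y => x - y) '' tsupport B)) :=
      (IsCompact.image hAc (by fun_prop)).prod (IsCompact.image hBc (by fun_prop))
    refine HasCompactSupport.intro hK fun z hz => ?_
    by_contra h
    refine hz ⟨⟨t - z.1, subset_tsupport A ?_, by ring⟩, ⟨x - z.2, subset_tsupport B ?_, by ring⟩⟩
    · exact left_ne_zero_of_mul h
    · exact right_ne_zero_of_mul h
  support := by
    have hcl : IsClosed {z : ℝ × ℝ | t - z.1 ∈ tsupport A} :=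
      (isClosed_tsupport A).preimage (by fun_prop : Continuous fun z : ℝ × ℝ => t - z.1)
    have : tsupport (fun z : ℝ × ℝ => A (t - z.1) * B (x - z.2))
        ⊆ {z : ℝ × ℝ | t - z.1 ∈ tsupport A} :=
      closure_minimal (fun z hz => subset_tsupport A (left_ne_zero_of_mul hz)) hcl
    exact fun z hz => ⟨ha.trans (ht _ (this hz)).1, mem_univ _⟩

/-- The weak equation is tested with φ(s, y) = A(t − s) B(x − y). Each derivative of φ brings a
factor −1, which turns the signs of the weak form back into those of the differential equation. The
support condition on A keeps s inside (a, b), where f represents u. -/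
theorem conv2_equation {u₀ : ℝ →₁[volume] ℝ} {u : ℝ → (ℝ →₁[volume] ℝ)}
    (hu : IsSolution u₀ u) {a b : ℝ} (ha : 0 < a) {f : ℝ × ℝ → ℝ}
    (hf : Integrable f) (hf2 : Integrable (fun z => f z ^ 2))
    (hfu : ∀ s ∈ Icc a b, (fun y => u s y) =ᵐ[volume] fun y => f (s, y))
    (hA : ContDiff ℝ ∞ A) (hAc : HasCompactSupport A) (hB : ContDiff ℝ ∞ B)
    (hBc : HasCompactSupport B) {t : ℝ} (x : ℝ)
    (ht : ∀ s, t - s ∈ tsupport A → s ∈ Ioo a b) :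
    conv2 (deriv A) B f t x = 1 / 2 * conv2 A (deriv B) (fun z => f z ^ 2) t x
      + conv2 A (deriv (deriv B)) f t x + (conv2 A (smear B) f t x - conv2 A B f t x)
      + conv2 A (deriv B) f t x := by
  have hA1 : ContDiff ℝ ∞ (deriv A) := ((contDiff_infty_iff_deriv (𝕜 := ℝ)).1 hA).2
  have hB1 : ContDiff ℝ ∞ (deriv B) := ((contDiff_infty_iff_deriv (𝕜 := ℝ)).1 hB).2
  have hB2 : ContDiff ℝ ∞ (deriv (deriv B)) := ((contDiff_infty_iff_deriv (𝕜 := ℝ)).1 hB1).2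
  have nA := isBddCont_of_compact hA.continuous hAc
  have nA1 := isBddCont_of_compact hA1.continuous hAc.deriv
  have nB := isBddCont_of_compact hB.continuous hBc
  have nB1 := isBddCont_of_compact hB1.continuous hBc.deriv
  have nB2 := isBddCont_of_compact hB2.continuous hBc.deriv.deriv
  have zA : ∀ s, s ∉ Icc a b → A (t - s) = 0 := fun s hs => by
    by_contra h
    exact hs (Ioo_subset_Icc_self (ht s (subset_tsupport A h)))
  have zA1 : ∀ s, s ∉ Icc a b → deriv A (t - s) = 0 := fun s hs => by
    by_contra h
    exact hs (Ioo_subset_Icc_self (ht s (tsupport_deriv_subset (subset_tsupport _ h))))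
  have dA : ∀ s, HasDerivAt A (deriv A s) s := fun s =>
    (hA.differentiable (by simp) s).hasDerivAt
  have dB : ∀ s, HasDerivAt B (deriv B s) s := fun s =>
    (hB.differentiable (by simp) s).hasDerivAt
  have dB1 : ∀ s, HasDerivAt (deriv B) (deriv (deriv B) s) s := fun s =>
    (hB1.differentiable (by simp) s).hasDerivAt
  have e1 : ∀ s y, deriv (fun r => A (t - r) * B (x - y)) s = -(deriv A (t - s) * B (x - y)) := by
    intro s y
    have := ((dA (t - s)).comp_const_sub t s).mul_const (B (x - y))
    rw [this.deriv]
    ring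
  have e2 : ∀ s y, deriv (fun r => A (t - s) * B (x - r)) y = -(A (t - s) * deriv B (x - y)) := by
    intro s y
    have := ((dB (x - y)).comp_const_sub x y).const_mul (A (t - s))
    rw [this.deriv]
    ring
  have e3 : ∀ s y, iteratedDeriv 2 (fun r => A (t - s) * B (x - r)) y
      = A (t - s) * deriv (deriv B) (x - y) := by
    intro s y
    rw [iteratedDeriv_succ, iteratedDeriv_one]
    have : deriv (fun r => A (t - s) * B (x - r)) = fun y => -(A (t - s) * deriv B (x - y)) :=
      funext (e2 s)
    rw [this]
    have := (((dB1 (x - y)).comp_const_sub x y).const_mul (A (t - s))).neg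
    refine this.deriv.trans ?_
    ring
  have hfu2 : ∀ s ∈ Icc a b, (fun y => (u s y) ^ 2) =ᵐ[volume] fun y => f (s, y) ^ 2 := by
    intro s hs
    filter_upwards [hfu s hs] with y hy
    rw [hy]
  have hK : ∀ s, ∫ y, (convK (u s) y - u s y) * (A (t - s) * B (x - y))
      = ∫ y, u s y * (A (t - s) * (smear B (x - y) - B (x - y))) := by
    intro s
    have hg : Integrable (u s) := L1.integrable_coeFn _
    obtain ⟨C, hC⟩ := nB.2
    have hBc := nB.1
    have mB : AEStronglyMeasurable (fun y => B (x - y)) (volume : Measure ℝ) :=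
      Continuous.aestronglyMeasurable (by fun_prop)
    have mKB : AEStronglyMeasurable (fun y => smear B (x - y)) (volume : Measure ℝ) :=
      ((smear_isBddCont nB).1.comp (continuous_const.sub continuous_id)).aestronglyMeasurable
    have i1 : Integrable (fun y => convK (u s) y * B (x - y)) :=
      (convK_integrable hg).mul_bdd (c := C) mB (ae_of_all _ fun w => hC _)
    have i2 : Integrable (fun y => u s y * B (x - y)) :=
      hg.mul_bdd (c := C) mB (ae_of_all _ fun w => hC _)
    have i3 : Integrable (fun y => u s y * smear B (x - y)) :=
      hg.mul_bdd (c := C) mKB (ae_of_all _ fun w => smear_abs_le hC _)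
    calc _ = A (t - s) * ((∫ y, convK (u s) y * B (x - y)) - ∫ y, u s y * B (x - y)) := by
          rw [← integral_sub i1 i2, ← integral_const_mul]
          congr 1
          funext y
          ring
      _ = _ := by
          rw [integral_convK_mul hg nB, ← integral_sub i3 i2, ← integral_const_mul]
          congr 1
          funext y
          ring
  have key := hu.equation _ (isTestFunction_kernel ha hA hAc hB hBc (x := x) ht)
  simp only [e1, e2, e3, hK, mul_neg, integral_neg] at key
  rw [iterated_eq_conv2 ha hfu nA1 nB hf zA1, iterated_eq_conv2 ha hfu2 nA nB1 hf2 zA,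
    iterated_eq_conv2 ha hfu nA nB2 hf zA, iterated_eq_conv2 ha hfu nA nB1 hf zA,
    iterated_eq_conv2 (B := fun y => smear B y - B y) ha hfu nA ((smear_isBddCont nB).sub nB) hf zA,
    conv2_linear_kernel nA (smear_isBddCont nB) nB hf] at key
  linarith

end AugmentedBurgers

/-! ### Jointly measurable representatives of solutions -/

namespace AugmentedBurgers

/-- A continuous curve in `L¹` has a jointly measurable representative. -/
theorem exists_measurable_representative (v : ℝ → (ℝ →₁[volume] ℝ)) (hv : Continuous v) :
    ∃ g : ℝ × ℝ → ℝ, Measurable g ∧ ∀ t, (fun x => g (t, x)) =ᵐ[volume] v t := by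
  let h : ℕ → ℝ := fun n => 1 / ((n : ℝ) + 1)
  have hh0 : ∀ n, 0 < h n := fun n => by positivity
  have hi : ∀ t, Integrable (v t) := fun t => L1.integrable_coeFn _
  -- Forward difference quotients of the primitive are continuous separately in t and in x, hence
  -- jointly measurable. For each t they converge to v t almost everywhere by Lebesgue
  -- differentiation; where they do not converge, `limUnder` takes an irrelevant value on a null set
  -- of the slice.
  let D : ℕ → ℝ × ℝ → ℝ := fun n z =>
    (h n)⁻¹ • ((∫ y in (0 : ℝ)..(z.2 + h n), v z.1 y) - ∫ y in (0 : ℝ)..z.2, v z.1 y)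
  have hct : ∀ c : ℝ, Continuous fun t => ∫ y in (0 : ℝ)..c, v t y := fun c => by
    simp only [intervalIntegral]
    exact ((continuous_setIntegral _).comp hv).sub ((continuous_setIntegral _).comp hv)
  have hcx : ∀ t, Continuous fun c => ∫ y in (0 : ℝ)..c, v t y := fun t =>
    intervalIntegral.continuous_primitive (fun a b => (hi t).intervalIntegrable) 0
  have hD : ∀ n, Measurable (D n) := fun n => by
    have : Measurable (Function.uncurry fun t x : ℝ =>
        (h n)⁻¹ • ((∫ y in (0 : ℝ)..(x + h n), v t y) - ∫ y in (0 : ℝ)..x, v t y)) := by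
      refine measurable_uncurry_of_continuous_of_measurable (fun x => ?_) (fun t => ?_)
      · have h1 : Continuous fun t =>
            (∫ y in (0 : ℝ)..(x + h n), v t y) - ∫ y in (0 : ℝ)..x, v t y :=
          (hct (x + h n)).sub (hct x)
        exact h1.const_smul (h n)⁻¹
      · have h2 : Continuous fun x => ∫ y in (0 : ℝ)..(x + h n), v t y :=
          (hcx t).comp (continuous_id.add continuous_const)
        exact (h2.sub (hcx t)).measurable.const_smul (h n)⁻¹
    exact this
  refine ⟨fun z => limUnder atTop fun n => D n z,
    (StronglyMeasurable.limUnder fun n => (hD n).stronglyMeasurable).measurable, fun t => ?_⟩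
  filter_upwards [LocallyIntegrable.ae_hasDerivAt_integral (hi t).locallyIntegrable] with x hx
  have h1 := hasDerivAt_iff_tendsto_slope_zero.1 (hx 0)
  have h2 : Tendsto h atTop (𝓝[≠] 0) :=
    tendsto_nhdsWithin_iff.2 ⟨tendsto_one_div_add_atTop_nhds_zero_nat,
      Eventually.of_forall fun n => (hh0 n).ne'⟩
  exact (h1.comp h2).limUnder_eq

theorem norm_sub_eq_integral (v w : ℝ →₁[volume] ℝ) : ‖v - w‖ = ∫ y, |v y - w y| := by
  rw [L1.norm_eq_integral_norm]
  refine integral_congr_ae ?_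
  filter_upwards [Lp.coeFn_sub v w] with y hy
  rw [hy]
  rfl

theorem stripSolution_of_isSolution {u₀ : ℝ →₁[volume] ℝ} {u : ℝ → (ℝ →₁[volume] ℝ)}
    (hu : IsSolution u₀ u) {a b M : ℝ} (ha : 0 < a) (hab : a < b) {f : ℝ × ℝ → ℝ}
    (hfm : Measurable f) (hf0 : ∀ t x, t ∉ Icc a b → f (t, x) = 0)
    (hfu : ∀ t ∈ Icc a b, (fun y => u t y) =ᵐ[volume] fun y => f (t, y))
    (hM : ∀ t ∈ Icc a b, ‖u t‖ ≤ M) : StripSolution a b M f := by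
  have hM0 : 0 ≤ M := (norm_nonneg _).trans (hM a ⟨le_rfl, hab.le⟩)
  have hsl : ∀ t, Integrable (fun y => f (t, y)) := fun t => by
    by_cases ht : t ∈ Icc a b
    · exact (L1.integrable_coeFn (u t)).congr (hfu t ht)
    · simp [hf0 t _ ht]
  have hmass : ∀ t, ∫ y, |f (t, y)| ≤ M := fun t => by
    by_cases ht : t ∈ Icc a b
    · refine le_trans (le_of_eq ?_) (hM t ht)
      rw [L1.norm_eq_integral_norm]
      refine integral_congr_ae ?_
      filter_upwards [hfu t ht] with y hy
      rw [hy]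
      rfl
    · simpa [hf0 t _ ht] using hM0
  have hint : Integrable f := by
    rw [Measure.volume_eq_prod]
    refine (integrable_prod_iff hfm.aestronglyMeasurable).2 ⟨ae_of_all _ hsl, ?_⟩
    have hind : Integrable ((Icc a b).indicator fun _ : ℝ => M) :=
      (integrable_indicator_iff measurableSet_Icc).2 (integrableOn_const (by simp))
    refine hind.mono' ?_ (ae_of_all _ fun t => ?_)
    · exact (hfm.norm.stronglyMeasurable.integral_prod_right').aestronglyMeasurable
    · rw [Real.norm_eq_abs, abs_of_nonneg (integral_nonneg fun y => norm_nonneg _)]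
      by_cases ht : t ∈ Icc a b
      · rw [indicator_of_mem ht]
        exact hmass t
      · simp [hf0 t _ ht, indicator_of_notMem ht]
  have hsq : Integrable (fun z => f z ^ 2) := by
    refine ⟨(hfm.pow_const 2).aestronglyMeasurable, ?_⟩
    rw [hasFiniteIntegral_iff_enorm, Measure.volume_eq_prod,
      lintegral_prod _ (hfm.pow_const 2).enorm.aemeasurable]
    refine lt_of_le_of_lt ?_ (hu.sq_integrable a b ha hab)
    rw [← lintegral_indicator measurableSet_Icc]
    refine lintegral_mono fun t => ?_
    by_cases ht : t ∈ Icc a b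
    · rw [indicator_of_mem ht]
      have h2 : eLpNorm (u t) 2 volume ^ 2 = ∫⁻ y, ‖u t y‖ₑ ^ 2 := by
        have := eLpNorm_nnreal_pow_eq_lintegral (μ := (volume : Measure ℝ)) (f := u t)
          (p := 2) (by norm_num)
        simpa using this
      rw [h2]
      refine le_of_eq (lintegral_congr_ae ?_)
      filter_upwards [hfu t ht] with y hy
      rw [hy, enorm_pow]
    · simp [hf0 t _ ht]
  refine ⟨hfm, hint, hsq, hsl, hmass, fun t ht δ hδ => ?_,
    fun A B hA hAc hB hBc t x h => conv2_equation hu ha hint hsq hfu hA hAc hB hBc x h⟩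
  have hct : ContinuousAt u t :=
    hu.continuousOn.continuousAt (Ici_mem_nhds (ha.trans ht.1))
  have h1 := hct.eventually (Metric.ball_mem_nhds (u t) hδ)
  have h2 := h1.and (Ioo_mem_nhds ht.1 ht.2)
  obtain ⟨ε, hε, h⟩ := Metric.eventually_nhds_iff.1 h2
  refine ⟨ε, hε, fun s hs => ?_⟩
  obtain ⟨h3, h4⟩ := h (y := s) (by simpa [Real.dist_eq] using hs)
  rw [dist_eq_norm, norm_sub_eq_integral] at h3
  refine le_trans (le_of_eq (integral_congr_ae ?_)) h3.le
  filter_upwards [hfu s (Ioo_subset_Icc_self h4), hfu t (Ioo_subset_Icc_self ht)] with y h5 h6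
  rw [h5, h6]

theorem exists_stripSolution {u₀ : ℝ →₁[volume] ℝ} {u : ℝ → (ℝ →₁[volume] ℝ)}
    (hu : IsSolution u₀ u) {a b : ℝ} (ha : 0 < a) (hab : a < b) :
    ∃ (M : ℝ) (f : ℝ × ℝ → ℝ), StripSolution a b M f ∧ (∀ t x, t ∉ Icc a b → f (t, x) = 0) ∧
      ∀ t ∈ Icc a b, (fun y => u t y) =ᵐ[volume] fun y => f (t, y) := by
  -- Nothing is known about u at negative times, so the curve is extended by its value at 0 to be
  -- continuous on the whole line.
  obtain ⟨g, hg, hgu⟩ := exists_measurable_representative (fun t => u (max t 0))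
    (hu.continuousOn.comp_continuous (by fun_prop) fun t => mem_Ici.2 (le_max_right _ _))
  obtain ⟨M, hM⟩ := isCompact_Icc.exists_bound_of_continuousOn
    (hu.continuousOn.mono fun t (ht : t ∈ Icc a b) => ha.le.trans ht.1)
  have hS : MeasurableSet (Icc a b ×ˢ (univ : Set ℝ)) := measurableSet_Icc.prod MeasurableSet.univ
  have h0 : ∀ t x, t ∉ Icc a b → (Icc a b ×ˢ (univ : Set ℝ)).indicator g (t, x) = 0 :=
    fun t x ht => indicator_of_notMem (fun h => ht h.1) _
  have h1 : ∀ t ∈ Icc a b,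
      (fun y => u t y) =ᵐ[volume] fun y => (Icc a b ×ˢ (univ : Set ℝ)).indicator g (t, y) := by
    intro t ht
    have := hgu t
    rw [max_eq_left (ha.le.trans ht.1)] at this
    filter_upwards [this] with y hy
    rw [indicator_of_mem (by exact ⟨ht, mem_univ _⟩), hy]
  exact ⟨M, _, stripSolution_of_isSolution hu ha hab (hg.indicator hS) h0 h1 hM, h0, h1⟩

end AugmentedBurgers

namespace AugmentedBurgers

/-! ### Mollifiers -/

/-- Continuity of translations in L^p, from the continuity of composition with measure preserving
maps. It is used in the plane with p = 2, for the defect, and on the line with p = 1, for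
convergence at a fixed time. -/
theorem eLpNorm_translation_tendsto {G : Type*} [NormedAddCommGroup G] [MeasurableSpace G]
    [BorelSpace G] {μ : Measure G} [μ.IsAddRightInvariant] [μ.InnerRegularCompactLTTop]
    [IsLocallyFiniteMeasure μ] {p : ℝ≥0∞} [Fact (1 ≤ p)] (hp : p ≠ ⊤)
    {g : G → ℝ} (hg : MemLp g p μ) :
    Tendsto (fun w => eLpNorm (fun z => g (z - w) - g z) p μ) (𝓝 0) (𝓝 0) := by
  let T : C(G, C(G, G)) := (ContinuousMap.mk (fun q : G × G => q.2 - q.1)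
    (by fun_prop)).curry
  have hT : ∀ w, MeasurePreserving (T w) μ μ := fun w => measurePreserving_sub_right μ w
  have h1 := Filter.Tendsto.compMeasurePreservingLp (p := p) (f := fun _ : G => hg.toLp g)
    (tendsto_const_nhds (f := 𝓝 (0 : G))) (T.continuous.tendsto 0) hT (hT 0) hp
  have h2 : Lp.compMeasurePreserving (T 0) (hT 0) (hg.toLp g) = hg.toLp g := by
    rw [Lp.toLp_compMeasurePreserving hg (hT 0)]
    congr 1
    funext z
    simp [T]
  rw [h2] at h1
  have h3 := (tendsto_iff_edist_tendsto_0).1 h1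
  refine h3.congr fun w => ?_
  rw [Lp.toLp_compMeasurePreserving hg (hT w), Lp.edist_toLp_toLp]
  rfl

/-- A smooth probability density on the line that vanishes outside `(-ε, ε)`. -/
structure Mollifier (ε : ℝ) (α : ℝ → ℝ) : Prop where
  smooth : ContDiff ℝ ∞ α
  nonneg : ∀ x, 0 ≤ α x
  integral_eq_one : ∫ x, α x = 1
  vanish : ∀ x, ε ≤ |x| → α x = 0

theorem exists_mollifier {ε : ℝ} (hε : 0 < ε) : ∃ α, Mollifier ε α := by
  let φ : ContDiffBump (0 : ℝ) := ⟨ε / 2, ε, by positivity, by linarith⟩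
  refine ⟨φ.normed volume, φ.contDiff_normed, φ.nonneg_normed, φ.integral_normed, fun x hx => ?_⟩
  by_contra h
  have : x ∈ Function.support (φ.normed volume) := h
  rw [φ.support_normed_eq, Metric.mem_ball, dist_zero_right, Real.norm_eq_abs] at this
  exact absurd this (not_lt.2 hx)

variable {ε : ℝ} {α : ℝ → ℝ} {f : ℝ × ℝ → ℝ}

namespace Mollifier

variable (h : Mollifier ε α)
include h

theorem tsupport_subset : tsupport α ⊆ Icc (-ε) ε := by
  refine closure_minimal (fun x hx => ?_) isClosed_Icc
  by_contra hn
  refine hx (h.vanish x ?_)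
  by_contra hlt
  exact hn (abs_le.1 (not_le.1 hlt).le)

theorem compact : HasCompactSupport α :=
  HasCompactSupport.of_support_subset_isCompact isCompact_Icc
    ((subset_tsupport α).trans h.tsupport_subset)

theorem smooth_deriv : ContDiff ℝ ∞ (deriv α) := ((contDiff_infty_iff_deriv (𝕜 := ℝ)).1 h.smooth).2

theorem smooth_deriv2 : ContDiff ℝ ∞ (deriv (deriv α)) :=
  ((contDiff_infty_iff_deriv (𝕜 := ℝ)).1 h.smooth_deriv).2

theorem bdd : IsBddCont α := isBddCont_of_compact h.smooth.continuous h.compact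

theorem bdd_deriv : IsBddCont (deriv α) :=
  isBddCont_of_compact h.smooth_deriv.continuous h.compact.deriv

theorem bdd_deriv2 : IsBddCont (deriv (deriv α)) :=
  isBddCont_of_compact h.smooth_deriv2.continuous h.compact.deriv.deriv

theorem integrable : Integrable α := h.smooth.continuous.integrable_of_hasCompactSupport h.compact

theorem integrable_deriv : Integrable (deriv α) :=
  h.smooth_deriv.continuous.integrable_of_hasCompactSupport h.compact.deriv

theorem integrable_deriv2 : Integrable (deriv (deriv α)) :=
  h.smooth_deriv2.continuous.integrable_of_hasCompactSupport h.compact.deriv.deriv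

theorem hasDerivAt (s : ℝ) : HasDerivAt α (deriv α s) s :=
  (h.smooth.differentiable (by simp) s).hasDerivAt

theorem hasDerivAt_deriv (s : ℝ) : HasDerivAt (deriv α) (deriv (deriv α) s) s :=
  (h.smooth_deriv.differentiable (by simp) s).hasDerivAt

theorem kernel_integrable : Integrable (fun w : ℝ × ℝ => α w.1 * α w.2) :=
  h.integrable.mul_prod h.integrable

theorem kernel_integral : ∫ w : ℝ × ℝ, α w.1 * α w.2 = 1 := by
  rw [Measure.volume_eq_prod, integral_prod_mul, h.integral_eq_one, one_mul]

end Mollifier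

theorem conv2_eq_translate (A B : ℝ → ℝ) (g : ℝ × ℝ → ℝ) (t x : ℝ) :
    conv2 A B g t x = ∫ w : ℝ × ℝ, A w.1 * B w.2 * g ((t, x) - w) := by
  rw [← integral_sub_left_eq_self (fun w : ℝ × ℝ => A w.1 * B w.2 * g ((t, x) - w)) volume (t, x)]
  unfold conv2
  congr 1
  funext z
  simp

theorem conv2_translate_integrable {A B : ℝ → ℝ} {g : ℝ × ℝ → ℝ} (hA : IsBddCont A)
    (hB : IsBddCont B) (hg : Integrable g) (t x : ℝ) :
    Integrable (fun w : ℝ × ℝ => A w.1 * B w.2 * g ((t, x) - w)) := by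
  refine ((conv2_integrable hA hB hg t x).comp_sub_left (t, x)).congr (ae_of_all _ fun w => ?_)
  simp

/-- The commutator of mollification and squaring. -/
def defect (α : ℝ → ℝ) (f : ℝ × ℝ → ℝ) (t x : ℝ) : ℝ :=
  conv2 α α (fun z => f z ^ 2) t x - conv2 α α f t x ^ 2

/-- The variance identity E(X − c)² = Var X + (E X − c)² for the averaging measure α ⊗ α, the defect
being the variance. Taking c to be the mean shows that the defect is nonnegative; taking c = f(t, x)
bounds it by squared L² translation differences. -/
theorem integral_kernel_mul_sq (h : Mollifier ε α) (hf : Integrable f)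
    (hf2 : Integrable (fun z => f z ^ 2)) (t x c : ℝ) :
    ∫ w : ℝ × ℝ, α w.1 * α w.2 * (f ((t, x) - w) - c) ^ 2
      = defect α f t x + (conv2 α α f t x - c) ^ 2 := by
  have i1 := conv2_translate_integrable h.bdd h.bdd hf2 t x
  have i2 := (conv2_translate_integrable h.bdd h.bdd hf t x).const_mul (2 * c)
  have i3 := h.kernel_integrable.mul_const (c ^ 2)
  have e1 : ∫ w : ℝ × ℝ, α w.1 * α w.2 * (f ((t, x) - w) - c) ^ 2
      = ∫ w : ℝ × ℝ, ((α w.1 * α w.2 * f ((t, x) - w) ^ 2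
        - 2 * c * (α w.1 * α w.2 * f ((t, x) - w))) + α w.1 * α w.2 * c ^ 2) := by
    congr 1
    funext w
    ring
  rw [e1, integral_add (f := fun w : ℝ × ℝ => _ - _) (i1.sub i2) i3, integral_sub i1 i2, integral_const_mul, integral_mul_const,
    h.kernel_integral, ← conv2_eq_translate α α f, ← conv2_eq_translate α α (fun z => f z ^ 2)]
  unfold defect
  ring

theorem defect_nonneg (h : Mollifier ε α) (hf : Integrable f)
    (hf2 : Integrable (fun z => f z ^ 2)) (t x : ℝ) : 0 ≤ defect α f t x := by
  have h1 := integral_kernel_mul_sq h hf hf2 t x (conv2 α α f t x)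
  rw [sub_self, zero_pow two_ne_zero, add_zero] at h1
  rw [← h1]
  exact integral_nonneg fun w =>
    mul_nonneg (mul_nonneg (h.nonneg _) (h.nonneg _)) (sq_nonneg _)

theorem defect_continuous (h : Mollifier ε α) (hf : Integrable f)
    (hf2 : Integrable (fun z => f z ^ 2)) :
    Continuous (fun p : ℝ × ℝ => defect α f p.1 p.2) :=
  (conv2_continuous h.bdd h.bdd hf2).sub ((conv2_continuous h.bdd h.bdd hf).pow 2)

/-- Integration of an average over a kernel. -/
theorem lintegral_average_le {X : Type*} [MeasurableSpace X] {μ : Measure X} [SFinite μ]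
    (h : Mollifier ε α) {Φ : X → ℝ≥0∞} {N : (ℝ × ℝ) → X → ℝ≥0∞} {δ : ℝ≥0∞}
    (hN : Measurable (Function.uncurry N))
    (hΦ : ∀ x, Φ x ≤ ∫⁻ w : ℝ × ℝ, ‖α w.1 * α w.2‖ₑ * N w x)
    (hδ : ∀ w : ℝ × ℝ, |w.1| < ε → |w.2| < ε → ∫⁻ x, N w x ∂μ ≤ δ) : ∫⁻ x, Φ x ∂μ ≤ δ := by
  have hα := h.smooth.continuous
  have hk : Measurable fun w : ℝ × ℝ => ‖α w.1 * α w.2‖ₑ :=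
    (Continuous.measurable (by fun_prop : Continuous fun w : ℝ × ℝ => α w.1 * α w.2)).enorm
  calc ∫⁻ x, Φ x ∂μ ≤ ∫⁻ x, (∫⁻ w : ℝ × ℝ, ‖α w.1 * α w.2‖ₑ * N w x) ∂μ := lintegral_mono hΦ
    _ = ∫⁻ w : ℝ × ℝ, ∫⁻ x, ‖α w.1 * α w.2‖ₑ * N w x ∂μ := by
        refine lintegral_lintegral_swap (Measurable.aemeasurable ?_)
        exact (hk.comp measurable_snd).mul (hN.comp measurable_swap)
    _ = ∫⁻ w : ℝ × ℝ, ‖α w.1 * α w.2‖ₑ * ∫⁻ x, N w x ∂μ := by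
        congr 1
        funext w
        rw [lintegral_const_mul]
        exact hN.comp measurable_prodMk_left
    _ ≤ ∫⁻ w : ℝ × ℝ, ‖α w.1 * α w.2‖ₑ * δ := by
        refine lintegral_mono fun w => ?_
        by_cases hw : |w.1| < ε ∧ |w.2| < ε
        · exact mul_le_mul_right (hδ w hw.1 hw.2) _
        · have : α w.1 * α w.2 = 0 := by
            rw [not_and_or] at hw
            rcases hw with hw | hw
            · rw [h.vanish _ (not_lt.1 hw), zero_mul]
            · rw [h.vanish _ (not_lt.1 hw), mul_zero]
          simp [this]
    _ = δ := by
        rw [lintegral_mul_const _ hk]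
        have : ∫⁻ w : ℝ × ℝ, ‖α w.1 * α w.2‖ₑ = 1 := by
          rw [← ofReal_integral_norm_eq_lintegral_enorm h.kernel_integrable]
          simp_rw [Real.norm_eq_abs, abs_mul, abs_of_nonneg (h.nonneg _)]
          rw [h.kernel_integral, ENNReal.ofReal_one]
        rw [this, one_mul]

theorem lintegral_defect_le (h : Mollifier ε α) (hfm : Measurable f) (hf : Integrable f)
    (hf2 : Integrable (fun z => f z ^ 2)) {δ : ℝ≥0∞}
    (hδ : ∀ w : ℝ × ℝ, |w.1| < ε → |w.2| < ε → ∫⁻ z, ‖f (z - w) - f z‖ₑ ^ 2 ≤ δ) :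
    ∫⁻ z : ℝ × ℝ, ‖defect α f z.1 z.2‖ₑ ≤ δ := by
  refine lintegral_average_le h (N := fun w z => ‖f (z - w) - f z‖ₑ ^ 2) ?_ (fun z => ?_) hδ
  · have : Measurable fun q : (ℝ × ℝ) × (ℝ × ℝ) => f (q.2 - q.1) - f q.2 :=
      (hfm.comp (measurable_snd.sub measurable_fst)).sub (hfm.comp measurable_snd)
    exact this.enorm.pow_const 2
  · have h1 := integral_kernel_mul_sq h hf hf2 z.1 z.2 (f z)
    have h2 : ‖defect α f z.1 z.2‖ₑ
        ≤ ‖∫ w : ℝ × ℝ, α w.1 * α w.2 * (f ((z.1, z.2) - w) - f z) ^ 2‖ₑ := by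
      rw [h1]
      have := defect_nonneg h hf hf2 z.1 z.2
      rw [← ofReal_norm, ← ofReal_norm, Real.norm_of_nonneg this,
        Real.norm_of_nonneg (by positivity)]
      exact ENNReal.ofReal_le_ofReal (le_add_of_nonneg_right (sq_nonneg _))
    refine h2.trans ((enorm_integral_le_lintegral_enorm _).trans (le_of_eq ?_))
    simp_rw [enorm_mul, enorm_pow]

/-- Integrating the variance bound over space-time leaves an average of ‖f(· − w) − f‖₂² over small
w, which is small by continuity of translations in L². This is where square integrability on strips
is indispensable. -/
theorem exists_defect_small (hfm : Measurable f) (hf : Integrable f)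
    (hf2 : Integrable (fun z => f z ^ 2)) {δ : ℝ} (hδ : 0 < δ) :
    ∃ ε₀ > 0, ∀ ε α, ε ≤ ε₀ → Mollifier ε α →
      Integrable (fun z : ℝ × ℝ => defect α f z.1 z.2) ∧
        ∫ z : ℝ × ℝ, defect α f z.1 z.2 ≤ δ := by
  have hL : MemLp f 2 volume := (memLp_two_iff_integrable_sq hfm.aestronglyMeasurable).2 hf2
  have h1 := eLpNorm_translation_tendsto (p := 2) (by simp) hL
  have h2 : (0 : ℝ≥0∞) < ENNReal.ofReal (√δ) := by
    rw [ENNReal.ofReal_pos]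
    exact Real.sqrt_pos.2 hδ
  obtain ⟨ε₀, hε₀, h3⟩ := Metric.eventually_nhds_iff.1 (h1.eventually (Iio_mem_nhds h2))
  refine ⟨ε₀, hε₀, fun ε α hε h => ?_⟩
  have h4 := lintegral_defect_le h hfm hf hf2 (δ := ENNReal.ofReal δ) (fun w hw1 hw2 => ?_)
  · have hi : Integrable (fun z : ℝ × ℝ => defect α f z.1 z.2) :=
      ⟨(defect_continuous h hf hf2).aestronglyMeasurable,
        lt_of_le_of_lt h4 ENNReal.ofReal_lt_top⟩
    refine ⟨hi, ?_⟩
    rw [← ENNReal.ofReal_le_ofReal_iff hδ.le]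
    refine le_trans (le_of_eq ?_) h4
    rw [← ofReal_integral_norm_eq_lintegral_enorm hi]
    congr 2
    funext z
    rw [Real.norm_of_nonneg (defect_nonneg h hf hf2 _ _)]
  · have h5 : eLpNorm (fun z => f (z - w) - f z) 2 volume < ENNReal.ofReal (√δ) := by
      refine h3 ?_
      rw [dist_zero_right, Prod.norm_def, max_lt_iff]
      exact ⟨hw1.trans_le hε, hw2.trans_le hε⟩
    have h6 := eLpNorm_nnreal_pow_eq_lintegral (μ := (volume : Measure (ℝ × ℝ)))
      (f := fun z => f (z - w) - f z) (p := 2) (by norm_num)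
    have h7 : ∫⁻ z, ‖f (z - w) - f z‖ₑ ^ 2 = eLpNorm (fun z => f (z - w) - f z) 2 volume ^ 2 := by
      simpa using h6.symm
    rw [h7]
    calc _ ≤ ENNReal.ofReal (√δ) ^ 2 := by gcongr
      _ = ENNReal.ofReal δ := by
          rw [← ENNReal.ofReal_pow (Real.sqrt_nonneg _), Real.sq_sqrt hδ.le]

end AugmentedBurgers

/-! ### Equations of the mollified solution and of its primitive -/

namespace AugmentedBurgers

variable {ε : ℝ} {α A B : ℝ → ℝ} {f : ℝ × ℝ → ℝ}

theorem conv2_tendsto {Bn : ℕ → ℝ → ℝ} {C : ℝ} (hA : IsBddCont A) (hBn : ∀ n, Continuous (Bn n))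
    (hC : ∀ n x, |Bn n x| ≤ C) (hlim : ∀ x, Tendsto (fun n => Bn n x) atTop (𝓝 (B x)))
    (hf : Integrable f) (t x : ℝ) :
    Tendsto (fun n => conv2 A (Bn n) f t x) atTop (𝓝 (conv2 A B f t x)) := by
  have h1 := fun n => (conv2_integrable hA ⟨hBn n, C, hC n⟩ hf t x).aestronglyMeasurable
  obtain ⟨hA, D, hD⟩ := hA
  refine tendsto_integral_of_dominated_convergence (fun z => D * C * |f z|) h1
    (hf.abs.const_mul _) (fun n => ae_of_all _ fun z => conv2_bound hD (hC n) t x z)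
    (ae_of_all _ fun z => ?_)
  exact ((hlim (x - z.2)).const_mul _).mul_const _

theorem smear_tendsto {Bn : ℕ → ℝ → ℝ} {C : ℝ} (hBn : ∀ n, Continuous (Bn n))
    (hC : ∀ n x, |Bn n x| ≤ C) (hlim : ∀ x, Tendsto (fun n => Bn n x) atTop (𝓝 (B x))) (z : ℝ) :
    Tendsto (fun n => smear (Bn n) z) atTop (𝓝 (smear B z)) := by
  refine tendsto_integral_of_dominated_convergence (fun w => K w * C)
    (fun n => (smear_integrand_integrable ⟨hBn n, C, hC n⟩ z).aestronglyMeasurable)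
    (K_integrable.mul_const C) (fun n => ae_of_all _ fun w => ?_)
    (ae_of_all _ fun w => (hlim (z - w)).const_mul _)
  rw [Real.norm_eq_abs, abs_mul, abs_of_nonneg (K_nonneg w)]
  exact mul_le_mul_of_nonneg_left (hC _ _) (K_nonneg w)

/-- The primitive of a mollifier, a smoothed Heaviside function. -/
def primitive (α : ℝ → ℝ) (z : ℝ) : ℝ := ∫ y in Iic z, α y

namespace Mollifier

variable (h : Mollifier ε α)
include h

theorem primitive_hasDerivAt (z : ℝ) : HasDerivAt (primitive α) (α z) z := by
  have h1 : primitive α = fun z => (∫ y in Iic (0 : ℝ), α y) + ∫ y in (0 : ℝ)..z, α y := by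
    funext z
    rw [← intervalIntegral.integral_Iic_sub_Iic h.integrable.integrableOn h.integrable.integrableOn]
    unfold primitive
    ring
  rw [h1]
  exact (h.smooth.continuous.integral_hasStrictDerivAt 0 z).hasDerivAt.const_add _

theorem primitive_smooth : ContDiff ℝ ∞ (primitive α) := by
  refine (contDiff_infty_iff_deriv (𝕜 := ℝ)).2
    ⟨fun z => (h.primitive_hasDerivAt z).differentiableAt, ?_⟩
  rw [funext fun z => (h.primitive_hasDerivAt z).deriv]
  exact h.smooth

theorem primitive_nonneg (z : ℝ) : 0 ≤ primitive α z :=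
  setIntegral_nonneg measurableSet_Iic fun y _ => h.nonneg y

theorem primitive_le_one (z : ℝ) : primitive α z ≤ 1 := by
  rw [← h.integral_eq_one]
  exact setIntegral_le_integral h.integrable (ae_of_all _ h.nonneg)

theorem primitive_abs_le (z : ℝ) : |primitive α z| ≤ 1 := by
  rw [abs_of_nonneg (h.primitive_nonneg z)]
  exact h.primitive_le_one z

theorem primitive_eq_zero {z : ℝ} (hz : z ≤ -ε) : primitive α z = 0 := by
  refine setIntegral_eq_zero_of_forall_eq_zero fun y hy => h.vanish y ?_
  have : y ≤ z := hy
  exact le_trans (by linarith) (neg_le_abs y)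

theorem primitive_eq_one {z : ℝ} (hz : ε ≤ z) : primitive α z = 1 := by
  rw [← h.integral_eq_one]
  refine setIntegral_eq_integral_of_forall_compl_eq_zero fun y hy => h.vanish y ?_
  have : z < y := not_le.1 hy
  exact le_trans (by linarith) (le_abs_self y)

theorem primitive_bdd : IsBddCont (primitive α) :=
  ⟨h.primitive_smooth.continuous, 1, h.primitive_abs_le⟩

end Mollifier

section equations

variable {a b M t : ℝ} (hf : StripSolution a b M f) (h : Mollifier ε α)
  (ht : ∀ s, |t - s| ≤ ε → s ∈ Ioo a b)
include hf h ht

/-- The equation of the mollified solution. -/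
theorem mollified_equation (x : ℝ) :
    conv2 (deriv α) α f t x = 1 / 2 * conv2 α (deriv α) (fun z => f z ^ 2) t x
      + conv2 α (deriv (deriv α)) f t x + (conv2 α (smear α) f t x - conv2 α α f t x)
      + conv2 α (deriv α) f t x :=
  hf.eqn α α h.smooth h.compact h.smooth h.compact t x fun s hs =>
    ht s (abs_le.2 (h.tsupport_subset hs))

/-- The equation of the primitive of the mollified solution. -/
theorem primitive_equation (x : ℝ) :
    conv2 (deriv α) (primitive α) f t x = 1 / 2 * conv2 α α (fun z => f z ^ 2) t x
      + conv2 α (deriv α) f t x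
      + (conv2 α (smear (primitive α)) f t x - conv2 α (primitive α) f t x)
      + conv2 α α f t x := by
  -- The smoothed Heaviside function is not compactly supported, so its difference with its
  -- translate by n is tested instead. The step at n escapes to infinity, and the bounds uniform in
  -- n allow dominated convergence.
  let Bn : ℕ → ℝ → ℝ := fun n z => primitive α z - primitive α (z - n)
  have d0 : ∀ n, deriv (Bn n) = fun z => α z - α (z - n) := fun n => by
    funext z
    exact ((h.primitive_hasDerivAt z).sub
      ((h.primitive_hasDerivAt (z - n)).comp_sub_const z n)).deriv
  have d1 : ∀ n, deriv (deriv (Bn n)) = fun z => deriv α z - deriv α (z - n) := fun n => by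
    rw [d0]
    funext z
    exact ((h.hasDerivAt z).sub ((h.hasDerivAt (z - n)).comp_sub_const z n)).deriv
  have s0 : ∀ n, ContDiff ℝ ∞ (Bn n) := fun n =>
    h.primitive_smooth.sub (h.primitive_smooth.comp (contDiff_id.sub contDiff_const))
  have s1 : ∀ n, ContDiff ℝ ∞ (deriv (Bn n)) := fun n =>
    ((contDiff_infty_iff_deriv (𝕜 := ℝ)).1 (s0 n)).2
  have s2 : ∀ n, ContDiff ℝ ∞ (deriv (deriv (Bn n))) := fun n =>
    ((contDiff_infty_iff_deriv (𝕜 := ℝ)).1 (s1 n)).2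
  have c0 : ∀ n, HasCompactSupport (Bn n) := fun n => by
    refine HasCompactSupport.intro (isCompact_Icc (a := -ε) (b := n + ε)) fun z hz => ?_
    have hn : (0 : ℝ) ≤ n := n.cast_nonneg
    rcases le_or_gt z (-ε) with h1 | h1
    · simp only [Bn]
      rw [h.primitive_eq_zero h1, h.primitive_eq_zero (by linarith), sub_zero]
    · have h2 : n + ε < z := by
        by_contra h3
        exact hz ⟨h1.le, not_lt.1 h3⟩
      simp only [Bn]
      rw [h.primitive_eq_one (by linarith), h.primitive_eq_one (by linarith), sub_self]
  have b0 : ∀ n x, |Bn n x| ≤ 1 + 1 := fun n x =>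
    (abs_sub _ _).trans (add_le_add (h.primitive_abs_le _) (h.primitive_abs_le _))
  obtain ⟨C0, hC0⟩ := h.bdd.2
  obtain ⟨C1, hC1⟩ := h.bdd_deriv.2
  have b1 : ∀ n x, |deriv (Bn n) x| ≤ C0 + C0 := fun n x => by
    rw [d0]
    exact (abs_sub _ _).trans (add_le_add (hC0 _) (hC0 _))
  have b2 : ∀ n x, |deriv (deriv (Bn n)) x| ≤ C1 + C1 := fun n x => by
    rw [d1]
    exact (abs_sub _ _).trans (add_le_add (hC1 _) (hC1 _))
  have far : ∀ z : ℝ, ∀ᶠ n : ℕ in atTop, z - n < -ε := fun z => by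
    obtain ⟨N, hN⟩ := exists_nat_gt (z + ε)
    filter_upwards [eventually_ge_atTop N] with n hn
    have : (N : ℝ) ≤ n := by exact_mod_cast hn
    linarith
  have l0 : ∀ z, Tendsto (fun n => Bn n z) atTop (𝓝 (primitive α z)) := fun z => by
    refine tendsto_const_nhds.congr' ?_
    filter_upwards [far z] with n hn
    simp only [Bn]
    rw [h.primitive_eq_zero hn.le, sub_zero]
  have l1 : ∀ z, Tendsto (fun n => deriv (Bn n) z) atTop (𝓝 (α z)) := fun z => by
    refine tendsto_const_nhds.congr' ?_
    filter_upwards [far z] with n hn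
    rw [d0]
    beta_reduce
    rw [h.vanish (z - n) (le_trans (by linarith) (neg_le_abs _)), sub_zero]
  have l2 : ∀ z, Tendsto (fun n => deriv (deriv (Bn n)) z) atTop (𝓝 (deriv α z)) := fun z => by
    refine tendsto_const_nhds.congr' ?_
    filter_upwards [far z] with n hn
    rw [d1]
    have : deriv α (z - n) = 0 := by
      by_contra h0
      have := (h.tsupport_subset (support_deriv_subset h0)).1
      linarith
    beta_reduce
    rw [this, sub_zero]
  have key := fun n => hf.eqn α (Bn n) h.smooth h.compact (s0 n) (c0 n) t x fun s hs =>
    ht s (abs_le.2 (h.tsupport_subset hs))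
  have L := conv2_tendsto h.bdd_deriv (fun n => (s0 n).continuous) b0 l0 hf.integrable t x
  have R1 := conv2_tendsto h.bdd (fun n => (s1 n).continuous) b1 l1 hf.sq_integrable t x
  have R2 := conv2_tendsto h.bdd (fun n => (s2 n).continuous) b2 l2 hf.integrable t x
  have R3 := conv2_tendsto h.bdd
    (fun n => (smear_isBddCont ⟨(s0 n).continuous, _, b0 n⟩).1) (fun n => smear_abs_le (b0 n))
    (smear_tendsto (fun n => (s0 n).continuous) b0 l0) hf.integrable t x
  have R4 := conv2_tendsto h.bdd (fun n => (s0 n).continuous) b0 l0 hf.integrable t x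
  have R5 := conv2_tendsto h.bdd (fun n => (s1 n).continuous) b1 l1 hf.integrable t x
  refine tendsto_nhds_unique L (Tendsto.congr (fun n => (key n).symm) ?_)
  exact (((R1.const_mul _).add R2).add (R3.sub R4)).add R5

end equations

/-- The mollified solution converges in `L¹` at each time. -/
theorem exists_mollified_close {a b M t δ : ℝ} (hf : StripSolution a b M f) (ht : t ∈ Ioo a b)
    (hδ : 0 < δ) : ∃ ε₀ > 0, ∀ ε α, ε ≤ ε₀ → Mollifier ε α →
      ∫ x, |conv2 α α f t x - f (t, x)| ≤ δ := by
  obtain ⟨ε₁, hε₁, h1⟩ := hf.cont t ht (δ / 2) (by positivity)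
  have hL : MemLp (fun x => f (t, x)) 1 volume := memLp_one_iff_integrable.2 (hf.slice t)
  have h2 := eLpNorm_translation_tendsto (p := 1) (by simp) hL
  have h3 : (0 : ℝ≥0∞) < ENNReal.ofReal (δ / 2) := ENNReal.ofReal_pos.2 (by positivity)
  obtain ⟨ε₂, hε₂, h4⟩ := Metric.eventually_nhds_iff.1 (h2.eventually (Iio_mem_nhds h3))
  refine ⟨min ε₁ ε₂, lt_min hε₁ hε₂, fun ε α hε h => ?_⟩
  have hi : Integrable (fun x => conv2 α α f t x - f (t, x)) :=
    (conv2_integrable_slice h.bdd h.bdd h.integrable hf.integrable t).sub (hf.slice t)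
  have hfm := hf.measurable
  have key : ∫⁻ x, ‖conv2 α α f t x - f (t, x)‖ₑ ≤ ENNReal.ofReal δ := by
    refine lintegral_average_le h (N := fun w x => ‖f ((t, x) - w) - f (t, x)‖ₑ) ?_
      (fun x => ?_) (fun w hw1 hw2 => ?_)
    · have : Measurable fun q : (ℝ × ℝ) × ℝ => f ((t, q.2) - q.1) - f (t, q.2) :=
        (hfm.comp ((measurable_const.prodMk measurable_snd).sub measurable_fst)).sub
          (hfm.comp (measurable_const.prodMk measurable_snd))
      exact this.enorm
    · have e : conv2 α α f t x - f (t, x)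
          = ∫ w : ℝ × ℝ, α w.1 * α w.2 * (f ((t, x) - w) - f (t, x)) := by
        simp_rw [mul_sub]
        rw [integral_sub (conv2_translate_integrable h.bdd h.bdd hf.integrable t x)
          (h.kernel_integrable.mul_const _), integral_mul_const, h.kernel_integral, one_mul,
          conv2_eq_translate]
      rw [e]
      refine (enorm_integral_le_lintegral_enorm _).trans (le_of_eq ?_)
      simp_rw [enorm_mul]
    · have e1 : ∫⁻ x, ‖f (t - w.1, x - w.2) - f (t, x - w.2)‖ₑ ≤ ENNReal.ofReal (δ / 2) := by
        rw [lintegral_sub_right_eq_self (fun x => ‖f (t - w.1, x) - f (t, x)‖ₑ) w.2,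
          ← ofReal_integral_norm_eq_lintegral_enorm (f := fun x => f (t - w.1, x) - f (t, x))
            ((hf.slice _).sub (hf.slice t))]
        refine ENNReal.ofReal_le_ofReal (h1 _ ?_)
        rw [sub_sub_cancel_left, abs_neg]
        exact hw1.trans_le (hε.trans (min_le_left _ _))
      have e2 : ∫⁻ x, ‖f (t, x - w.2) - f (t, x)‖ₑ ≤ ENNReal.ofReal (δ / 2) := by
        have := h4 (y := w.2) (by
          rw [dist_zero_right]
          exact hw2.trans_le (hε.trans (min_le_right _ _)))
        rw [eLpNorm_one_eq_lintegral_enorm] at this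
        exact this.le
      calc ∫⁻ x, ‖f ((t, x) - w) - f (t, x)‖ₑ
          ≤ ∫⁻ x, (‖f (t - w.1, x - w.2) - f (t, x - w.2)‖ₑ + ‖f (t, x - w.2) - f (t, x)‖ₑ) := by
            refine lintegral_mono fun x => ?_
            refine le_trans (le_of_eq ?_) (enorm_add_le _ _)
            rw [sub_add_sub_cancel]
            rfl
        _ = _ + _ := lintegral_add_left (Measurable.enorm (by fun_prop)) _
        _ ≤ ENNReal.ofReal (δ / 2) + ENNReal.ofReal (δ / 2) := add_le_add e1 e2
        _ = ENNReal.ofReal δ := by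
            rw [← ENNReal.ofReal_add (by positivity) (by positivity), add_halves]
  rw [← ENNReal.ofReal_le_ofReal_iff hδ.le]
  exact (ofReal_integral_norm_eq_lintegral_enorm hi).trans_le key

end AugmentedBurgers

namespace AugmentedBurgers

/-! ### The drifted heat kernel -/

/-- An unnormalised solution of `H_τ = H_yy - H_y`. -/
def heat (τ y : ℝ) : ℝ := Real.exp (-(y - τ) ^ 2 / (4 * τ)) / √τ

/-- The first space derivative of `heat`. -/
def heat1 (τ y : ℝ) : ℝ := -((y - τ) / (2 * τ)) * heat τ y

/-- The second space derivative of `heat`. -/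
def heat2 (τ y : ℝ) : ℝ := ((y - τ) ^ 2 / (4 * τ ^ 2) - 1 / (2 * τ)) * heat τ y

theorem heat_nonneg (τ y : ℝ) : 0 ≤ heat τ y := by
  unfold heat
  positivity

theorem heat_hasDerivAt_space (τ y : ℝ) : HasDerivAt (heat τ) (heat1 τ y) y := by
  have h1 : HasDerivAt (fun y : ℝ => -(y - τ) ^ 2 / (4 * τ)) (-(2 * (y - τ)) / (4 * τ)) y := by
    have := ((((hasDerivAt_id y).sub_const τ).pow 2).neg).div_const (4 * τ)
    simpa using this
  refine (h1.exp.div_const (√τ)).congr_deriv ?_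
  unfold heat1 heat
  by_cases hτ : τ = 0
  · simp [hτ]
  · field_simp
    ring

theorem heat1_hasDerivAt_space {τ : ℝ} (hτ : τ ≠ 0) (y : ℝ) :
    HasDerivAt (heat1 τ) (heat2 τ y) y := by
  have h1 : HasDerivAt (fun y : ℝ => -((y - τ) / (2 * τ))) (-(1 / (2 * τ))) y :=
    (((hasDerivAt_id y).sub_const τ).div_const (2 * τ)).neg
  refine (h1.mul (heat_hasDerivAt_space τ y)).congr_deriv ?_
  unfold heat2 heat1
  field_simp
  ring

theorem heat_hasDerivAt_time {τ : ℝ} (hτ : 0 < τ) (y : ℝ) :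
    HasDerivAt (fun τ => heat τ y) (heat2 τ y - heat1 τ y) τ := by
  have hne : τ ≠ 0 := hτ.ne'
  have h1 : HasDerivAt (fun τ : ℝ => -(y - τ) ^ 2 / (4 * τ))
      ((2 * (y - τ) * (4 * τ) + (y - τ) ^ 2 * 4) / (4 * τ) ^ 2) τ := by
    have ha : HasDerivAt (fun τ : ℝ => -(y - τ) ^ 2) (2 * (y - τ)) τ := by
      exact (((hasDerivAt_id τ).const_sub y).pow 2).neg.congr_deriv (by simp)
    have hb : HasDerivAt (fun τ : ℝ => 4 * τ) 4 τ := by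
      simpa using (hasDerivAt_id τ).const_mul 4
    refine (ha.div hb (by positivity)).congr_deriv ?_
    ring
  have hs : √τ ≠ 0 := (Real.sqrt_pos.2 hτ).ne'
  have h2 : HasDerivAt (fun τ : ℝ => √τ) (1 / (2 * √τ)) τ := Real.hasDerivAt_sqrt hne
  refine (h1.exp.div h2 hs).congr_deriv ?_
  unfold heat2 heat1 heat
  have hsq : √τ ^ 2 = τ := Real.sq_sqrt hτ.le
  have h3 : ∀ E : ℝ, (E * ((2 * (y - τ) * (4 * τ) + (y - τ) ^ 2 * 4) / (4 * τ) ^ 2) * √τ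
      - E * (1 / (2 * √τ))) / √τ ^ 2 = (E / √τ) *
      ((2 * (y - τ) * (4 * τ) + (y - τ) ^ 2 * 4) / (4 * τ) ^ 2 - 1 / (2 * √τ ^ 2)) := by
    intro E
    field_simp
  rw [h3, hsq]
  field_simp
  ring

theorem heat_continuous (τ : ℝ) : Continuous (heat τ) :=
  continuous_iff_continuousAt.2 fun y => (heat_hasDerivAt_space τ y).continuousAt

theorem heat1_continuous (τ : ℝ) : Continuous (heat1 τ) := by
  have := heat_continuous τ
  unfold heat1
  fun_prop

theorem heat2_continuous (τ : ℝ) : Continuous (heat2 τ) := by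
  have := heat_continuous τ
  unfold heat2
  fun_prop

theorem one_add_mul_exp_neg_le {x : ℝ} (_ : 0 ≤ x) :
    (1 + x) * Real.exp (-x) ≤ 2 * Real.exp (-(x / 2)) := by
  have h1 := Real.add_one_le_exp (x / 2)
  have h2 : Real.exp (-x) = Real.exp (-(x / 2)) * Real.exp (-(x / 2)) := by
    rw [← Real.exp_add]
    ring_nf
  have h3 : Real.exp (x / 2) * Real.exp (-(x / 2)) = 1 := by
    rw [← Real.exp_add]
    simp
  have h4 := Real.exp_pos (-(x / 2))
  rw [h2]
  nlinarith [mul_nonneg h4.le h4.le]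

/-- A Gaussian majorant of the heat kernel and its derivatives on a compact range of times. -/
theorem exists_heat_majorant {η T : ℝ} (hη : 0 < η) (hT : η ≤ T) :
    ∃ D : ℝ → ℝ, Integrable D ∧ ∀ τ ∈ Icc η T, ∀ y,
      |heat τ y| ≤ D y ∧ |heat1 τ y| ≤ D y ∧ |heat2 τ y| ≤ D y := by
  have hT0 : 0 < T := hη.trans_le hT
  refine ⟨fun y => (1 + 1 / η) * (2 / √η * Real.exp (T / 8)) * Real.exp (-(1 / (16 * T)) * y ^ 2),
    (integrable_exp_neg_mul_sq (by positivity)).const_mul _, fun τ hτ y => ?_⟩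
  have hτ0 : 0 < τ := hη.trans_le hτ.1
  set x := (y - τ) ^ 2 / (4 * τ) with hx
  have hx0 : 0 ≤ x := by positivity
  have hh : heat τ y = Real.exp (-x) / √τ := by
    unfold heat
    rw [hx, neg_div]
  have hsη : 0 < √η := Real.sqrt_pos.2 hη
  have hsτ : √η ≤ √τ := Real.sqrt_le_sqrt hτ.1
  have e1 : Real.exp (-(x / 2)) ≤ Real.exp (T / 8) * Real.exp (-(1 / (16 * T)) * y ^ 2) := by
    rw [← Real.exp_add, Real.exp_le_exp]
    have k1 : (y - τ) ^ 2 / (8 * T) ≤ x / 2 := by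
      rw [hx, div_div]
      refine div_le_div_of_nonneg_left (sq_nonneg _) (by positivity) ?_
      linarith [hτ.2]
    -- From (y − 2τ)² ≥ 0 one gets (y − τ)² ≥ y²/2 − τ², which absorbs the drift into a constant.
    have k2 : y ^ 2 / 2 - T ^ 2 ≤ (y - τ) ^ 2 := by
      nlinarith [sq_nonneg (y - 2 * τ), hτ.2]
    have k3 : (y ^ 2 / 2 - T ^ 2) / (8 * T) ≤ (y - τ) ^ 2 / (8 * T) :=
      div_le_div_of_nonneg_right k2 (by positivity)
    have k4 : (y ^ 2 / 2 - T ^ 2) / (8 * T) = 1 / (16 * T) * y ^ 2 - T / 8 := by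
      field_simp
      ring
    linarith
  have e2 : (1 + x) * heat τ y
      ≤ 2 / √η * Real.exp (T / 8) * Real.exp (-(1 / (16 * T)) * y ^ 2) := by
    calc (1 + x) * heat τ y = ((1 + x) * Real.exp (-x)) / √τ := by rw [hh]; ring
      _ ≤ (2 * (Real.exp (T / 8) * Real.exp (-(1 / (16 * T)) * y ^ 2))) / √η := by
          refine div_le_div₀ (by positivity) ?_ hsη hsτ
          exact (one_add_mul_exp_neg_le hx0).trans (by linarith)
      _ = _ := by ring
  -- The polynomial prefactors of the kernel and of its two derivatives are all at most (1 + 1/η)(1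
  -- + x), and half of the Gaussian decay absorbs the factor 1 + x.
  have main : ∀ c : ℝ, |c| ≤ (1 + 1 / η) * (1 + x) → |c * heat τ y|
      ≤ (1 + 1 / η) * (2 / √η * Real.exp (T / 8)) * Real.exp (-(1 / (16 * T)) * y ^ 2) := by
    intro c hc
    rw [abs_mul, abs_of_nonneg (heat_nonneg τ y)]
    calc |c| * heat τ y ≤ (1 + 1 / η) * (1 + x) * heat τ y :=
          mul_le_mul_of_nonneg_right hc (heat_nonneg τ y)
      _ = (1 + 1 / η) * ((1 + x) * heat τ y) := by ring
      _ ≤ (1 + 1 / η) * (2 / √η * Real.exp (T / 8) * Real.exp (-(1 / (16 * T)) * y ^ 2)) :=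
          mul_le_mul_of_nonneg_left e2 (by positivity)
      _ = _ := by ring
  have hinv : 1 / τ ≤ 1 / η := one_div_le_one_div_of_le hη hτ.1
  have hτi : 0 < 1 / τ := by positivity
  refine ⟨?_, main _ ?_, main _ ?_⟩
  · have := main 1 (by
      rw [abs_one]
      have : 0 ≤ 1 / η := by positivity
      nlinarith)
    rwa [one_mul] at this
  · rw [abs_neg, abs_div, abs_of_pos (by positivity : 0 < 2 * τ)]
    have k1 : |y - τ| / (2 * τ) ≤ (1 / τ + x) / 2 := by
      rw [hx]
      have : (1 / τ + (y - τ) ^ 2 / (4 * τ)) / 2 - |y - τ| / (2 * τ)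
          = (|y - τ| - 2) ^ 2 / (8 * τ) := by
        rw [← sq_abs (y - τ)]
        field_simp
        ring
      have h0 : 0 ≤ (|y - τ| - 2) ^ 2 / (8 * τ) := by positivity
      linarith
    nlinarith
  · have k1 : (y - τ) ^ 2 / (4 * τ ^ 2) = x * (1 / τ) := by
      rw [hx]
      field_simp
    have k2 : 1 / (2 * τ) = (1 / τ) / 2 := by
      field_simp
    rw [k1, k2]
    rw [abs_le]
    constructor <;> nlinarith

theorem heat1_integrable {τ : ℝ} (hτ : 0 < τ) : Integrable (heat1 τ) := by
  obtain ⟨D, hD, h⟩ := exists_heat_majorant hτ le_rfl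
  exact hD.mono' (heat1_continuous τ).aestronglyMeasurable
    (ae_of_all _ fun y => (h τ ⟨le_rfl, le_rfl⟩ y).2.1)

theorem heat_integrable {τ : ℝ} (hτ : 0 < τ) : Integrable (heat τ) := by
  obtain ⟨D, hD, h⟩ := exists_heat_majorant hτ le_rfl
  exact hD.mono' (heat_continuous τ).aestronglyMeasurable
    (ae_of_all _ fun y => (h τ ⟨le_rfl, le_rfl⟩ y).1)

theorem heat_le {η τ : ℝ} (hη : 0 < η) (hτ : η ≤ τ) (y : ℝ) : heat τ y ≤ 1 / √η := by
  unfold heat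
  refine div_le_div₀ zero_le_one ?_ (Real.sqrt_pos.2 hη) (Real.sqrt_le_sqrt hτ)
  rw [Real.exp_le_one_iff]
  have : 0 < τ := hη.trans_le hτ
  rw [neg_div]
  exact neg_nonpos.2 (by positivity)

/-- With r = |y − τ|/(2√τ) the derivative is r e^(−r²)/τ in absolute value, and r ≤ 1 + r²/2 ≤
e^(r²/2) reduces it to a wider Gaussian. The constant is not sharp and does not reach the final
estimate; only the rate τ^(-1/2) matters. -/
theorem heat1_integral_le {τ : ℝ} (hτ : 0 < τ) :
    ∫ y, |heat1 τ y| ≤ √(8 * Real.pi) / √τ := by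
  have hs : 0 < √τ := Real.sqrt_pos.2 hτ
  have hsq : √τ ^ 2 = τ := Real.sq_sqrt hτ.le
  have hi : Integrable (fun y => Real.exp (-(1 / (8 * τ)) * (y - τ) ^ 2) / τ) :=
    ((integrable_exp_neg_mul_sq (by positivity)).comp_sub_right τ).div_const τ
  calc ∫ y, |heat1 τ y| ≤ ∫ y, Real.exp (-(1 / (8 * τ)) * (y - τ) ^ 2) / τ := by
        refine integral_mono (heat1_integrable hτ).abs hi fun y => ?_
        set r := |y - τ| / (2 * √τ) with hr
        have hr0 : 0 ≤ r := by positivity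
        have hr2 : r ^ 2 = (y - τ) ^ 2 / (4 * τ) := by
          rw [hr, div_pow, sq_abs, mul_pow, hsq]
          norm_num
        have h1 : |heat1 τ y| = r * Real.exp (-r ^ 2) / τ := by
          unfold heat1 heat
          rw [abs_mul, abs_neg, abs_div, abs_of_pos (by positivity : 0 < 2 * τ),
            abs_of_nonneg (a := _ / √τ) (by positivity), neg_div, ← hr2]
          generalize Real.exp (-r ^ 2) = E
          rw [hr]
          field_simp
        have h2 : -(1 / (8 * τ)) * (y - τ) ^ 2 = -(r ^ 2 / 2) := by
          rw [hr2]
          field_simp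
          ring
        beta_reduce
        rw [h1, h2]
        refine div_le_div_of_nonneg_right ?_ hτ.le
        have h3 := Real.add_one_le_exp (r ^ 2 / 2)
        have h4 : Real.exp (-r ^ 2) * Real.exp (r ^ 2 / 2) = Real.exp (-(r ^ 2 / 2)) := by
          rw [← Real.exp_add]
          ring_nf
        rw [← h4, mul_comm]
        refine mul_le_mul_of_nonneg_left ?_ (Real.exp_pos _).le
        nlinarith [sq_nonneg (r - 1)]
    _ = √(8 * Real.pi) / √τ := by
        rw [integral_div, integral_sub_right_eq_self
          (fun y => Real.exp (-(1 / (8 * τ)) * y ^ 2)) τ, integral_gaussian]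
        have h2 : Real.pi / (1 / (8 * τ)) = 8 * Real.pi * τ := by
          field_simp
        rw [h2, Real.sqrt_mul (by positivity)]
        nth_rewrite 2 [← hsq]
        field_simp

/-- The difference is the integral of the derivative over the translates between the two centres;
Tonelli and translation invariance conclude. -/
theorem integral_abs_translate_sub_le {g g' : ℝ → ℝ} (hg : ∀ y, HasDerivAt g (g' y) y)
    (hc : Continuous g') (hi : Integrable g') (hgi : Integrable g) (c₁ c₂ : ℝ) :
    ∫ y, |g (y - c₁) - g (y - c₂)| ≤ |c₁ - c₂| * ∫ y, |g' y| := by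
  have hd : Integrable (fun y => g (y - c₁) - g (y - c₂)) :=
    (hgi.comp_sub_right c₁).sub (hgi.comp_sub_right c₂)
  have hpos : 0 ≤ |c₁ - c₂| * ∫ y, |g' y| :=
    mul_nonneg (abs_nonneg _) (integral_nonneg fun _ => abs_nonneg _)
  rw [← ENNReal.ofReal_le_ofReal_iff hpos]
  refine (ofReal_integral_norm_eq_lintegral_enorm hd).trans_le ?_
  calc ∫⁻ y, ‖g (y - c₁) - g (y - c₂)‖ₑ
      ≤ ∫⁻ y, ∫⁻ r in uIoc c₂ c₁, ‖g' (y - r)‖ₑ := by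
        refine lintegral_mono fun y => ?_
        have h1 : ∫ r in c₂..c₁, -g' (y - r) = g (y - c₁) - g (y - c₂) :=
          intervalIntegral.integral_eq_sub_of_hasDerivAt
            (fun r _ => (hg (y - r)).comp_const_sub y r)
            (Continuous.intervalIntegrable (by fun_prop) _ _)
        rw [← h1, ← ofReal_norm, intervalIntegral.norm_intervalIntegral_eq, ofReal_norm]
        refine (enorm_integral_le_lintegral_enorm _).trans (le_of_eq ?_)
        simp_rw [enorm_neg]
    _ = ∫⁻ r in uIoc c₂ c₁, ∫⁻ y, ‖g' (y - r)‖ₑ := by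
        refine lintegral_lintegral_swap (Measurable.aemeasurable ?_)
        have : Continuous fun q : ℝ × ℝ => g' (q.1 - q.2) := by fun_prop
        exact this.measurable.enorm
    _ = ∫⁻ r in uIoc c₂ c₁, ∫⁻ y, ‖g' y‖ₑ := by
        congr 1
        funext r
        exact lintegral_sub_right_eq_self (fun y => ‖g' y‖ₑ) r
    _ = ENNReal.ofReal (|c₁ - c₂| * ∫ y, |g' y|) := by
        rw [setLIntegral_const, Real.volume_uIoc, ENNReal.ofReal_mul (abs_nonneg _), mul_comm,
          ← ofReal_integral_norm_eq_lintegral_enorm hi]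
        rfl

theorem heat_translate_le {τ : ℝ} (hτ : 0 < τ) (c₁ c₂ : ℝ) :
    ∫ y, |heat τ (y - c₁) - heat τ (y - c₂)| ≤ |c₁ - c₂| * (√(8 * Real.pi) / √τ) :=
  (integral_abs_translate_sub_le (heat_hasDerivAt_space τ) (heat1_continuous τ)
    (heat1_integrable hτ) (heat_integrable hτ) c₁ c₂).trans
    (mul_le_mul_of_nonneg_left (heat1_integral_le hτ) (abs_nonneg _))

/-- The heat kernel is an approximate identity. -/
theorem heat_tendsto {w : ℝ → ℝ} (hw : IsBddCont w) (c : ℝ) :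
    Tendsto (fun η => ∫ y, w y * heat η (y - c)) (𝓝[>] 0) (𝓝 (2 * √Real.pi * w c)) := by
  have hwc := hw.1
  obtain ⟨C, hC⟩ := hw.2
  -- Substituting y = c + η + √η z, drift included, turns the kernel into the fixed Gaussian
  -- e^(−z²/4). Its total mass 2√π is the normalisation missing from `heat`.
  have h1 : ∀ η : ℝ, 0 < η → ∫ y, w y * heat η (y - c)
      = ∫ z, w (c + η + √η * z) * Real.exp (-(1 / 4) * z ^ 2) := by
    intro η hη
    have hs : 0 < √η := Real.sqrt_pos.2 hη
    have hsq : √η ^ 2 = η := Real.sq_sqrt hη.le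
    have e1 := Measure.integral_comp_mul_left (fun y => w (c + η + y) * heat η (η + y)) (√η)
    have e2 := integral_add_left_eq_self (μ := (volume : Measure ℝ))
      (fun y => w y * heat η (y - c)) (c + η)
    have e3 : (fun y => w (c + η + y) * heat η (η + y))
        = fun y => w (c + η + y) * heat η (c + η + y - c) := by
      funext y
      rw [show c + η + y - c = η + y by ring]
    have e6 := (congrArg (fun g : ℝ → ℝ => ∫ y, g y) e3).trans e2
    beta_reduce at e1 e6
    rw [e6] at e1
    have e4 : ∫ y, w y * heat η (y - c)
        = √η * ∫ z, w (c + η + √η * z) * heat η (η + √η * z) := by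
      rw [e1, abs_of_pos (inv_pos.2 hs), smul_eq_mul, ← mul_assoc, mul_inv_cancel₀ hs.ne', one_mul]
    rw [e4, ← integral_const_mul]
    congr 1
    funext z
    unfold heat
    have e5 : -(η + √η * z - η) ^ 2 / (4 * η) = -(1 / 4) * z ^ 2 := by
      have : (η + √η * z - η) ^ 2 = η * z ^ 2 := by
        rw [add_sub_cancel_left, mul_pow, hsq]
      rw [this]
      field_simp
    rw [e5]
    field_simp
  have h2 : 2 * √Real.pi * w c = ∫ z : ℝ, w c * Real.exp (-(1 / 4) * z ^ 2) := by
    rw [integral_const_mul, integral_gaussian]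
    have : Real.pi / (1 / 4) = 2 ^ 2 * Real.pi := by ring
    rw [this, Real.sqrt_mul (by positivity), Real.sqrt_sq (by norm_num)]
    ring
  rw [h2]
  have h3 : Tendsto (fun η => ∫ z, w (c + η + √η * z) * Real.exp (-(1 / 4) * z ^ 2)) (𝓝[>] 0)
      (𝓝 (∫ z : ℝ, w c * Real.exp (-(1 / 4) * z ^ 2))) := by
    refine tendsto_integral_filter_of_dominated_convergence
      (fun z => C * Real.exp (-(1 / 4) * z ^ 2)) (Eventually.of_forall fun η => ?_)
      (Eventually.of_forall fun η => ae_of_all _ fun z => ?_)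
      ((integrable_exp_neg_mul_sq (by norm_num)).const_mul _) (ae_of_all _ fun z => ?_)
    · exact Continuous.aestronglyMeasurable (by fun_prop)
    · rw [Real.norm_eq_abs, abs_mul, Real.abs_exp]
      exact mul_le_mul_of_nonneg_right (hC _) (Real.exp_pos _).le
    · have : Continuous fun η : ℝ => w (c + η + √η * z) * Real.exp (-(1 / 4) * z ^ 2) := by
        fun_prop
      have := this.tendsto 0
      simp only [Real.sqrt_zero, zero_mul, add_zero] at this
      exact this.mono_left nhdsWithin_le_nhds
  refine h3.congr' ?_
  filter_upwards [self_mem_nhdsWithin] with η hη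
  exact (h1 η hη).symm

end AugmentedBurgers

namespace AugmentedBurgers

/-! ### The Cole–Hopf transform -/

theorem IsBddCont.mul {A B : ℝ → ℝ} (hA : IsBddCont A) (hB : IsBddCont B) :
    IsBddCont (fun x => A x * B x) := by
  obtain ⟨hA, C, hC⟩ := hA
  obtain ⟨hB, D, hD⟩ := hB
  exact ⟨hA.mul hB, C * D, fun x => (abs_mul _ _).trans_le
    (mul_le_mul (hC x) (hD x) (abs_nonneg _) ((abs_nonneg _).trans (hC 0)))⟩

theorem IsBddCont.const_mul {A : ℝ → ℝ} (hA : IsBddCont A) (c : ℝ) :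
    IsBddCont (fun x => c * A x) :=
  IsBddCont.mul ⟨continuous_const, |c|, fun _ => le_rfl⟩ hA

theorem IsBddCont.exp {A : ℝ → ℝ} (hA : IsBddCont A) : IsBddCont (fun x => Real.exp (A x)) := by
  obtain ⟨hA, C, hC⟩ := hA
  exact ⟨hA.rexp, Real.exp C, fun x => by
    rw [Real.abs_exp]
    exact Real.exp_le_exp.2 ((le_abs_self _).trans (hC x))⟩

theorem IsBddCont.mul_integrable {A g : ℝ → ℝ} (hA : IsBddCont A) (hg : Integrable g) :
    Integrable (fun x => A x * g x) := by
  obtain ⟨hA, C, hC⟩ := hA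
  exact hg.bdd_mul (c := C) hA.aestronglyMeasurable (ae_of_all _ hC)

theorem conv2_isBddCont {A B : ℝ → ℝ} {f : ℝ × ℝ → ℝ} (hA : IsBddCont A) (hB : IsBddCont B)
    (hf : Integrable f) (t : ℝ) : IsBddCont (conv2 A B f t) := by
  obtain ⟨C, hC⟩ := conv2_abs_le hA hB hf
  exact ⟨conv2_slice_continuous hA hB hf t, C, hC t⟩

/-- The Cole–Hopf transform of the mollified solution. -/
def coleHopf (α : ℝ → ℝ) (f : ℝ × ℝ → ℝ) (t x : ℝ) : ℝ :=
  Real.exp (1 / 2 * conv2 α (primitive α) f t x)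

/-- The source term in the equation `W_t = W_xx + W_x + F` of the Cole–Hopf transform. -/
def coleHopfSource (α : ℝ → ℝ) (f : ℝ × ℝ → ℝ) (t x : ℝ) : ℝ :=
  1 / 2 * coleHopf α f t x * (1 / 2 * defect α f t x
    + (conv2 α (smear (primitive α)) f t x - conv2 α (primitive α) f t x))

variable {ε a b M t : ℝ} {α : ℝ → ℝ} {f : ℝ × ℝ → ℝ}

theorem heat2_integrable {τ : ℝ} (hτ : 0 < τ) : Integrable (heat2 τ) := by
  obtain ⟨D, hD, h⟩ := exists_heat_majorant hτ le_rfl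
  exact hD.mono' (heat2_continuous τ).aestronglyMeasurable
    (ae_of_all _ fun y => (h τ ⟨le_rfl, le_rfl⟩ y).2.2)

theorem coleHopf_isBddCont (hf : StripSolution a b M f) (h : Mollifier ε α) (t : ℝ) :
    IsBddCont (coleHopf α f t) :=
  ((conv2_isBddCont h.bdd h.primitive_bdd hf.integrable t).const_mul _).exp

theorem defect_isBddCont (hf : StripSolution a b M f) (h : Mollifier ε α) (t : ℝ) :
    IsBddCont (defect α f t) := by
  have h1 := conv2_isBddCont h.bdd h.bdd hf.integrable t
  have e : defect α f t
      = fun x => conv2 α α (fun z => f z ^ 2) t x - conv2 α α f t x * conv2 α α f t x := by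
    funext x
    rw [defect, sq]
  rw [e]
  exact (conv2_isBddCont h.bdd h.bdd hf.sq_integrable t).sub (h1.mul h1)

theorem coleHopfSource_isBddCont (hf : StripSolution a b M f) (h : Mollifier ε α) (t : ℝ) :
    IsBddCont (coleHopfSource α f t) :=
  ((coleHopf_isBddCont hf h t).const_mul _).mul (((defect_isBddCont hf h t).const_mul _).add
    ((conv2_isBddCont h.bdd (smear_isBddCont h.primitive_bdd) hf.integrable t).sub
      (conv2_isBddCont h.bdd h.primitive_bdd hf.integrable t)))

/-- Duhamel's principle in weak form: s ↦ `heat (T - s)` solves the backward equation adjoint to W_t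
= W_xx + W_x, so only the source survives in the derivative of the pairing. -/
theorem coleHopf_pairing_hasDerivAt (hf : StripSolution a b M f) (h : Mollifier ε α) {s T : ℝ}
    (hs : ∀ r, |s - r| ≤ ε → r ∈ Ioo a b) (hsT : s < T) (c : ℝ) :
    HasDerivAt (fun s => ∫ y, coleHopf α f s y * heat (T - s) (y - c))
      (∫ y, coleHopfSource α f s y * heat (T - s) (y - c)) s := by
  -- For times within η of s, the remaining time T − r stays in [η, 3η], so a single Gaussian
  -- majorant dominates all the kernels.
  set η := (T - s) / 2 with hη
  have hη0 : 0 < η := by linarith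
  have hτ : 0 < T - s := by linarith
  obtain ⟨C₁, hC₁⟩ := conv2_abs_le h.bdd h.primitive_bdd hf.integrable
  obtain ⟨C₂, hC₂⟩ := conv2_abs_le h.bdd_deriv h.primitive_bdd hf.integrable
  obtain ⟨D, hD, hDb⟩ := exists_heat_majorant (T := 3 * η) hη0 (by linarith)
  let Wt : ℝ → ℝ → ℝ := fun s y => 1 / 2 * coleHopf α f s y * conv2 (deriv α) (primitive α) f s y
  let Wx : ℝ → ℝ := fun y => 1 / 2 * coleHopf α f s y * conv2 α α f s y
  have bW := coleHopf_isBddCont hf h s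
  have bv := conv2_isBddCont h.bdd h.bdd hf.integrable s
  have bWx : IsBddCont Wx := (bW.const_mul _).mul bv
  have bWt : IsBddCont (Wt s) :=
    (bW.const_mul _).mul (conv2_isBddCont h.bdd_deriv h.primitive_bdd hf.integrable s)
  have hW1 : ∀ s y, |coleHopf α f s y| ≤ Real.exp (1 / 2 * C₁) := fun s y => by
    rw [coleHopf, Real.abs_exp, Real.exp_le_exp]
    have := (le_abs_self _).trans (hC₁ s y)
    linarith
  have hW2 : ∀ s y, |Wt s y| ≤ 1 / 2 * Real.exp (1 / 2 * C₁) * C₂ := fun s y => by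
    simp only [Wt]
    rw [abs_mul, abs_mul, abs_of_pos (by norm_num : (0 : ℝ) < 1 / 2)]
    have := hW1 s y
    exact mul_le_mul (by linarith) (hC₂ s y) (abs_nonneg _) (by positivity)
  have dW : ∀ s y, HasDerivAt (fun s => coleHopf α f s y) (Wt s y) s := fun s y => by
    refine ((conv2_hasDerivAt_time h.bdd h.bdd_deriv h.primitive_bdd h.hasDerivAt hf.integrable
      s y).const_mul (1 / 2)).exp.congr_deriv ?_
    simp only [Wt, coleHopf]
    ring
  have dWx : ∀ y, HasDerivAt (coleHopf α f s) (Wx y) y := fun y => by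
    refine ((conv2_hasDerivAt_space h.bdd h.primitive_bdd h.bdd h.primitive_hasDerivAt
      hf.integrable s y).const_mul (1 / 2)).exp.congr_deriv ?_
    simp only [Wx, coleHopf]
    ring
  have dv : ∀ y, HasDerivAt (conv2 α α f s) (conv2 α (deriv α) f s y) y :=
    conv2_hasDerivAt_space h.bdd h.bdd h.bdd_deriv h.hasDerivAt hf.integrable s
  have i0 := (heat_integrable hτ).comp_sub_right c
  have i1 := (heat1_integrable hτ).comp_sub_right c
  have i2 := (heat2_integrable hτ).comp_sub_right c
  have key := hasDerivAt_integral_of_dominated_loc_of_deriv_le (μ := volume) (x₀ := s)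
    (s := Ioo (s - η) (s + η))
    (F := fun s y => coleHopf α f s y * heat (T - s) (y - c))
    (F' := fun s y => Wt s y * heat (T - s) (y - c)
      - coleHopf α f s y * (heat2 (T - s) (y - c) - heat1 (T - s) (y - c)))
    (bound := fun y => (1 / 2 * Real.exp (1 / 2 * C₁) * C₂ + 2 * Real.exp (1 / 2 * C₁)) * D (y - c))
    (Ioo_mem_nhds (by linarith) (by linarith))
    (Eventually.of_forall fun r => ?_) (bW.mul_integrable i0) ?_ (ae_of_all _ fun y r hr => ?_)
    ((hD.comp_sub_right c).const_mul _) (ae_of_all _ fun y r hr => ?_)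
  · refine key.2.congr_deriv ?_
    -- By the equation for W, the time derivative of the integrand minus the source term is the
    -- x-derivative of W_x H − W H_x + W H, with H the kernel, so its integral vanishes.
    have hpde : ∀ y, HasDerivAt
        (fun y => Wx y * heat (T - s) (y - c) - coleHopf α f s y * heat1 (T - s) (y - c)
          + coleHopf α f s y * heat (T - s) (y - c))
        (Wt s y * heat (T - s) (y - c)
          - coleHopf α f s y * (heat2 (T - s) (y - c) - heat1 (T - s) (y - c))
          - coleHopfSource α f s y * heat (T - s) (y - c)) y := by
      intro y
      have d0 := (heat_hasDerivAt_space (T - s) (y - c)).comp_sub_const y c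
      have d1 := (heat1_hasDerivAt_space hτ.ne' (y - c)).comp_sub_const y c
      have dd := (((dWx y).const_mul (1 / 2)).mul (dv y)).mul d0
      refine ((dd.sub ((dWx y).mul d1)).add ((dWx y).mul d0)).congr_deriv ?_
      have e := primitive_equation hf h hs y
      simp only [Wt, Wx, coleHopfSource, defect]
      rw [e]
      simp only [Pi.mul_apply]
      ring
    have j1 := bWt.mul_integrable i0
    have j2 := bW.mul_integrable (i2.sub i1)
    have j3 := (coleHopfSource_isBddCont hf h s).mul_integrable i0
    have z := integral_eq_zero_of_hasDerivAt_of_integrable hpde ((j1.sub j2).sub j3)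
      (((bWx.mul_integrable i0).sub (bW.mul_integrable i1)).add (bW.mul_integrable i0))
    rw [integral_sub (key.1) j3, sub_eq_zero] at z
    exact z
  · exact ((coleHopf_isBddCont hf h r).1.mul
      ((heat_continuous _).comp (continuous_id.sub continuous_const))).aestronglyMeasurable
  · exact ((bWt.mul_integrable i0).sub (bW.mul_integrable (i2.sub i1))).aestronglyMeasurable
  · have hr' : T - r ∈ Icc η (3 * η) := ⟨by linarith [hr.2], by linarith [hr.1]⟩
    obtain ⟨k0, k1, k2⟩ := hDb (T - r) hr' (y - c)
    have hD0 : 0 ≤ D (y - c) := (abs_nonneg _).trans k0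
    rw [Real.norm_eq_abs]
    calc _ ≤ |Wt r y| * |heat (T - r) (y - c)|
          + |coleHopf α f r y| * (|heat2 (T - r) (y - c)| + |heat1 (T - r) (y - c)|) := by
          refine (abs_sub _ _).trans ?_
          rw [abs_mul (Wt r y), abs_mul (coleHopf α f r y)]
          exact add_le_add le_rfl (mul_le_mul_of_nonneg_left (abs_sub _ _) (abs_nonneg _))
      _ ≤ 1 / 2 * Real.exp (1 / 2 * C₁) * C₂ * D (y - c)
          + Real.exp (1 / 2 * C₁) * (D (y - c) + D (y - c)) := by
          refine add_le_add (mul_le_mul (hW2 r y) k0 (abs_nonneg _)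
            ((abs_nonneg _).trans (hW2 r y))) (mul_le_mul (hW1 r y) (add_le_add k2 k1)
            (by positivity) (by positivity))
      _ = _ := by ring
  · have hr' : 0 < T - r := by linarith [hr.2]
    have := (heat_hasDerivAt_time hr' (y - c)).comp_const_sub T r
    refine ((dW r y).mul this).congr_deriv ?_
    ring

end AugmentedBurgers

/-! ### Lipschitz bound for the Cole–Hopf transform and boundedness at positive times -/

namespace AugmentedBurgers

variable {ε a b M : ℝ} {α : ℝ → ℝ} {f : ℝ × ℝ → ℝ}

theorem StripSolution.mass_nonneg (hf : StripSolution a b M f) : 0 ≤ M :=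
  (integral_nonneg fun _ => abs_nonneg _).trans (hf.mass 0)

theorem coleHopf_le (hf : StripSolution a b M f) (h : Mollifier ε α) (t x : ℝ) :
    coleHopf α f t x ≤ Real.exp (M / 2) := by
  have := conv2_abs_le_of_slices h.bdd h.nonneg h.integrable h.integral_eq_one h.primitive_bdd
    h.primitive_abs_le hf.integrable hf.slice hf.mass t x
  rw [coleHopf, Real.exp_le_exp]
  linarith [(le_abs_self _).trans this]

theorem coleHopf_nonneg (t x : ℝ) : 0 ≤ coleHopf α f t x := (Real.exp_pos _).le

/-- The nonlocal part K*V − V is at most 2M in absolute value, since K is a probability density and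
|V| ≤ M. The defect is left unestimated: it is small only after integration in space-time. -/
theorem coleHopfSource_abs_le (hf : StripSolution a b M f) (h : Mollifier ε α) (t x : ℝ) :
    |coleHopfSource α f t x| ≤ Real.exp (M / 2) * (1 / 4 * defect α f t x + M) := by
  have hS : IsBddCont (fun z => smear (primitive α) z - primitive α z) :=
    (smear_isBddCont h.primitive_bdd).sub h.primitive_bdd
  have hQ := conv2_abs_le_of_slices (C := 1 + 1) h.bdd h.nonneg h.integrable h.integral_eq_one hS
    (fun z => (abs_sub _ _).trans
      (add_le_add (smear_abs_le h.primitive_abs_le z) (h.primitive_abs_le z)))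
    hf.integrable hf.slice hf.mass t x
  rw [conv2_linear_kernel h.bdd (smear_isBddCont h.primitive_bdd) h.primitive_bdd
    hf.integrable] at hQ
  have hR := defect_nonneg h hf.integrable hf.sq_integrable t x
  have hW := coleHopf_le hf h t x
  have hW0 := coleHopf_nonneg (α := α) (f := f) t x
  unfold coleHopfSource
  rw [abs_mul, abs_of_nonneg (by positivity : 0 ≤ 1 / 2 * coleHopf α f t x)]
  calc _ ≤ 1 / 2 * coleHopf α f t x * (1 / 2 * defect α f t x + (1 + 1) * M) := by
        refine mul_le_mul_of_nonneg_left ((abs_add_le _ _).trans (add_le_add ?_ hQ)) (by positivity)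
        rw [abs_of_nonneg (by positivity)]
    _ = coleHopf α f t x * (1 / 4 * defect α f t x + M) := by ring
    _ ≤ _ := mul_le_mul_of_nonneg_right hW (by have := hf.mass_nonneg; positivity)

theorem defect_slice_integrable (hf : StripSolution a b M f) (h : Mollifier ε α) (t : ℝ) :
    Integrable (defect α f t) := by
  have h1 := conv2_integrable_slice h.bdd h.bdd h.integrable hf.integrable t
  have h2 := conv2_integrable_slice h.bdd h.bdd h.integrable hf.sq_integrable t
  refine (h2.sub ((conv2_isBddCont h.bdd h.bdd hf.integrable t).mul_integrable h1)).congr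
    (ae_of_all _ fun x => ?_)
  simp only [defect, Pi.sub_apply, sq]

theorem integral_defect_slices_le {δ s t : ℝ} (hst : s ≤ t) (hf : StripSolution a b M f)
    (h : Mollifier ε α) (hi : Integrable (fun z : ℝ × ℝ => defect α f z.1 z.2))
    (hδ : ∫ z : ℝ × ℝ, defect α f z.1 z.2 ≤ δ) :
    Integrable (fun r => ∫ y, defect α f r y) ∧ ∫ r in s..t, ∫ y, defect α f r y ≤ δ := by
  rw [Measure.volume_eq_prod] at hi hδ
  refine ⟨hi.integral_prod_left, le_trans ?_ hδ⟩
  rw [integral_prod _ hi, intervalIntegral.integral_of_le hst]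
  exact setIntegral_le_integral hi.integral_prod_left (ae_of_all _ fun r =>
    integral_nonneg fun y => defect_nonneg h hf.integrable hf.sq_integrable r y)

/-- Comparing the pairings at two centres produces the factor |c₁ − c₂| from the L¹ modulus of
translation of the kernel. The terminal time T = t + η keeps the kernel bounded by 1/√η, so that the
defect, controlled only in L¹, costs E/(4√η) · δ with E = exp(M/2); this vanishes when the
mollification is removed at fixed η. -/
theorem coleHopf_pairing_sub_le (hf : StripSolution a b M f) (h : Mollifier ε α) {s t η δ : ℝ}
    (hst : s ≤ t) (hη : 0 < η) (hr : ∀ r ∈ Icc s t, ∀ r', |r - r'| ≤ ε → r' ∈ Ioo a b)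
    (hi : Integrable (fun z : ℝ × ℝ => defect α f z.1 z.2))
    (hδ : ∫ z : ℝ × ℝ, defect α f z.1 z.2 ≤ δ) (c₁ c₂ : ℝ) :
    (∫ y, coleHopf α f t y * heat η (y - c₁)) - ∫ y, coleHopf α f t y * heat η (y - c₂)
      ≤ |c₁ - c₂| * (Real.exp (M / 2) * √(8 * Real.pi)
          * (1 / √(t - s + η) + 2 * M * √(t - s + η))) + Real.exp (M / 2) / (4 * √η) * δ := by
  set E := Real.exp (M / 2) with hE
  have hE0 : 0 < E := Real.exp_pos _
  have hM := hf.mass_nonneg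
  set T := t + η with hT
  let k : ℝ → ℝ → ℝ := fun r y => heat (T - r) (y - c₁) - heat (T - r) (y - c₂)
  let J : ℝ → ℝ := fun r => (∫ y, coleHopf α f r y * heat (T - r) (y - c₁))
    - ∫ y, coleHopf α f r y * heat (T - r) (y - c₂)
  have hτ : ∀ r ∈ Icc s t, η ≤ T - r := fun r hr => by linarith [hr.2]
  have ki : ∀ r ∈ Icc s t, Integrable (k r) := fun r hr =>
    ((heat_integrable (hη.trans_le (hτ r hr))).comp_sub_right c₁).sub
      ((heat_integrable (hη.trans_le (hτ r hr))).comp_sub_right c₂)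
  have kb : ∀ r ∈ Icc s t, ∀ y, |k r y| ≤ 1 / √η := fun r hr y => by
    have h1 := heat_nonneg (T - r) (y - c₁)
    have h2 := heat_nonneg (T - r) (y - c₂)
    have h3 := heat_le hη (hτ r hr) (y - c₁)
    have h4 := heat_le hη (hτ r hr) (y - c₂)
    exact abs_le.2 ⟨by simp only [k]; linarith, by simp only [k]; linarith⟩
  have kl : ∀ r ∈ Icc s t, ∫ y, |k r y| ≤ |c₁ - c₂| * (√(8 * Real.pi) / √(T - r)) :=
    fun r hr => heat_translate_le (hη.trans_le (hτ r hr)) c₁ c₂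
  have dJ : ∀ r ∈ Icc s t, HasDerivAt J (∫ y, coleHopfSource α f r y * k r y) r := fun r hr' => by
    have hrT : r < T := by linarith [hr'.2]
    have h0 := hη.trans_le (hτ r hr')
    have bF := coleHopfSource_isBddCont hf h r
    refine ((coleHopf_pairing_hasDerivAt hf h (hr r hr') hrT c₁).sub
      (coleHopf_pairing_hasDerivAt hf h (hr r hr') hrT c₂)).congr_deriv ?_
    rw [← integral_sub (bF.mul_integrable ((heat_integrable h0).comp_sub_right c₁))
      (bF.mul_integrable ((heat_integrable h0).comp_sub_right c₂))]
    congr 1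
    funext y
    simp only [k]
    ring
  -- The defect is paired with the sup of the kernel difference, the bounded source with its L¹
  -- norm. The latter gives (T − r)^(-1/2), integrable in r uniformly in η.
  let φ : ℝ → ℝ := fun r => E / (4 * √η) * (∫ y, defect α f r y)
    + E * M * |c₁ - c₂| * √(8 * Real.pi) * (1 / √(T - r))
  have dJle : ∀ r ∈ Icc s t, ∫ y, coleHopfSource α f r y * k r y ≤ φ r := fun r hr => by
    calc _ ≤ ∫ y, (E / (4 * √η) * defect α f r y + E * M * |k r y|) := by
          refine (le_abs_self _).trans (abs_integral_le_of_abs_le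
            (((defect_slice_integrable hf h r).const_mul _).add ((ki r hr).abs.const_mul _))
            fun y => ?_)
          have hd := defect_nonneg h hf.integrable hf.sq_integrable r y
          rw [abs_mul]
          calc _ ≤ E * (1 / 4 * defect α f r y + M) * |k r y| :=
                mul_le_mul_of_nonneg_right (coleHopfSource_abs_le hf h r y) (abs_nonneg _)
            _ = E / 4 * defect α f r y * |k r y| + E * M * |k r y| := by ring
            _ ≤ E / 4 * defect α f r y * (1 / √η) + E * M * |k r y| :=
                add_le_add (mul_le_mul_of_nonneg_left (kb r hr y) (by positivity)) le_rfl
            _ = _ := by ring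
      _ = E / (4 * √η) * (∫ y, defect α f r y) + E * M * ∫ y, |k r y| := by
          rw [integral_add ((defect_slice_integrable hf h r).const_mul _)
            ((ki r hr).abs.const_mul _), integral_const_mul, integral_const_mul]
      _ ≤ E / (4 * √η) * (∫ y, defect α f r y)
            + E * M * (|c₁ - c₂| * (√(8 * Real.pi) / √(T - r))) :=
          add_le_add le_rfl (mul_le_mul_of_nonneg_left (kl r hr) (by positivity))
      _ = φ r := by
          simp only [φ]
          ring
  obtain ⟨ri, rle⟩ := integral_defect_slices_le hst hf h hi hδ
  have sc : ContinuousOn (fun r => 1 / √(T - r)) (Icc s t) := by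
    refine continuousOn_const.div (by fun_prop) fun r hr => ?_
    exact (Real.sqrt_pos.2 (hη.trans_le (hτ r hr))).ne'
  have si : IntervalIntegrable (fun r => 1 / √(T - r)) volume s t :=
    (uIcc_of_le hst ▸ sc).intervalIntegrable
  have sv : ∫ r in s..t, 1 / √(T - r) = 2 * √(T - s) - 2 * √(T - t) := by
    have := intervalIntegral.integral_eq_sub_of_hasDerivAt (f := fun r => -(2 * √(T - r)))
      (f' := fun r => 1 / √(T - r)) (a := s) (b := t) (fun r hr => ?_) si
    · rw [this]
      ring
    · rw [uIcc_of_le hst] at hr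
      have h0 := hη.trans_le (hτ r hr)
      have h1 : √(T - r) ≠ 0 := (Real.sqrt_pos.2 h0).ne'
      have := (((Real.hasDerivAt_sqrt h0.ne').comp_const_sub T r).const_mul 2).neg
      refine this.congr_deriv ?_
      field_simp
  have main := intervalIntegral.sub_le_integral_of_hasDeriv_right_of_le hst
    (g := J) (φ := φ) (fun r hr => (dJ r hr).continuousAt.continuousWithinAt)
    (fun r hr => (dJ r (Ioo_subset_Icc_self hr)).hasDerivWithinAt)
    ((ri.integrableOn.const_mul _).add ((sc.integrableOn_Icc).const_mul _))
    (fun r hr => dJle r (Ioo_subset_Icc_self hr))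
  have φi : ∫ r in s..t, φ r ≤ E / (4 * √η) * δ
      + E * M * |c₁ - c₂| * √(8 * Real.pi) * (2 * √(T - s)) := by
    simp only [φ]
    rw [intervalIntegral.integral_add (ri.intervalIntegrable.const_mul _) (si.const_mul _),
      intervalIntegral.integral_const_mul, intervalIntegral.integral_const_mul, sv]
    refine add_le_add (mul_le_mul_of_nonneg_left rle (by positivity))
      (mul_le_mul_of_nonneg_left ?_ (by positivity))
    linarith [Real.sqrt_nonneg (T - t)]
  have J0 : J s ≤ E * (|c₁ - c₂| * (√(8 * Real.pi) / √(T - s))) := by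
    have hs : s ∈ Icc s t := ⟨le_rfl, hst⟩
    have bW := coleHopf_isBddCont hf h s
    have h0 := hη.trans_le (hτ s hs)
    calc J s = ∫ y, coleHopf α f s y * k s y := by
          simp only [J]
          rw [← integral_sub (bW.mul_integrable ((heat_integrable h0).comp_sub_right c₁))
            (bW.mul_integrable ((heat_integrable h0).comp_sub_right c₂))]
          congr 1
          funext y
          simp only [k]
          ring
      _ ≤ ∫ y, E * |k s y| := by
          refine (le_abs_self _).trans (abs_integral_le_of_abs_le ((ki s hs).abs.const_mul _)
            fun y => ?_)
          rw [abs_mul, abs_of_nonneg (coleHopf_nonneg s y)]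
          exact mul_le_mul_of_nonneg_right (coleHopf_le hf h s y) (abs_nonneg _)
      _ = E * ∫ y, |k s y| := integral_const_mul _ _
      _ ≤ _ := mul_le_mul_of_nonneg_left (kl s hs) hE0.le
  have hTt : T - t = η := by rw [hT]; ring
  have hTs : T - s = t - s + η := by rw [hT]; ring
  have hJt : J t = (∫ y, coleHopf α f t y * heat η (y - c₁))
      - ∫ y, coleHopf α f t y * heat η (y - c₂) := by
    simp only [J, hTt]
  rw [hTs] at J0 φi
  rw [← hJt]
  calc J t ≤ J s + ∫ r in s..t, φ r := by linarith
    _ ≤ _ := add_le_add J0 φi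
    _ = _ := by ring

/-- Identifies V as the primitive of v vanishing at −∞, so that L¹ convergence of v at time t gives
pointwise convergence of V. -/
theorem conv2_primitive_eq_integral (hf : StripSolution a b M f) (h : Mollifier ε α) (t x : ℝ) :
    conv2 α (primitive α) f t x = ∫ y in Iic x, conv2 α α f t y := by
  have hlim : Tendsto (conv2 α (primitive α) f t) atBot (𝓝 0) := by
    have h0 : (0 : ℝ) = ∫ z : ℝ × ℝ, α (t - z.1) * 0 * f z := by simp
    rw [h0]
    obtain ⟨C, hC⟩ := h.bdd.2
    refine tendsto_integral_filter_of_dominated_convergence (fun z => C * 1 * |f z|)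
      (Eventually.of_forall fun x =>
        (conv2_integrable h.bdd h.primitive_bdd hf.integrable t x).aestronglyMeasurable)
      (Eventually.of_forall fun x => ae_of_all _ fun z =>
        conv2_bound hC h.primitive_abs_le t x z)
      (hf.integrable.abs.const_mul _) (ae_of_all _ fun z => ?_)
    refine tendsto_const_nhds.congr' ?_
    filter_upwards [eventually_le_atBot (z.2 - ε)] with x hx
    rw [h.primitive_eq_zero (by linarith)]
  have hd : ∀ y, HasDerivAt (conv2 α (primitive α) f t) (conv2 α α f t y) y :=
    conv2_hasDerivAt_space h.bdd h.primitive_bdd h.bdd h.primitive_hasDerivAt hf.integrable t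
  rw [integral_Iic_of_hasDerivAt_of_tendsto (hd x).continuousAt.continuousWithinAt
    (fun y _ => hd y)
    (conv2_integrable_slice h.bdd h.bdd h.integrable hf.integrable t).integrableOn hlim, sub_zero]

/-- The Cole–Hopf transform at a fixed time. -/
def coleHopfSlice (f : ℝ × ℝ → ℝ) (t x : ℝ) : ℝ :=
  Real.exp (1 / 2 * ∫ y in Iic x, f (t, y))

theorem abs_integral_Iic_le (hf : StripSolution a b M f) (t x : ℝ) :
    |∫ y in Iic x, f (t, y)| ≤ M :=
  calc _ ≤ ∫ y in Iic x, |f (t, y)| := abs_integral_le_integral_abs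
    _ ≤ ∫ y, |f (t, y)| := setIntegral_le_integral (hf.slice t).abs (ae_of_all _ fun _ =>
        abs_nonneg _)
    _ ≤ M := hf.mass t

theorem integral_Iic_eq_add {g : ℝ → ℝ} (hg : Integrable g) :
    (fun x => ∫ y in Iic x, g y) = fun x => (∫ y in Iic (0 : ℝ), g y) + ∫ y in (0 : ℝ)..x, g y := by
  funext x
  rw [← intervalIntegral.integral_Iic_sub_Iic hg.integrableOn hg.integrableOn]
  ring

theorem coleHopfSlice_isBddCont (hf : StripSolution a b M f) (t : ℝ) :
    IsBddCont (coleHopfSlice f t) := by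
  refine IsBddCont.exp (IsBddCont.const_mul ⟨?_, M, abs_integral_Iic_le hf t⟩ _)
  rw [integral_Iic_eq_add (hf.slice t)]
  exact continuous_const.add (intervalIntegral.continuous_primitive
    (fun a b => (hf.slice t).intervalIntegrable) 0)

theorem exists_good_mollifiers (hf : StripSolution a b M f) {s t : ℝ} (hs : a < s) (hst : s ≤ t)
    (ht : t < b) (δ : ℝ) (hδ : 0 < δ) :
    ∃ ε α, Mollifier ε α ∧ (∀ r ∈ Icc s t, ∀ r', |r - r'| ≤ ε → r' ∈ Ioo a b) ∧
      Integrable (fun z : ℝ × ℝ => defect α f z.1 z.2) ∧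
      ∫ z : ℝ × ℝ, defect α f z.1 z.2 ≤ δ ∧
      ∫ x, |conv2 α α f t x - f (t, x)| ≤ δ ∧ ∫ x, |conv2 α α f s x - f (s, x)| ≤ δ := by
  obtain ⟨ε₁, h₁, H₁⟩ := exists_defect_small hf.measurable hf.integrable hf.sq_integrable hδ
  obtain ⟨ε₂, h₂, H₂⟩ := exists_mollified_close hf ⟨hs.trans_le hst, ht⟩ hδ
  obtain ⟨ε₃, h₃, H₃⟩ := exists_mollified_close hf ⟨hs, hst.trans_lt ht⟩ hδ
  set ε := min (min ε₁ (min ε₂ ε₃)) (min ((s - a) / 2) ((b - t) / 2)) with hε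
  have hε0 : 0 < ε := lt_min (lt_min h₁ (lt_min h₂ h₃)) (lt_min (by linarith) (by linarith))
  have e1 : ε ≤ ε₁ := (min_le_left _ _).trans (min_le_left _ _)
  have e2 : ε ≤ ε₂ := (min_le_left _ _).trans ((min_le_right _ _).trans (min_le_left _ _))
  have e3 : ε ≤ ε₃ := (min_le_left _ _).trans ((min_le_right _ _).trans (min_le_right _ _))
  have e4 : ε ≤ (s - a) / 2 := (min_le_right _ _).trans (min_le_left _ _)
  have e5 : ε ≤ (b - t) / 2 := (min_le_right _ _).trans (min_le_right _ _)
  obtain ⟨α, h⟩ := exists_mollifier hε0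
  refine ⟨ε, α, h, fun r hr r' hr' => ?_, (H₁ ε α e1 h).1, (H₁ ε α e1 h).2, H₂ ε α e2 h,
    H₃ ε α e3 h⟩
  have := abs_le.1 hr'
  exact ⟨by linarith [hr.1], by linarith [hr.2]⟩

/-- The mollification is removed with η fixed, which eliminates the defect term. What remains is
bounded as η → 0. -/
theorem coleHopfSlice_pairing_sub_le (hf : StripSolution a b M f) {s t η : ℝ}
    (hs : a < s) (hst : s ≤ t) (ht : t < b) (hη : 0 < η) (c₁ c₂ : ℝ) :
    (∫ y, coleHopfSlice f t y * heat η (y - c₁)) - ∫ y, coleHopfSlice f t y * heat η (y - c₂)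
      ≤ |c₁ - c₂| * (Real.exp (M / 2) * √(8 * Real.pi)
          * (1 / √(t - s + η) + 2 * M * √(t - s + η))) := by
  have hδ : ∀ n : ℕ, (0 : ℝ) < 1 / ((n : ℝ) + 1) := fun n => by positivity
  choose ε α hα hr hi hd hc _ using fun n : ℕ => exists_good_mollifiers hf hs hst ht _ (hδ n)
  have hlim0 : Tendsto (fun n : ℕ => 1 / ((n : ℝ) + 1)) atTop (𝓝 0) :=
    tendsto_one_div_add_atTop_nhds_zero_nat
  have hV : ∀ y, Tendsto (fun n => conv2 (α n) (primitive (α n)) f t y) atTop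
      (𝓝 (∫ y in Iic y, f (t, y))) := fun y => by
    rw [tendsto_iff_norm_sub_tendsto_zero]
    refine squeeze_zero (fun _ => norm_nonneg _) (fun n => ?_) hlim0
    have i1 := conv2_integrable_slice (hα n).bdd (hα n).bdd (hα n).integrable hf.integrable t
    rw [conv2_primitive_eq_integral hf (hα n),
      ← integral_sub i1.integrableOn (hf.slice t).integrableOn]
    calc _ ≤ ∫ x in Iic y, |conv2 (α n) (α n) f t x - f (t, x)| := abs_integral_le_integral_abs
      _ ≤ ∫ x, |conv2 (α n) (α n) f t x - f (t, x)| :=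
          setIntegral_le_integral (i1.sub (hf.slice t)).abs (ae_of_all _ fun _ => abs_nonneg _)
      _ ≤ _ := hc n
  have hW : ∀ c, Tendsto (fun n => ∫ y, coleHopf (α n) f t y * heat η (y - c)) atTop
      (𝓝 (∫ y, coleHopfSlice f t y * heat η (y - c))) := fun c => by
    have ih := (heat_integrable hη).comp_sub_right c
    refine tendsto_integral_of_dominated_convergence
      (fun y => Real.exp (M / 2) * heat η (y - c))
      (fun n => ((coleHopf_isBddCont hf (hα n) t).mul_integrable ih).aestronglyMeasurable)
      (ih.const_mul _) (fun n => ae_of_all _ fun y => ?_) (ae_of_all _ fun y => ?_)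
    · rw [Real.norm_eq_abs, abs_mul, abs_of_nonneg (coleHopf_nonneg _ _),
        abs_of_nonneg (heat_nonneg _ _)]
      exact mul_le_mul_of_nonneg_right (coleHopf_le hf (hα n) t y) (heat_nonneg _ _)
    · exact (((hV y).const_mul (1 / 2)).rexp).mul_const _
  have hR : Tendsto (fun n : ℕ => |c₁ - c₂| * (Real.exp (M / 2) * √(8 * Real.pi)
      * (1 / √(t - s + η) + 2 * M * √(t - s + η)))
      + Real.exp (M / 2) / (4 * √η) * (1 / ((n : ℝ) + 1))) atTop
      (𝓝 (|c₁ - c₂| * (Real.exp (M / 2) * √(8 * Real.pi)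
      * (1 / √(t - s + η) + 2 * M * √(t - s + η))) + Real.exp (M / 2) / (4 * √η) * 0)) :=
    tendsto_const_nhds.add (hlim0.const_mul _)
  rw [mul_zero, add_zero] at hR
  exact le_of_tendsto_of_tendsto' ((hW c₁).sub (hW c₂)) hR fun n =>
    coleHopf_pairing_sub_le hf (hα n) hst hη (hr n) (hi n) (hd n) c₁ c₂

/-- The bound on the spatial Lipschitz constant of the Cole–Hopf transform. -/
def lipBound (M r : ℝ) : ℝ :=
  Real.exp (M / 2) * √(8 * Real.pi) * (1 / √r + 2 * M * √r) / (2 * √Real.pi)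

/-- Letting η → 0 turns the pairings into 2√π times the point values, which explains the denominator
in `lipBound`. -/
theorem coleHopfSlice_sub_le (hf : StripSolution a b M f) {s t : ℝ}
    (hs : a < s) (hst : s < t) (ht : t < b) (c₁ c₂ : ℝ) :
    coleHopfSlice f t c₁ - coleHopfSlice f t c₂ ≤ lipBound M (t - s) * |c₁ - c₂| := by
  have bW := coleHopfSlice_isBddCont hf t
  have hr : 0 < t - s := by linarith
  have hL := (heat_tendsto bW c₁).sub (heat_tendsto bW c₂)
  have hR : Tendsto (fun η => |c₁ - c₂| * (Real.exp (M / 2) * √(8 * Real.pi)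
          * (1 / √(t - s + η) + 2 * M * √(t - s + η)))) (𝓝[>] 0)
      (𝓝 (|c₁ - c₂| * (Real.exp (M / 2) * √(8 * Real.pi)
          * (1 / √(t - s + 0) + 2 * M * √(t - s + 0))))) := by
    have h1 : ContinuousAt (fun η : ℝ => √(t - s + η)) 0 := by fun_prop
    have h2 : √(t - s + 0) ≠ 0 := by
      rw [add_zero]
      exact (Real.sqrt_pos.2 hr).ne'
    have h3 : ContinuousAt (fun η : ℝ => |c₁ - c₂| * (Real.exp (M / 2) * √(8 * Real.pi)
          * (1 / √(t - s + η) + 2 * M * √(t - s + η)))) 0 :=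
      continuousAt_const.mul (continuousAt_const.mul
        ((continuousAt_const.div h1 h2).add (continuousAt_const.mul h1)))
    exact h3.tendsto.mono_left nhdsWithin_le_nhds
  have key := le_of_tendsto_of_tendsto hL hR (by
    filter_upwards [self_mem_nhdsWithin] with η hη
    exact coleHopfSlice_pairing_sub_le hf hs hst.le ht hη c₁ c₂)
  rw [add_zero, ← mul_sub] at key
  have hpi : 0 < 2 * √Real.pi := by positivity
  unfold lipBound
  rw [div_mul_eq_mul_div, le_div_iff₀ hpi]
  linarith

/-- Solutions on a strip are bounded at each interior time. -/
theorem StripSolution.ae_abs_le (hf : StripSolution a b M f) {s t : ℝ}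
    (hs : a < s) (hst : s < t) (ht : t < b) :
    ∀ᵐ x, |f (t, x)| ≤ 2 * Real.exp (M / 2) * lipBound M (t - s) := by
  have hlip : 0 ≤ lipBound M (t - s) := by
    have := hf.mass_nonneg
    unfold lipBound
    positivity
  filter_upwards [LocallyIntegrable.ae_hasDerivAt_integral (hf.slice t).locallyIntegrable]
    with x hx
  have h1 : HasDerivAt (fun x => ∫ y in Iic x, f (t, y)) (f (t, x)) x := by
    rw [integral_Iic_eq_add (hf.slice t)]
    exact (hx 0).const_add _
  have h2 : HasDerivAt (coleHopfSlice f t)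
      (coleHopfSlice f t x * (1 / 2 * f (t, x))) x := (h1.const_mul (1 / 2)).exp
  -- At a Lebesgue point W is differentiable with W_x = W u/2, bounded by the Lipschitz constant.
  -- The lower bound W ≥ exp(−M/2) then converts this into a bound for u.
  have h3 : |coleHopfSlice f t x * (1 / 2 * f (t, x))| ≤ lipBound M (t - s) := by
    refine h2.le_of_lip' hlip (Eventually.of_forall fun y => ?_)
    rw [Real.norm_eq_abs, Real.norm_eq_abs]
    refine abs_le.2 ⟨?_, coleHopfSlice_sub_le hf hs hst ht y x⟩
    have := coleHopfSlice_sub_le hf hs hst ht x y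
    rw [abs_sub_comm] at this
    linarith
  have h4 : Real.exp (-(M / 2)) ≤ coleHopfSlice f t x := by
    rw [coleHopfSlice, Real.exp_le_exp]
    linarith [(abs_le.1 (abs_integral_Iic_le hf t x)).1]
  have h5 : 0 < coleHopfSlice f t x := Real.exp_pos _
  rw [abs_mul, abs_of_pos h5, abs_mul, abs_of_pos (by norm_num : (0 : ℝ) < 1 / 2)] at h3
  have h6 : Real.exp (M / 2) * Real.exp (-(M / 2)) = 1 := by
    rw [← Real.exp_add]
    simp
  have h7 : Real.exp (-(M / 2)) * |f (t, x)| ≤ 2 * lipBound M (t - s) := by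
    have := mul_le_mul_of_nonneg_right h4 (abs_nonneg (f (t, x)))
    linarith
  calc |f (t, x)| = Real.exp (M / 2) * (Real.exp (-(M / 2)) * |f (t, x)|) := by
        rw [← mul_assoc, h6, one_mul]
    _ ≤ Real.exp (M / 2) * (2 * lipBound M (t - s)) :=
        mul_le_mul_of_nonneg_left h7 (Real.exp_pos _).le
    _ = _ := by ring

theorem lipBound_le {M r r' d : ℝ} (hM : 0 ≤ M) (hd : 0 < d) (hdr : d ≤ r) (hr : r ≤ r') :
    lipBound M r ≤ Real.exp (M / 2) * √(8 * Real.pi) * (1 / √d + 2 * M * √r')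
      / (2 * √Real.pi) := by
  have h1 : 1 / √r ≤ 1 / √d :=
    one_div_le_one_div_of_le (Real.sqrt_pos.2 hd) (Real.sqrt_le_sqrt hdr)
  have h2 : √r ≤ √r' := Real.sqrt_le_sqrt hr
  unfold lipBound
  gcongr

/-- A bounded, jointly measurable representative of a solution on a strip. -/
theorem exists_bounded_stripSolution {u₀ : ℝ →₁[volume] ℝ} {u : ℝ → (ℝ →₁[volume] ℝ)}
    (hu : IsSolution u₀ u) {a b : ℝ} (ha : 0 < a) (hab : a < b) :
    ∃ (M B : ℝ) (f : ℝ × ℝ → ℝ), StripSolution a b M f ∧ (∀ z, |f z| ≤ B) ∧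
      ∀ t ∈ Icc a b, (fun y => u t y) =ᵐ[volume] fun y => f (t, y) := by
  -- A larger strip makes [a, b] interior. Starting the estimate at time 3a/4 leaves an elapsed time
  -- between a/4 and b for every t in [a, b], hence a uniform bound.
  obtain ⟨M, g, hg, hg0, hgu⟩ := exists_stripSolution hu (a := a / 2) (b := b + 1)
    (by linarith) (by linarith)
  have hM := hg.mass_nonneg
  set B := 2 * Real.exp (M / 2) * (Real.exp (M / 2) * √(8 * Real.pi) *
    (1 / √(a / 4) + 2 * M * √b) / (2 * √Real.pi)) with hB
  have hB0 : 0 ≤ B := by positivity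
  have hgB : ∀ t ∈ Icc a b, ∀ᵐ x, |g (t, x)| ≤ B := fun t ht => by
    filter_upwards [hg.ae_abs_le (s := 3 * a / 4) (t := t) (by linarith) (by linarith [ht.1])
      (by linarith [ht.2])] with x hx
    refine hx.trans (mul_le_mul_of_nonneg_left (lipBound_le hM (by linarith) ?_ ?_)
      (by positivity))
    · linarith [ht.1]
    · linarith [ht.2]
  -- Cutting off the points where the bound fails changes each slice only on a null set and makes
  -- the bound hold everywhere.
  set S : Set (ℝ × ℝ) := (Icc a b ×ˢ (univ : Set ℝ)) ∩ {z | |g z| ≤ B} with hS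
  have hSm : MeasurableSet S := (measurableSet_Icc.prod MeasurableSet.univ).inter
    (measurableSet_le hg.measurable.abs measurable_const)
  have hfu : ∀ t ∈ Icc a b, (fun y => u t y) =ᵐ[volume] fun y => S.indicator g (t, y) := by
    intro t ht
    filter_upwards [hgu t ⟨by linarith [ht.1], by linarith [ht.2]⟩, hgB t ht] with y h1 h2
    rw [indicator_of_mem (show (t, y) ∈ S from ⟨⟨ht, mem_univ _⟩, h2⟩), h1]
  obtain ⟨M', hM'⟩ := isCompact_Icc.exists_bound_of_continuousOn
    (hu.continuousOn.mono fun t (ht : t ∈ Icc a b) => ha.le.trans ht.1)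
  refine ⟨M', B, S.indicator g, stripSolution_of_isSolution hu ha hab
    (hg.measurable.indicator hSm) (fun t x ht => indicator_of_notMem (fun h => ht h.1.1) _) hfu hM',
    fun z => ?_, hfu⟩
  by_cases hz : z ∈ S
  · rw [indicator_of_mem hz]
    exact hz.2
  · rw [indicator_of_notMem hz, abs_zero]
    exact hB0

end AugmentedBurgers

namespace AugmentedBurgers

/-! ### The energy inequality -/

/-- `β` is a convex entropy of class `C²` with `β(0) = 0`. -/
structure Entropy (β β₁ β₂ : ℝ → ℝ) : Prop where
  zero : β 0 = 0
  deriv_fst : ∀ x, HasDerivAt β (β₁ x) x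
  deriv_snd : ∀ x, HasDerivAt β₁ (β₂ x) x
  continuous_snd : Continuous β₂
  nonneg_snd : ∀ x, 0 ≤ β₂ x

namespace Entropy

variable {β β₁ β₂ : ℝ → ℝ} (hβ : Entropy β β₁ β₂)
include hβ

theorem continuous : Continuous β :=
  continuous_iff_continuousAt.2 fun x => (hβ.deriv_fst x).continuousAt

theorem continuous_fst : Continuous β₁ :=
  continuous_iff_continuousAt.2 fun x => (hβ.deriv_snd x).continuousAt

theorem tangent_le (x y : ℝ) : β x + β₁ x * (y - x) ≤ β y := by
  have hmono : Monotone β₁ := monotone_of_hasDerivAt_nonneg hβ.deriv_snd hβ.nonneg_snd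
  rcases lt_trichotomy x y with h | h | h
  · obtain ⟨c, hc, e⟩ := exists_hasDerivAt_eq_slope β β₁ h hβ.continuous.continuousOn
      fun z _ => hβ.deriv_fst z
    have h1 := hmono hc.1.le
    rw [e, le_div_iff₀ (by linarith)] at h1
    linarith
  · simp [h]
  · obtain ⟨c, hc, e⟩ := exists_hasDerivAt_eq_slope β β₁ h hβ.continuous.continuousOn
      fun z _ => hβ.deriv_fst z
    have h1 := hmono hc.2.le
    rw [e, div_le_iff₀ (by linarith)] at h1
    linarith

theorem exists_lipschitz (B : ℝ) :
    ∃ C, 0 ≤ C ∧ (∀ x, |x| ≤ B → |β₁ x| ≤ C) ∧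
      ∀ x y, |x| ≤ B → |y| ≤ B → |β x - β y| ≤ C * |x - y| := by
  obtain ⟨C, hC⟩ := (isCompact_Icc (a := -B) (b := B)).exists_bound_of_continuousOn
    hβ.continuous_fst.continuousOn
  refine ⟨max C 0, le_max_right _ _, fun x hx => (hC x (abs_le.1 hx)).trans (le_max_left _ _),
    fun x y hx hy => ?_⟩
  exact (convex_Icc (-B) B).norm_image_sub_le_of_norm_hasDerivWithin_le
    (fun z _ => (hβ.deriv_fst z).hasDerivWithinAt)
    (fun z hz => (hC z hz).trans (le_max_left _ _)) (abs_le.1 hy) (abs_le.1 hx)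

end Entropy

theorem IsBddCont.comp_entropy {β v : ℝ → ℝ} (hβ : Continuous β) (hv : IsBddCont v) :
    IsBddCont (fun x => β (v x)) := by
  obtain ⟨hv, B, hB⟩ := hv
  obtain ⟨C, hC⟩ := (isCompact_Icc (a := -B) (b := B)).exists_bound_of_continuousOn
    hβ.continuousOn
  exact ⟨hβ.comp hv, C, fun x => hC _ (abs_le.1 (hB x))⟩

theorem entropy_comp_integrable {β β₁ β₂ v : ℝ → ℝ} (hβ : Entropy β β₁ β₂)
    {B : ℝ} (hB : ∀ x, |v x| ≤ B) (hvi : Integrable v) : Integrable (fun x => β (v x)) := by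
  obtain ⟨C, hC0, -, hC⟩ := hβ.exists_lipschitz B
  have hB0 : 0 ≤ B := (abs_nonneg _).trans (hB 0)
  refine (hvi.abs.const_mul C).mono' (hβ.continuous.comp_aestronglyMeasurable
    hvi.aestronglyMeasurable) (ae_of_all _ fun x => ?_)
  have := hC (v x) 0 (hB x) (by simpa using hB0)
  simpa [hβ.zero] using this

variable {ε a b M B : ℝ} {α : ℝ → ℝ} {f : ℝ × ℝ → ℝ} {β β₁ β₂ : ℝ → ℝ}

theorem conv2_smear {A D : ℝ → ℝ} (hA : IsBddCont A) (hD : IsBddCont D) (hf : Integrable f)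
    (t x : ℝ) : conv2 A (smear D) f t x = convK (conv2 A D f t) x := by
  have hAc := hA.1
  have hDc := hD.1
  obtain ⟨C, hC⟩ := hA.2
  obtain ⟨C', hC'⟩ := hD.2
  have hi : Integrable (fun p : ℝ × (ℝ × ℝ) =>
      A (t - p.2.1) * D (x - p.1 - p.2.2) * (K p.1 * f p.2)) (volume.prod volume) := by
    refine (K_integrable.mul_prod hf).bdd_mul (c := C * C')
      (Continuous.aestronglyMeasurable (by fun_prop)) (ae_of_all _ fun p => ?_)
    rw [Real.norm_eq_abs, abs_mul]
    exact mul_le_mul (hC _) (hC' _) (abs_nonneg _) ((abs_nonneg _).trans (hC 0))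
  calc conv2 A (smear D) f t x
      = ∫ z : ℝ × ℝ, ∫ w, A (t - z.1) * D (x - w - z.2) * (K w * f z) := by
        unfold conv2 smear
        congr 1
        funext z
        rw [← integral_const_mul, ← integral_mul_const]
        congr 1
        funext w
        rw [show x - z.2 - w = x - w - z.2 by ring]
        ring
    _ = ∫ w, ∫ z : ℝ × ℝ, A (t - z.1) * D (x - w - z.2) * (K w * f z) :=
        (integral_integral_swap hi).symm
    _ = convK (conv2 A D f t) x := by
        rw [convK_apply]
        congr 1
        funext w
        unfold conv2
        rw [← integral_const_mul]
        congr 1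
        funext z
        ring

theorem integral_convK {g : ℝ → ℝ} (hg : Integrable g) : ∫ x, convK g x = ∫ x, g x := by
  have h1 : IsBddCont fun _ : ℝ => (1 : ℝ) := ⟨continuous_const, 1, fun _ => by simp⟩
  have h := integral_convK_mul hg h1 0
  have h2 : ∀ z, smear (fun _ => (1 : ℝ)) z = 1 := fun z => by
    simp [smear, K_integral]
  simpa [h2] using h

/-- Averaging the tangent inequality of β at v(x) against the probability density K gives β'(v)(K*v
− v) ≤ K*β(v) − β(v), and convolution with K preserves the integral. -/
theorem integral_entropy_convK_le (hβ : Entropy β β₁ β₂) {v : ℝ → ℝ} (hv : IsBddCont v)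
    (hvi : Integrable v) : ∫ x, β₁ (v x) * (convK v x - v x) ≤ 0 := by
  obtain ⟨B, hB⟩ := hv.2
  have b1 := hv.comp_entropy hβ.continuous_fst
  have bβ := hv.comp_entropy hβ.continuous
  have iβ := entropy_comp_integrable hβ hB hvi
  have i1 := b1.mul_integrable ((convK_integrable hvi).sub hvi)
  have hle : ∀ x, β₁ (v x) * (convK v x - v x) ≤ convK (fun x => β (v x)) x - β (v x) := by
    intro x
    have k1 := smear_integrand_integrable hv x
    have k2 := smear_integrand_integrable bβ x
    have k0 : ∀ c : ℝ, Integrable fun w => K w * c := fun c => K_integrable.mul_const c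
    have e1 : β₁ (v x) * (convK v x - v x) = ∫ w, (β₁ (v x) * (K w * v (x - w)) - K w *
        (β₁ (v x) * v x)) := by
      rw [integral_sub (k1.const_mul _) (k0 _), integral_const_mul, integral_mul_const,
        K_integral, convK_apply]
      ring
    have e2 : convK (fun x => β (v x)) x - β (v x) = ∫ w, (K w * β (v (x - w)) - K w *
        β (v x)) := by
      rw [integral_sub k2 (k0 _), integral_mul_const, K_integral, convK_apply, one_mul]
    rw [e1, e2]
    refine integral_mono ((k1.const_mul _).sub (k0 _)) (k2.sub (k0 _)) fun w => ?_
    have := mul_le_mul_of_nonneg_left (hβ.tangent_le (v x) (v (x - w))) (K_nonneg w)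
    beta_reduce
    linarith
  calc _ ≤ ∫ x, (convK (fun x => β (v x)) x - β (v x)) :=
        integral_mono i1 ((convK_integrable iβ).sub iβ) hle
    _ = 0 := by
        rw [integral_sub (convK_integrable iβ) iβ, integral_convK iβ, sub_self]

theorem mollified_abs_le (h : Mollifier ε α) (hB : ∀ z, |f z| ≤ B) (t x : ℝ) :
    |conv2 α α f t x| ≤ B := by
  rw [conv2_eq_translate]
  calc _ ≤ ∫ w : ℝ × ℝ, α w.1 * α w.2 * B := by
        refine abs_integral_le_of_abs_le (h.kernel_integrable.mul_const B) fun w => ?_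
        have := mul_nonneg (h.nonneg w.1) (h.nonneg w.2)
        rw [abs_mul, abs_of_nonneg this]
        exact mul_le_mul_of_nonneg_left (hB _) this
    _ = B := by rw [integral_mul_const, h.kernel_integral, one_mul]

theorem energy_hasDerivAt (hf : StripSolution a b M f) (h : Mollifier ε α)
    (hB : ∀ z, |f z| ≤ B) (hβ : Entropy β β₁ β₂) (t : ℝ) :
    HasDerivAt (fun t => ∫ x, β (conv2 α α f t x))
      (∫ x, β₁ (conv2 α α f t x) * conv2 (deriv α) α f t x) t := by
  have hvB := fun t x => mollified_abs_le h hB t x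
  obtain ⟨C, hC0, hC1, -⟩ := hβ.exists_lipschitz B
  obtain ⟨C', hC'⟩ := h.bdd_deriv.2
  have bv := fun t => conv2_isBddCont h.bdd h.bdd hf.integrable t
  have iv := fun t => conv2_integrable_slice h.bdd h.bdd h.integrable hf.integrable t
  have ivt := conv2_integrable_slice h.bdd_deriv h.bdd h.integrable hf.integrable t
  refine (hasDerivAt_integral_of_dominated_loc_of_deriv_le (s := univ)
    (F := fun t x => β (conv2 α α f t x))
    (F' := fun t x => β₁ (conv2 α α f t x) * conv2 (deriv α) α f t x)
    (bound := fun x => C * (C' * convDom α f x)) univ_mem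
    (Eventually.of_forall fun t => ?_) (entropy_comp_integrable hβ (hvB t) (iv t)) ?_
    (ae_of_all _ fun x t _ => ?_)
    (((convDom_integrable h.bdd h.integrable hf.integrable).const_mul _).const_mul _)
    (ae_of_all _ fun x t _ => ?_)).2
  · exact ((bv t).comp_entropy hβ.continuous).1.aestronglyMeasurable
  · exact (((bv t).comp_entropy hβ.continuous_fst).mul_integrable ivt).aestronglyMeasurable
  · rw [Real.norm_eq_abs, abs_mul]
    exact mul_le_mul (hC1 _ (hvB t x)) (conv2_le_convDom hC' h.bdd hf.integrable t x)
      (abs_nonneg _) hC0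
  · exact (hβ.deriv_fst _).comp t
      (conv2_hasDerivAt_time h.bdd h.bdd_deriv h.bdd h.hasDerivAt hf.integrable t x)

/-- Multiply the mollified equation by β'(v) and integrate by parts. The transport terms are exact
derivatives, except for the part carrying the defect; that part is absorbed by half of the
dissipation, at a cost proportional to ∫ R. The other half of the dissipation is kept for Nash's
inequality. -/
theorem energy_rate_le (hf : StripSolution a b M f) (h : Mollifier ε α)
    (hB : ∀ z, |f z| ≤ B) (hβ : Entropy β β₁ β₂) {C : ℝ} (hC : ∀ x, |x| ≤ B → β₂ x ≤ C) {t : ℝ}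
    (ht : ∀ s, |t - s| ≤ ε → s ∈ Ioo a b) :
    ∫ x, β₁ (conv2 α α f t x) * conv2 (deriv α) α f t x
      ≤ -(1 / 2) * (∫ x, β₂ (conv2 α α f t x) * conv2 α (deriv α) f t x ^ 2)
        + C * B ^ 2 / 8 * ∫ x, defect α f t x := by
  have hvB := fun x => mollified_abs_le h hB t x
  have hB0 : 0 ≤ B := (abs_nonneg _).trans (hB 0)
  have hR0 := fun x => defect_nonneg h hf.integrable hf.sq_integrable t x
  have hRB : ∀ x, defect α f t x ≤ B ^ 2 := fun x => by
    have := mollified_abs_le h (f := fun z => f z ^ 2) (B := B ^ 2) (fun z => by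
      rw [abs_of_nonneg (sq_nonneg _), ← sq_abs]
      exact pow_le_pow_left₀ (abs_nonneg _) (hB z) 2) t x
    have h1 := (le_abs_self _).trans this
    unfold defect
    linarith [sq_nonneg (conv2 α α f t x)]
  set v := conv2 α α f t with hv
  set vx := conv2 α (deriv α) f t with hvx
  set vxx := conv2 α (deriv (deriv α)) f t with hvxx
  set S := conv2 α α (fun z => f z ^ 2) t with hS
  set Sx := conv2 α (deriv α) (fun z => f z ^ 2) t with hSx
  have bv : IsBddCont v := conv2_isBddCont h.bdd h.bdd hf.integrable t
  have bvx : IsBddCont vx := conv2_isBddCont h.bdd h.bdd_deriv hf.integrable t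
  have bR : IsBddCont (defect α f t) := defect_isBddCont hf h t
  have iv : Integrable v := conv2_integrable_slice h.bdd h.bdd h.integrable hf.integrable t
  have ivx : Integrable vx :=
    conv2_integrable_slice h.bdd h.bdd_deriv h.integrable_deriv hf.integrable t
  have ivxx : Integrable vxx :=
    conv2_integrable_slice h.bdd h.bdd_deriv2 h.integrable_deriv2 hf.integrable t
  have iS : Integrable S := conv2_integrable_slice h.bdd h.bdd h.integrable hf.sq_integrable t
  have iSx : Integrable Sx :=
    conv2_integrable_slice h.bdd h.bdd_deriv h.integrable_deriv hf.sq_integrable t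
  have iR : Integrable (defect α f t) := defect_slice_integrable hf h t
  have dv : ∀ x, HasDerivAt v (vx x) x :=
    conv2_hasDerivAt_space h.bdd h.bdd h.bdd_deriv h.hasDerivAt hf.integrable t
  have dvx : ∀ x, HasDerivAt vx (vxx x) x :=
    conv2_hasDerivAt_space h.bdd h.bdd_deriv h.bdd_deriv2 h.hasDerivAt_deriv hf.integrable t
  have dS : ∀ x, HasDerivAt S (Sx x) x :=
    conv2_hasDerivAt_space h.bdd h.bdd h.bdd_deriv h.hasDerivAt hf.sq_integrable t
  have bβ1 := bv.comp_entropy hβ.continuous_fst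
  have bβ2 := bv.comp_entropy hβ.continuous_snd
  -- a primitive of the cubic term
  let G : ℝ → ℝ := fun w => ∫ z in (0 : ℝ)..w, β₂ z * z ^ 2
  have hg : Continuous fun z => β₂ z * z ^ 2 := hβ.continuous_snd.mul (continuous_pow 2)
  have dG : ∀ w, HasDerivAt G (β₂ w * w ^ 2) w := fun w =>
    (hg.integral_hasStrictDerivAt 0 w).hasDerivAt
  obtain ⟨CG, hCG⟩ := (isCompact_Icc (a := -B) (b := B)).exists_bound_of_continuousOn
    hg.continuousOn
  have iG : Integrable (fun x => G (v x)) := by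
    refine (iv.abs.const_mul CG).mono'
      ((continuous_iff_continuousAt.2 fun w => (dG w).continuousAt).comp
        bv.1).aestronglyMeasurable (ae_of_all _ fun x => ?_)
    have := (convex_Icc (-B) B).norm_image_sub_le_of_norm_hasDerivWithin_le
      (fun z _ => (dG z).hasDerivWithinAt) hCG (x := 0) (y := v x) (by simpa using hB0)
      (abs_le.1 (hvB x))
    have hG0 : G 0 = 0 := intervalIntegral.integral_same
    simpa [hG0] using this
  -- All integrations by parts are gathered in one exact derivative. Writing S = v² + R, the v² part
  -- of the flux is differentiated through the primitive G, which leaves the cross term β''(v) v_x R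
  -- / 2.
  have dP : ∀ x, HasDerivAt
      (fun x => β₁ (v x) * (vx x + 1 / 2 * S x) + β (v x) - 1 / 2 * G (v x))
      (β₁ (v x) * (1 / 2 * Sx x + vxx x + vx x)
        + (β₂ (v x) * vx x ^ 2 + 1 / 2 * (β₂ (v x) * vx x * defect α f t x))) x := by
    intro x
    have d1 := ((hβ.deriv_snd (v x)).comp x (dv x)).mul ((dvx x).add ((dS x).const_mul (1 / 2)))
    have d2 := (hβ.deriv_fst (v x)).comp x (dv x)
    have d3 := ((dG (v x)).comp x (dv x)).const_mul (1 / 2)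
    refine ((d1.add d2).sub d3).congr_deriv ?_
    have hd : defect α f t x = S x - v x ^ 2 := rfl
    rw [hd]
    simp only [Function.comp_apply, Pi.add_apply]
    ring
  have i1 : Integrable fun x => β₁ (v x) * (1 / 2 * Sx x + vxx x + vx x) :=
    bβ1.mul_integrable (((iSx.const_mul _).add ivxx).add ivx)
  have i2 : Integrable fun x => β₂ (v x) * vx x ^ 2 := by
    refine (bβ2.mul_integrable (bvx.mul_integrable ivx)).congr (ae_of_all _ fun x => ?_)
    ring
  have i3 : Integrable fun x => β₂ (v x) * vx x * defect α f t x :=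
    (bβ2.mul bvx).mul_integrable iR
  have i23 : Integrable fun x => β₂ (v x) * vx x ^ 2
      + 1 / 2 * (β₂ (v x) * vx x * defect α f t x) := i2.add (i3.const_mul _)
  have z := integral_eq_zero_of_hasDerivAt_of_integrable dP (i1.add i23)
    (((bβ1.mul_integrable (ivx.add (iS.const_mul _))).add
      (entropy_comp_integrable hβ hvB iv)).sub (iG.const_mul _))
  rw [integral_add i1 i23] at z
  have i4 : Integrable fun x => β₁ (v x) * (convK v x - v x) :=
    bβ1.mul_integrable ((convK_integrable iv).sub iv)
  have e : ∫ x, β₁ (v x) * conv2 (deriv α) α f t x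
      = (∫ x, β₁ (v x) * (1 / 2 * Sx x + vxx x + vx x))
        + ∫ x, β₁ (v x) * (convK v x - v x) := by
    rw [← integral_add i1 i4]
    congr 1
    funext x
    rw [mollified_equation hf h ht x, conv2_smear h.bdd h.bdd hf.integrable]
    simp only [← hv, ← hvx, ← hvxx, ← hSx]
    ring
  have hK := integral_entropy_convK_le hβ bv iv
  have hfin : -(∫ x, (β₂ (v x) * vx x ^ 2 + 1 / 2 * (β₂ (v x) * vx x * defect α f t x)))
      ≤ -(1 / 2) * (∫ x, β₂ (v x) * vx x ^ 2) + C * B ^ 2 / 8 * ∫ x, defect α f t x := by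
    rw [← integral_neg, ← integral_const_mul, ← integral_const_mul,
      ← integral_add (i2.const_mul _) (iR.const_mul _)]
    refine integral_mono i23.neg ((i2.const_mul _).add (iR.const_mul _)) fun x => ?_
    -- Young's inequality; then R² ≤ B² R, because 0 ≤ R ≤ B², reduces the quadratic error to a
    -- multiple of R.
    have h1 : -(vx x ^ 2 + 1 / 2 * (vx x * defect α f t x))
        ≤ -(1 / 2) * vx x ^ 2 + 1 / 8 * defect α f t x ^ 2 := by
      linarith [sq_nonneg (2 * vx x + defect α f t x)]
    have h2 : defect α f t x ^ 2 ≤ B ^ 2 * defect α f t x := by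
      rw [sq]
      exact mul_le_mul_of_nonneg_right (hRB x) (hR0 x)
    have h3 := hβ.nonneg_snd (v x)
    have h4 := hC (v x) (hvB x)
    have h5 : β₂ (v x) * (1 / 8 * (B ^ 2 * defect α f t x))
        ≤ C * (1 / 8 * (B ^ 2 * defect α f t x)) :=
      mul_le_mul_of_nonneg_right h4 (by have := hR0 x; positivity)
    have h6 := mul_le_mul_of_nonneg_left (h1.trans (add_le_add le_rfl
      (mul_le_mul_of_nonneg_left h2 (by norm_num : (0 : ℝ) ≤ 1 / 8)))) h3
    beta_reduce
    linarith
  linarith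

end AugmentedBurgers

/-! ### Removal of the mollification in the entropy inequality -/

namespace AugmentedBurgers

variable {ε a b M B : ℝ} {α : ℝ → ℝ} {f : ℝ × ℝ → ℝ} {β β₁ β₂ : ℝ → ℝ}

theorem entropy_slice_integrable (hf : StripSolution a b M f) (hB : ∀ z, |f z| ≤ B)
    (hβ : Entropy β β₁ β₂) (t : ℝ) : Integrable (fun x => β (f (t, x))) :=
  entropy_comp_integrable hβ (fun x => hB (t, x)) (hf.slice t)

theorem entropy_mollified_integrable (hf : StripSolution a b M f) (h : Mollifier ε α)
    (hB : ∀ z, |f z| ≤ B) (hβ : Entropy β β₁ β₂) (t : ℝ) :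
    Integrable (fun x => β (conv2 α α f t x)) :=
  entropy_comp_integrable hβ (fun x => mollified_abs_le h hB t x)
    (conv2_integrable_slice h.bdd h.bdd h.integrable hf.integrable t)

theorem tendsto_entropy_mollified (hf : StripSolution a b M f) (hB : ∀ z, |f z| ≤ B)
    (hβ : Entropy β β₁ β₂) {ε δ : ℕ → ℝ} {α : ℕ → ℝ → ℝ} (hα : ∀ n, Mollifier (ε n) (α n))
    (hδ : Tendsto δ atTop (𝓝 0)) {t : ℝ}
    (hc : ∀ n, ∫ x, |conv2 (α n) (α n) f t x - f (t, x)| ≤ δ n) :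
    Tendsto (fun n => ∫ x, β (conv2 (α n) (α n) f t x)) atTop (𝓝 (∫ x, β (f (t, x)))) := by
  obtain ⟨C, hC0, -, hC⟩ := hβ.exists_lipschitz B
  rw [tendsto_iff_norm_sub_tendsto_zero]
  have h0 : Tendsto (fun n => C * δ n) atTop (𝓝 0) := by simpa using hδ.const_mul C
  refine squeeze_zero (fun _ => norm_nonneg _) (fun n => ?_) h0
  have iv := conv2_integrable_slice (hα n).bdd (hα n).bdd (hα n).integrable hf.integrable t
  rw [← integral_sub (entropy_mollified_integrable hf (hα n) hB hβ t)
    (entropy_slice_integrable hf hB hβ t)]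
  calc _ ≤ ∫ x, C * |conv2 (α n) (α n) f t x - f (t, x)| :=
        abs_integral_le_of_abs_le ((iv.sub (hf.slice t)).abs.const_mul C) fun x =>
          hC _ _ (mollified_abs_le (hα n) hB t x) (hB (t, x))
    _ = C * ∫ x, |conv2 (α n) (α n) f t x - f (t, x)| := integral_const_mul _ _
    _ ≤ C * δ n := mul_le_mul_of_nonneg_left (hc n) hC0

theorem Entropy.exists_bound_snd (hβ : Entropy β β₁ β₂) (B : ℝ) :
    ∃ C, 0 ≤ C ∧ ∀ x, |x| ≤ B → β₂ x ≤ C := by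
  obtain ⟨C, hC⟩ := (isCompact_Icc (a := -B) (b := B)).exists_bound_of_continuousOn
    hβ.continuous_snd.continuousOn
  exact ⟨max C 0, le_max_right _ _, fun x hx =>
    (le_abs_self _).trans ((hC x (abs_le.1 hx)).trans (le_max_left _ _))⟩

/-- Discarding the dissipation, the mollified entropy can grow by at most a multiple of ∫ R, which
vanishes in the limit. Both endpoint values converge because β is Lipschitz on [−B, B] and v
converges in L¹. -/
theorem entropy_mono (hf : StripSolution a b M f) (hB : ∀ z, |f z| ≤ B)
    (hβ : Entropy β β₁ β₂) {s t : ℝ} (hs : a < s) (hst : s ≤ t) (ht : t < b) :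
    ∫ x, β (f (t, x)) ≤ ∫ x, β (f (s, x)) := by
  obtain ⟨C, hC0, hC⟩ := hβ.exists_bound_snd B
  have hδ : ∀ n : ℕ, (0 : ℝ) < 1 / ((n : ℝ) + 1) := fun n => by positivity
  choose ε α hα hr hi hd hct hcs using fun n : ℕ => exists_good_mollifiers hf hs hst ht _ (hδ n)
  have hlim0 : Tendsto (fun n : ℕ => 1 / ((n : ℝ) + 1)) atTop (𝓝 0) :=
    tendsto_one_div_add_atTop_nhds_zero_nat
  have key : ∀ n, ∫ x, β (conv2 (α n) (α n) f t x)
      ≤ (∫ x, β (conv2 (α n) (α n) f s x)) + C * B ^ 2 / 8 * (1 / ((n : ℝ) + 1)) := fun n => by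
    obtain ⟨ri, rle⟩ := integral_defect_slices_le hst hf (hα n) (hi n) (hd n)
    have hder := energy_hasDerivAt hf (hα n) hB hβ
    have := intervalIntegral.sub_le_integral_of_hasDeriv_right_of_le hst
      (φ := fun r => C * B ^ 2 / 8 * ∫ x, defect (α n) f r x)
      (fun r _ => (hder r).continuousAt.continuousWithinAt)
      (fun r _ => (hder r).hasDerivWithinAt) (ri.integrableOn.const_mul _) (fun r hr' => by
        have h1 := energy_rate_le hf (hα n) hB hβ hC (hr n r (Ioo_subset_Icc_self hr'))
        have h2 : 0 ≤ ∫ x, β₂ (conv2 (α n) (α n) f r x)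
            * conv2 (α n) (deriv (α n)) f r x ^ 2 :=
          integral_nonneg fun x => mul_nonneg (hβ.nonneg_snd _) (sq_nonneg _)
        linarith)
    rw [intervalIntegral.integral_const_mul] at this
    have h3 := mul_le_mul_of_nonneg_left rle (by positivity : 0 ≤ C * B ^ 2 / 8)
    linarith
  have hR := (tendsto_entropy_mollified hf hB hβ hα hlim0 hcs).add
    (hlim0.const_mul (C * B ^ 2 / 8))
  rw [mul_zero, add_zero] at hR
  exact le_of_tendsto_of_tendsto' (tendsto_entropy_mollified hf hB hβ hα hlim0 hct) hR key

/-! ### Decay of the mass -/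

/-- A smooth convex approximation of |x| from below, normalised to vanish at 0 so that its
composition with an integrable function stays integrable. -/
theorem entropy_sqrt {δ : ℝ} (hδ : 0 < δ) :
    Entropy (fun x => √(x ^ 2 + δ ^ 2) - δ) (fun x => x / √(x ^ 2 + δ ^ 2))
      (fun x => δ ^ 2 / √(x ^ 2 + δ ^ 2) ^ 3) := by
  have hpos : ∀ x : ℝ, 0 < √(x ^ 2 + δ ^ 2) := fun x => Real.sqrt_pos.2 (by positivity)
  have hsq : ∀ x : ℝ, √(x ^ 2 + δ ^ 2) ^ 2 = x ^ 2 + δ ^ 2 := fun x =>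
    Real.sq_sqrt (by positivity)
  have hd : ∀ x : ℝ, HasDerivAt (fun x => √(x ^ 2 + δ ^ 2)) (x / √(x ^ 2 + δ ^ 2)) x := fun x => by
    have h1 : HasDerivAt (fun x : ℝ => x ^ 2 + δ ^ 2) (2 * x) x := by
      simpa using (hasDerivAt_pow 2 x).add_const (δ ^ 2)
    refine (h1.sqrt (by positivity)).congr_deriv ?_
    have := (hpos x).ne'
    field_simp
  refine ⟨?_, fun x => (hd x).sub_const δ, fun x => ?_, ?_, fun x => by positivity⟩
  · simp [Real.sqrt_sq hδ.le]
  · refine ((hasDerivAt_id x).div (hd x) (hpos x).ne').congr_deriv ?_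
    have h1 := (hpos x).ne'
    have h2 := hsq x
    simp only [id]
    field_simp
    rw [h2]
    ring
  · exact continuous_const.div (by fun_prop) fun x => (pow_pos (hpos x) 3).ne'

theorem mass_mono (hf : StripSolution a b M f) (hB : ∀ z, |f z| ≤ B) {s t : ℝ} (hs : a < s)
    (hst : s ≤ t) (ht : t < b) : ∫ x, |f (t, x)| ≤ ∫ x, |f (s, x)| := by
  have hle : ∀ δ : ℝ, 0 < δ → ∀ x : ℝ, √(x ^ 2 + δ ^ 2) - δ ≤ |x| := fun δ hδ x => by
    rw [sub_le_iff_le_add, ← sq_abs x]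
    exact Real.sqrt_le_iff.2 ⟨by positivity, by nlinarith [abs_nonneg x]⟩
  have hge : ∀ δ : ℝ, 0 < δ → ∀ x : ℝ, 0 ≤ √(x ^ 2 + δ ^ 2) - δ := fun δ hδ x => by
    rw [sub_nonneg]
    exact Real.le_sqrt_of_sq_le (by linarith [sq_nonneg x])
  have h1 : ∀ δ : ℝ, 0 < δ → ∫ x, (√(f (t, x) ^ 2 + δ ^ 2) - δ) ≤ ∫ x, |f (s, x)| := fun δ hδ =>
    (entropy_mono hf hB (entropy_sqrt hδ) hs hst ht).trans
      (integral_mono (entropy_slice_integrable hf hB (entropy_sqrt hδ) s) (hf.slice s).abs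
        fun x => hle δ hδ _)
  have h2 : Tendsto (fun δ : ℝ => ∫ x, (√(f (t, x) ^ 2 + δ ^ 2) - δ)) (𝓝[>] 0)
      (𝓝 (∫ x, |f (t, x)|)) := by
    refine tendsto_integral_filter_of_dominated_convergence (fun x => |f (t, x)|) ?_ ?_
      (hf.slice t).abs (ae_of_all _ fun x => ?_)
    · filter_upwards [self_mem_nhdsWithin] with δ hδ
      exact (entropy_slice_integrable hf hB (entropy_sqrt hδ) t).aestronglyMeasurable
    · filter_upwards [self_mem_nhdsWithin] with δ hδ
      refine ae_of_all _ fun x => ?_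
      rw [Real.norm_eq_abs, abs_of_nonneg (hge δ hδ _)]
      exact hle δ hδ _
    · have hc : Continuous fun δ : ℝ => √(f (t, x) ^ 2 + δ ^ 2) - δ := by fun_prop
      have := hc.tendsto 0
      simp only [ne_eq, OfNat.ofNat_ne_zero, not_false_eq_true, zero_pow, add_zero, sub_zero,
        Real.sqrt_sq_eq_abs] at this
      exact this.mono_left nhdsWithin_le_nhds
  exact le_of_tendsto h2 (by filter_upwards [self_mem_nhdsWithin] with δ hδ using h1 δ hδ)

/-! ### Nash's inequality -/

/-- In one dimension sup w² ≤ N = 2∫|w w'|, and N² ≤ 4 A D by Cauchy–Schwarz, where A = ∫ w² and D =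
∫ w'². Combined with A ≤ sup|w| · Y, where Y = ∫|w|, this gives A⁴ ≤ N² Y⁴ ≤ 4 A D Y⁴. -/
theorem nash_inequality {w w' : ℝ → ℝ} (hw : ∀ x, HasDerivAt w (w' x) x) (hb : IsBddCont w)
    (hb' : IsBddCont w') (hi : Integrable w) (hi' : Integrable w') :
    (∫ x, w x ^ 2) ^ 3 ≤ 4 * (∫ x, |w x|) ^ 4 * ∫ x, w' x ^ 2 := by
  set A := ∫ x, w x ^ 2 with hA
  set D := ∫ x, w' x ^ 2 with hD
  set Y := ∫ x, |w x| with hY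
  set N := ∫ x, 2 * |w x * w' x| with hN
  have iA : Integrable fun x => w x ^ 2 := by
    simpa only [sq] using hb.mul_integrable hi
  have iD : Integrable fun x => w' x ^ 2 := by
    simpa only [sq] using hb'.mul_integrable hi'
  have iww : Integrable fun x => w x * w' x := hb.mul_integrable hi'
  have iN : Integrable fun x => 2 * |w x * w' x| := iww.abs.const_mul 2
  have hA0 : 0 ≤ A := integral_nonneg fun x => sq_nonneg _
  have hD0 : 0 ≤ D := integral_nonneg fun x => sq_nonneg _
  have hY0 : 0 ≤ Y := integral_nonneg fun x => abs_nonneg _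
  have hN0 : 0 ≤ N := integral_nonneg fun x => by positivity
  have hsup : ∀ x, w x ^ 2 ≤ N := fun x => by
    have d2 : ∀ y, HasDerivAt (fun y => w y ^ 2) (2 * (w y * w' y)) y := fun y =>
      ((hw y).pow 2).congr_deriv (by ring)
    have i2 : Integrable fun y => 2 * (w y * w' y) := iww.const_mul 2
    have hl := tendsto_zero_of_hasDerivAt_of_integrableOn_Iic (a := x) (fun y _ => d2 y)
      i2.integrableOn iA.integrableOn
    have := integral_Iic_of_hasDerivAt_of_tendsto (a := x) (d2 x).continuousAt.continuousWithinAt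
      (fun y _ => d2 y) i2.integrableOn hl
    rw [sub_zero] at this
    rw [← this]
    calc _ ≤ ∫ y in Iic x, 2 * |w y * w' y| :=
          integral_mono i2.integrableOn iN.integrableOn fun y =>
            mul_le_mul_of_nonneg_left (le_abs_self _) (by norm_num)
      _ ≤ N := setIntegral_le_integral iN (ae_of_all _ fun y => by positivity)
  have hcs : N ^ 2 ≤ 4 * A * D := by
    -- The quadratic polynomial is ∫ (l|w| − |w'|)²; its nonpositive discriminant is Cauchy–Schwarz.
    have hq : ∀ l : ℝ, 0 ≤ A * (l * l) + (-N) * l + D := fun l => by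
      have e : A * (l * l) + (-N) * l + D = ∫ x, (l * |w x| - |w' x|) ^ 2 := by
        have e1 : ∀ x, (l * |w x| - |w' x|) ^ 2
            = (l * l * w x ^ 2 - l * (2 * |w x * w' x|)) + w' x ^ 2 := fun x => by
          rw [abs_mul, ← sq_abs (w x), ← sq_abs (w' x)]
          ring
        simp_rw [e1]
        rw [integral_add (f := fun x => _ - _) ((iA.const_mul _).sub (iN.const_mul _)) iD,
          integral_sub (iA.const_mul _) (iN.const_mul _), integral_const_mul, integral_const_mul]
        ring
      rw [e]
      exact integral_nonneg fun x => sq_nonneg _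
    have := discrim_le_zero hq
    rw [discrim, neg_sq] at this
    linarith
  have hAN : A ≤ √N * Y := by
    rw [hY, ← integral_const_mul]
    refine integral_mono iA (hi.abs.const_mul _) fun x => ?_
    have h1 : |w x| ≤ √N := Real.abs_le_sqrt (hsup x)
    beta_reduce
    rw [← sq_abs, sq]
    exact mul_le_mul_of_nonneg_right h1 (abs_nonneg _)
  have hA2 : A ^ 2 ≤ N * Y ^ 2 := by
    calc A ^ 2 ≤ (√N * Y) ^ 2 := pow_le_pow_left₀ hA0 hAN 2
      _ = N * Y ^ 2 := by rw [mul_pow, Real.sq_sqrt hN0]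
  have hA4 : A * A ^ 3 ≤ A * (4 * Y ^ 4 * D) := by
    calc A * A ^ 3 = (A ^ 2) ^ 2 := by ring
      _ ≤ (N * Y ^ 2) ^ 2 := pow_le_pow_left₀ (sq_nonneg _) hA2 2
      _ = N ^ 2 * Y ^ 4 := by ring
      _ ≤ 4 * A * D * Y ^ 4 := mul_le_mul_of_nonneg_right hcs (by positivity)
      _ = _ := by ring
  rcases hA0.eq_or_lt with h0 | h0
  · rw [← h0, zero_pow three_ne_zero]
    positivity
  · exact le_of_mul_le_mul_left hA4 h0

/-! ### Doubling the exponent -/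

theorem entropy_pow {q : ℕ} (hq : 1 ≤ q) :
    Entropy (fun x => x ^ (2 * q)) (fun x => 2 * q * x ^ (2 * q - 1))
      (fun x => 2 * q * (2 * q - 1) * (x ^ (q - 1)) ^ 2) := by
  have hq' : (1 : ℝ) ≤ q := by exact_mod_cast hq
  refine ⟨zero_pow (by omega), fun x => ?_, fun x => ?_, by fun_prop, fun x => ?_⟩
  · simpa using hasDerivAt_pow (2 * q) x
  · refine ((hasDerivAt_pow (2 * q - 1) x).const_mul (2 * (q : ℝ))).congr_deriv ?_
    rw [Nat.cast_sub (by omega), ← pow_mul, show 2 * q - 1 - 1 = (q - 1) * 2 by omega]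
    push_cast
    ring
  · have : (0 : ℝ) ≤ 2 * q - 1 := by linarith
    positivity

theorem pow_slice_integrable (hf : StripSolution a b M f) (hB : ∀ z, |f z| ≤ B) {q : ℕ}
    (hq : 1 ≤ q) (t : ℝ) : Integrable (fun x => |f (t, x)| ^ q) := by
  obtain ⟨n, rfl⟩ : ∃ n, q = n + 1 := ⟨q - 1, by omega⟩
  refine ((hf.slice t).abs.const_mul (B ^ n)).mono'
    ((hf.slice t).abs.aestronglyMeasurable.pow _) (ae_of_all _ fun x => ?_)
  rw [Real.norm_eq_abs, abs_of_nonneg (by positivity), pow_succ]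
  exact mul_le_mul_of_nonneg_right (pow_le_pow_left₀ (abs_nonneg _) (hB _) n) (abs_nonneg _)

theorem pow_integrable (hf : StripSolution a b M f) (hB : ∀ z, |f z| ≤ B) {q : ℕ}
    (hq : 1 ≤ q) : Integrable (fun z => |f z| ^ q) := by
  obtain ⟨n, rfl⟩ : ∃ n, q = n + 1 := ⟨q - 1, by omega⟩
  refine (hf.integrable.abs.const_mul (B ^ n)).mono'
    (hf.integrable.abs.aestronglyMeasurable.pow _) (ae_of_all _ fun x => ?_)
  rw [Real.norm_eq_abs, abs_of_nonneg (by positivity), pow_succ]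
  exact mul_le_mul_of_nonneg_right (pow_le_pow_left₀ (abs_nonneg _) (hB _) n) (abs_nonneg _)

/-- Jensen for exponents 2^k, obtained by squaring repeatedly: each squaring is nonnegativity of the
defect, applied to |f|^(2^k) in place of f. -/
theorem mollified_pow_le (hf : StripSolution a b M f) (h : Mollifier ε α)
    (hB : ∀ z, |f z| ≤ B) (k : ℕ) (t x : ℝ) :
    |conv2 α α f t x| ^ 2 ^ k ≤ conv2 α α (fun z => |f z| ^ 2 ^ k) t x := by
  induction k with
  | zero =>
    simp only [pow_zero, pow_one]
    rw [conv2_eq_translate, conv2_eq_translate]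
    refine abs_integral_le_of_abs_le
      (conv2_translate_integrable h.bdd h.bdd hf.integrable.abs t x) fun w => ?_
    rw [abs_mul, abs_of_nonneg (mul_nonneg (h.nonneg _) (h.nonneg _))]
  | succ k ih =>
    have h1 := pow_integrable hf hB (Nat.one_le_two_pow (n := k))
    have h2 := pow_integrable hf hB (Nat.one_le_two_pow (n := k + 1))
    have e : ∀ y : ℝ, y ^ 2 ^ (k + 1) = (y ^ 2 ^ k) ^ 2 := fun y => by rw [← pow_mul, pow_succ]
    simp only [e] at h2 ⊢
    have := defect_nonneg h h1 h2 t x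
    unfold defect at this
    calc (|conv2 α α f t x| ^ 2 ^ k) ^ 2 ≤ (conv2 α α (fun z => |f z| ^ 2 ^ k) t x) ^ 2 :=
          pow_le_pow_left₀ (by positivity) ih 2
      _ ≤ _ := by linarith

/-- After Jensen, the integral is an average over nearby times of the integrals of |f|^(2^k), so a
bound uniform over the strip passes to v with no loss. -/
theorem integral_mollified_pow_le (hf : StripSolution a b M f) (h : Mollifier ε α)
    (hB : ∀ z, |f z| ≤ B) (k : ℕ) {t m : ℝ} (ht : ∀ s, |t - s| ≤ ε → s ∈ Ioo a b)
    (hm : ∀ s ∈ Ioo a b, ∫ x, |f (s, x)| ^ 2 ^ k ≤ m) (hm0 : 0 ≤ m) :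
    ∫ x, |conv2 α α f t x| ^ 2 ^ k ≤ m := by
  have hg := pow_integrable hf hB (Nat.one_le_two_pow (n := k))
  have hi := conv2_integrable_slice h.bdd h.bdd h.integrable hg t
  have hv := conv2_isBddCont h.bdd h.bdd hf.integrable t
  have hpos : ∀ x, 0 ≤ conv2 α α (fun z => |f z| ^ 2 ^ k) t x := fun x =>
    le_trans (by positivity) (mollified_pow_le hf h hB k t x)
  have h1 : ∫ x, |conv2 α α f t x| ^ 2 ^ k ≤ ∫ x, conv2 α α (fun z => |f z| ^ 2 ^ k) t x := by
    refine integral_mono (hi.mono' (hv.1.abs.pow _).aestronglyMeasurable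
      (ae_of_all _ fun x => ?_)) hi (mollified_pow_le hf h hB k t)
    rw [Real.norm_eq_abs, abs_of_nonneg (by positivity)]
    exact mollified_pow_le hf h hB k t x
  refine h1.trans ?_
  rw [← ENNReal.ofReal_le_ofReal_iff hm0]
  have h2 : ENNReal.ofReal (∫ x, conv2 α α (fun z => |f z| ^ 2 ^ k) t x)
      = ∫⁻ x, ‖conv2 α α (fun z => |f z| ^ 2 ^ k) t x‖ₑ := by
    rw [← ofReal_integral_norm_eq_lintegral_enorm hi]
    congr 2
    funext x
    rw [Real.norm_of_nonneg (hpos x)]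
  rw [h2]
  have hfm := hf.measurable
  refine lintegral_average_le h (N := fun w x => ‖|f ((t, x) - w)| ^ 2 ^ k‖ₑ) ?_
    (fun x => ?_) (fun w hw _ => ?_)
  · have : Measurable fun p : (ℝ × ℝ) × ℝ => f ((t, p.2) - p.1) :=
      hfm.comp ((measurable_const.prodMk measurable_snd).sub measurable_fst)
    exact (this.abs.pow_const _).enorm
  · rw [conv2_eq_translate]
    refine (enorm_integral_le_lintegral_enorm _).trans (le_of_eq ?_)
    simp_rw [enorm_mul]
  · have e : ∫⁻ x, ‖|f ((t, x) - w)| ^ 2 ^ k‖ₑ = ∫⁻ x, ‖|f (t - w.1, x)| ^ 2 ^ k‖ₑ :=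
      lintegral_sub_right_eq_self (fun x => ‖|f (t - w.1, x)| ^ 2 ^ k‖ₑ) w.2
    rw [e, ← ofReal_integral_norm_eq_lintegral_enorm
      (pow_slice_integrable hf hB Nat.one_le_two_pow _)]
    refine ENNReal.ofReal_le_ofReal (le_trans (le_of_eq ?_) (hm (t - w.1) (ht _ ?_)))
    · congr 1
      funext x
      rw [Real.norm_of_nonneg (by positivity)]
    · rw [sub_sub_cancel]
      exact hw.le

/-- In the variable r = √θ y/m² the left side is √θ m² (2r − r³/4), and 2r − r³/4 ≤ 3 for r ≥ 0. It
integrates y' ≤ −y³/(4m⁴) against the weight θ² without dividing by y. -/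
theorem cubic_absorption {m θ L y : ℝ} (hm : 0 < m) (hθ : 0 ≤ θ) (hθL : θ ≤ L) (hy : 0 ≤ y) :
    2 * θ * y - θ ^ 2 * (y ^ 3 / (4 * m ^ 4)) ≤ 3 * m ^ 2 * √L := by
  have hs : √θ ≤ √L := Real.sqrt_le_sqrt hθL
  have hsq : √θ ^ 2 = θ := Real.sq_sqrt hθ
  set r := √θ * y / m ^ 2 with hr
  have hr0 : 0 ≤ r := by positivity
  have h1 : 2 * r - r ^ 3 / 4 ≤ 3 := by
    nlinarith [mul_nonneg hr0 (sq_nonneg (r - 3 / 2)), sq_nonneg (r - 3 / 2), sq_nonneg (r - 2)]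
  have hy' : √θ * y = m ^ 2 * r := by
    rw [hr]
    field_simp
  have e : 2 * θ * y - θ ^ 2 * (y ^ 3 / (4 * m ^ 4)) = √θ * (m ^ 2 * (2 * r - r ^ 3 / 4)) := by
    have e1 : 2 * θ * y = 2 * √θ * (√θ * y) := by
      rw [show 2 * √θ * (√θ * y) = 2 * √θ ^ 2 * y by ring, hsq]
    have e2 : θ ^ 2 * (y ^ 3 / (4 * m ^ 4)) = √θ * (√θ * y) ^ 3 / (4 * m ^ 4) := by
      have : θ ^ 2 = √θ ^ 4 := by
        rw [show √θ ^ 4 = (√θ ^ 2) ^ 2 by ring, hsq]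
      rw [this]
      ring
    rw [e1, e2, hy']
    field_simp
  rw [e]
  calc √θ * (m ^ 2 * (2 * r - r ^ 3 / 4)) ≤ √θ * (m ^ 2 * 3) := by gcongr
    _ ≤ √L * (m ^ 2 * 3) := by gcongr
    _ = _ := by ring

end AugmentedBurgers

namespace AugmentedBurgers

variable {ε a b M B : ℝ} {α : ℝ → ℝ} {f : ℝ × ℝ → ℝ}

theorem abs_pow_two_pow_succ (x : ℝ) (k : ℕ) : |x| ^ 2 ^ (k + 1) = x ^ (2 * 2 ^ k) := by
  rw [pow_succ', pow_mul, sq_abs, pow_mul]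

/-- Nash's inequality for w = v^q with q = 2^k. The factor q² in ∫ w_x² is dominated by q(2q − 1),
which is what the retained half of the entropy dissipation supplies. -/
theorem nash_mollified (hf : StripSolution a b M f) (h : Mollifier ε α)
    (hB : ∀ z, |f z| ≤ B) (k : ℕ) {t m : ℝ} (ht : ∀ s, |t - s| ≤ ε → s ∈ Ioo a b) (hm0 : 0 < m)
    (hm : ∀ s ∈ Ioo a b, ∫ x, |f (s, x)| ^ 2 ^ k ≤ m) :
    (∫ x, conv2 α α f t x ^ (2 * 2 ^ k)) ^ 3 / (4 * m ^ 4)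
      ≤ 1 / 2 * ∫ x, 2 * ((2 ^ k : ℕ) : ℝ) * (2 * ((2 ^ k : ℕ) : ℝ) - 1) *
          (conv2 α α f t x ^ (2 ^ k - 1)) ^ 2 * conv2 α (deriv α) f t x ^ 2 := by
  set q : ℕ := 2 ^ k with hq
  have hq1 : 1 ≤ q := Nat.one_le_two_pow
  have hq' : (1 : ℝ) ≤ q := by exact_mod_cast hq1
  have bv := conv2_isBddCont h.bdd h.bdd hf.integrable t
  have bvx := conv2_isBddCont h.bdd h.bdd_deriv hf.integrable t
  have iv := conv2_integrable_slice h.bdd h.bdd h.integrable hf.integrable t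
  have ivx := conv2_integrable_slice h.bdd h.bdd_deriv h.integrable_deriv hf.integrable t
  have bp : ∀ n : ℕ, IsBddCont fun x => conv2 α α f t x ^ n := fun n =>
    bv.comp_entropy (β := fun y => y ^ n) (continuous_pow n)
  have dw : ∀ x, HasDerivAt (fun x => conv2 α α f t x ^ q)
      (q * conv2 α α f t x ^ (q - 1) * conv2 α (deriv α) f t x) x := fun x =>
    (conv2_hasDerivAt_space h.bdd h.bdd h.bdd_deriv h.hasDerivAt hf.integrable t x).pow q
  have iw : Integrable fun x => conv2 α α f t x ^ q := by
    refine ((bp (q - 1)).mul_integrable iv).congr (ae_of_all _ fun x => ?_)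
    beta_reduce
    rw [← pow_succ, Nat.sub_add_cancel hq1]
  have bc : IsBddCont fun x => (q : ℝ) * conv2 α α f t x ^ (q - 1) := (bp (q - 1)).const_mul q
  have bw' := bc.mul bvx
  have iw' := bc.mul_integrable ivx
  have N := nash_inequality dw (bp q) bw' iw iw'
  have hY : ∫ x, |conv2 α α f t x ^ q| ≤ m := by
    simp_rw [abs_pow]
    exact integral_mollified_pow_le hf h hB k ht hm hm0.le
  have hY0 : 0 ≤ ∫ x, |conv2 α α f t x ^ q| := integral_nonneg fun x => abs_nonneg _
  have hy : ∫ x, conv2 α α f t x ^ (2 * q) = ∫ x, (conv2 α α f t x ^ q) ^ 2 := by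
    simp_rw [← pow_mul, mul_comm q 2]
  set D := ∫ x, (q * conv2 α α f t x ^ (q - 1) * conv2 α (deriv α) f t x) ^ 2 with hD
  have hD0 : 0 ≤ D := integral_nonneg fun x => sq_nonneg _
  have h1 : (∫ x, conv2 α α f t x ^ (2 * q)) ^ 3 ≤ 4 * m ^ 4 * D := by
    rw [hy]
    refine N.trans (mul_le_mul_of_nonneg_right (mul_le_mul_of_nonneg_left
      (pow_le_pow_left₀ hY0 hY 4) (by norm_num)) hD0)
  rw [div_le_iff₀ (by positivity)]
  refine h1.trans ?_
  rw [mul_comm]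
  refine mul_le_mul_of_nonneg_right ?_ (by positivity)
  rw [hD, ← integral_const_mul]
  have iD : Integrable fun x =>
      (q * conv2 α α f t x ^ (q - 1) * conv2 α (deriv α) f t x) ^ 2 := by
    simpa only [sq] using bw'.mul_integrable iw'
  refine integral_mono iD ?_ fun x => ?_
  · refine (iD.const_mul ((2 * q - 1) / q)).congr (ae_of_all _ fun x => ?_)
    have : (q : ℝ) ≠ 0 := by positivity
    field_simp
  · have h2 : 0 ≤ (conv2 α α f t x ^ (q - 1)) ^ 2 * conv2 α (deriv α) f t x ^ 2 := by positivity
    have h3 : (q : ℝ) * q ≤ q * (2 * q - 1) := by nlinarith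
    have := mul_le_mul_of_nonneg_right h3 h2
    beta_reduce
    rw [mul_pow, mul_pow]
    linarith

theorem integral_pow_double_le (hf : StripSolution a b M f) (hB : ∀ z, |f z| ≤ B) (k : ℕ)
    {s t m : ℝ} (hs : a < s) (hst : s < t) (ht : t < b) (hm0 : 0 < m)
    (hm : ∀ r ∈ Ioo a b, ∫ x, |f (r, x)| ^ 2 ^ k ≤ m) :
    ∫ x, |f (t, x)| ^ 2 ^ (k + 1) ≤ 3 * m ^ 2 / √(t - s) := by
  have hβ := entropy_pow (Nat.one_le_two_pow (n := k))
  obtain ⟨C, hC0, hC⟩ := hβ.exists_bound_snd B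
  have hδ : ∀ n : ℕ, (0 : ℝ) < 1 / ((n : ℝ) + 1) := fun n => by positivity
  choose ε α hα hr hi hd hct _ using
    fun n : ℕ => exists_good_mollifiers hf hs hst.le ht _ (hδ n)
  have hlim0 : Tendsto (fun n : ℕ => 1 / ((n : ℝ) + 1)) atTop (𝓝 0) :=
    tendsto_one_div_add_atTop_nhds_zero_nat
  set L := t - s with hL
  have hL0 : 0 < L := by linarith
  have key : ∀ n, L ^ 2 * ∫ x, conv2 (α n) (α n) f t x ^ (2 * 2 ^ k)
      ≤ 3 * m ^ 2 * √L * L + L ^ 2 * (C * B ^ 2 / 8) * (1 / ((n : ℝ) + 1)) := fun n => by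
    obtain ⟨ri, rle⟩ := integral_defect_slices_le hst.le hf (hα n) (hi n) (hd n)
    have hder := energy_hasDerivAt hf (hα n) hB hβ
    -- The weight (r − s)² vanishes at s, so no information on the entropy at the starting time is
    -- needed.
    have hg : ∀ r, HasDerivAt (fun r => (r - s) ^ 2 * ∫ x, conv2 (α n) (α n) f r x ^ (2 * 2 ^ k))
        _ r := fun r => (((hasDerivAt_id r).sub_const s).pow 2).mul (hder r)
    have := intervalIntegral.sub_le_integral_of_hasDeriv_right_of_le hst.le
      (φ := fun r => 3 * m ^ 2 * √L + L ^ 2 * (C * B ^ 2 / 8) * ∫ x, defect (α n) f r x)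
      (fun r _ => (hg r).continuousAt.continuousWithinAt)
      (fun r _ => (hg r).hasDerivWithinAt)
      ((integrableOn_const (by simp)).add (ri.integrableOn.const_mul _)) (fun r hr' => by
        have hgood := hr n r (Ioo_subset_Icc_self hr')
        have h1 := energy_rate_le hf (hα n) hB hβ hC hgood
        have h2 := nash_mollified hf (hα n) hB k hgood hm0 hm
        have hθ : 0 ≤ r - s := by linarith [hr'.1]
        have hθL : r - s ≤ L := by linarith [hr'.2]
        have hy : 0 ≤ ∫ x, conv2 (α n) (α n) f r x ^ (2 * 2 ^ k) :=
          integral_nonneg fun x => by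
            rw [pow_mul]
            positivity
        have h3 := cubic_absorption hm0 hθ hθL hy
        have hR : 0 ≤ C * B ^ 2 / 8 * ∫ x, defect (α n) f r x :=
          mul_nonneg (by positivity) (integral_nonneg fun x =>
            defect_nonneg (hα n) hf.integrable hf.sq_integrable r x)
        have h4 : (r - s) ^ 2 ≤ L ^ 2 := pow_le_pow_left₀ hθ hθL 2
        have h5 := mul_le_mul_of_nonneg_right h4 hR
        have h6 := mul_le_mul_of_nonneg_left (h1.trans (add_le_add (by linarith :
          _ ≤ -((∫ x, conv2 (α n) (α n) f r x ^ (2 * 2 ^ k)) ^ 3 / (4 * m ^ 4))) le_rfl))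
          (sq_nonneg (r - s))
        simp only [Pi.pow_apply, id, Nat.cast_ofNat, Nat.add_one_sub_one, pow_one, mul_one]
        linarith)
    rw [intervalIntegral.integral_add (by simp) (ri.intervalIntegrable.const_mul _),
      intervalIntegral.integral_const, intervalIntegral.integral_const_mul] at this
    have h3 := mul_le_mul_of_nonneg_left rle (by positivity : 0 ≤ L ^ 2 * (C * B ^ 2 / 8))
    simp only [sub_self, smul_eq_mul, ← hL] at this
    linarith
  have hlim := (tendsto_entropy_mollified hf hB hβ hα hlim0 hct).const_mul (L ^ 2)
  have hR : Tendsto (fun n : ℕ => 3 * m ^ 2 * √L * L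
      + L ^ 2 * (C * B ^ 2 / 8) * (1 / ((n : ℝ) + 1))) atTop
      (𝓝 (3 * m ^ 2 * √L * L + L ^ 2 * (C * B ^ 2 / 8) * 0)) :=
    tendsto_const_nhds.add (hlim0.const_mul _)
  have fin := le_of_tendsto_of_tendsto' hlim hR key
  rw [mul_zero, add_zero] at fin
  simp_rw [abs_pow_two_pow_succ]
  have hsq : √L ^ 2 = L := Real.sq_sqrt hL0.le
  have hs0 : 0 < √L := Real.sqrt_pos.2 hL0
  rw [le_div_iff₀ hs0]
  refine le_of_mul_le_mul_left (a := L * √L) ?_ (by positivity)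
  calc _ = √L ^ 2 * (L * ∫ x, f (t, x) ^ (2 * 2 ^ k)) := by ring
    _ = L ^ 2 * ∫ x, f (t, x) ^ (2 * 2 ^ k) := by
        rw [hsq]
        ring
    _ ≤ 3 * m ^ 2 * √L * L := fin
    _ = _ := by ring

/-! ### Iteration -/

section solution

variable {u₀ : ℝ →₁[volume] ℝ} {u : ℝ → (ℝ →₁[volume] ℝ)} (hu : IsSolution u₀ u)
include hu

/-- Monotonicity of the mass holds only between positive times, where the solution is bounded;
continuity in L¹ at time 0 then carries the comparison to the datum. -/
theorem norm_solution_le {t : ℝ} (ht : 0 < t) : ‖u t‖ ≤ ‖u₀‖ := by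
  have h1 : ∀ s, 0 < s → s ≤ t → ‖u t‖ ≤ ‖u s‖ := fun s hs hst => by
    obtain ⟨M, B, f, hf, hB, hfu⟩ := exists_bounded_stripSolution hu (a := s / 2) (b := t + 1)
      (by linarith) (by linarith)
    have e : ∀ r ∈ Icc (s / 2) (t + 1), ‖u r‖ = ∫ x, |f (r, x)| := fun r hr => by
      rw [L1.norm_eq_integral_norm]
      refine integral_congr_ae ?_
      filter_upwards [hfu r hr] with x hx
      rw [hx]
      rfl
    rw [e t ⟨by linarith, by linarith⟩, e s ⟨by linarith, by linarith⟩]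
    exact mass_mono hf hB (by linarith) hst (by linarith)
  have h2 : Tendsto (fun s => ‖u s‖) (𝓝[>] 0) (𝓝 ‖u₀‖) := by
    have := (hu.continuousOn 0 (mem_Ici.2 le_rfl)).norm
    rw [ContinuousWithinAt, hu.initial] at this
    exact this.mono_left (nhdsWithin_mono 0 Ioi_subset_Ici_self)
  refine ge_of_tendsto h2 ?_
  filter_upwards [Ioo_mem_nhdsGT ht] with s hs
  exact h1 s hs.1 hs.2.le

/-- With Q = 2^k and constant c in place of 24, one doubling step costs 3 from
`integral_pow_double_le`, 2 from moving the time and 2Q from the short time step. The induction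
closes when 12Q/(cQ)² ≤ 1/(2cQ), that is c ≥ 24. The denominator 24 · 2^k absorbs the growing factor
2Q. -/
theorem integral_pow_solution_le {M : ℝ} (hM : 0 < M) (hMu : ‖u₀‖ ≤ M) (k : ℕ) :
    ∀ t, 0 < t → Integrable (fun x => |u t x| ^ 2 ^ k) ∧
      ∫ x, |u t x| ^ 2 ^ k ≤ (24 * M) ^ 2 ^ k / (24 * 2 ^ k) / √t ^ (2 ^ k - 1) := by
  induction k with
  | zero =>
    intro t ht
    simp only [pow_zero, pow_one, mul_one, Nat.sub_self, div_one]
    refine ⟨(L1.integrable_coeFn (u t)).abs, ?_⟩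
    have := norm_solution_le hu ht
    rw [L1.norm_eq_integral_norm] at this
    simp only [Real.norm_eq_abs] at this
    linarith
  | succ k ih =>
    intro t ht
    set Q : ℕ := 2 ^ k with hQ
    have hQ1 : 1 ≤ Q := Nat.one_le_two_pow
    have hQr : (1 : ℝ) ≤ Q := by exact_mod_cast hQ1
    have hQ0 : (0 : ℝ) < Q := by linarith
    have hQk : (Q : ℝ) = 2 ^ k := by rw [hQ]; push_cast; rfl
    -- The relative time step 1/(2Q) is small enough that s^(Q−1) is still at least t^(Q−1)/2, by
    -- Bernoulli. The doubling step starts at t − t/(4Q), strictly inside the strip that begins at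
    -- s.
    set s := t * (1 - 1 / (2 * Q)) with hs
    have hx : 1 / (2 * (Q : ℝ)) ≤ 1 / 2 := one_div_le_one_div_of_le (by norm_num) (by linarith)
    have hx0 : 0 < 1 / (2 * (Q : ℝ)) := by positivity
    have hs0 : 0 < s := mul_pos ht (by linarith)
    have hst : s < t := by
      have := mul_pos ht hx0
      rw [hs]
      linarith
    obtain ⟨M', B, f, hf, hB, hfu⟩ := exists_bounded_stripSolution hu (a := s) (b := t + 1)
      hs0 (by linarith)
    have hfu' : ∀ n, ∀ r ∈ Icc s (t + 1), (fun x => |f (r, x)| ^ n) =ᵐ[volume]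
        fun x => |u r x| ^ n := fun n r hr => by
      filter_upwards [hfu r hr] with x hx
      rw [hx]
    have htI : t ∈ Icc s (t + 1) := ⟨hst.le, by linarith⟩
    refine ⟨(pow_slice_integrable hf hB Nat.one_le_two_pow t).congr (hfu' _ t htI), ?_⟩
    set m := (24 * M) ^ Q / (24 * 2 ^ k) / √s ^ (Q - 1) with hm
    have hs0' : 0 < √s := Real.sqrt_pos.2 hs0
    have ht0' : 0 < √t := Real.sqrt_pos.2 ht
    have hm0 : 0 < m := by positivity
    have hmass : ∀ r ∈ Ioo s (t + 1), ∫ x, |f (r, x)| ^ 2 ^ k ≤ m := fun r hr => by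
      rw [integral_congr_ae (hfu' _ r (Ioo_subset_Icc_self hr))]
      refine ((ih r (hs0.trans hr.1)).2).trans ?_
      refine div_le_div_of_nonneg_left (by positivity) (by positivity)
        (pow_le_pow_left₀ hs0'.le (Real.sqrt_le_sqrt hr.1.le) _)
    have main := integral_pow_double_le hf hB k (s := t - t / (4 * Q)) (t := t) (m := m)
      (by
        have : t / (4 * Q) < t * (1 / (2 * Q)) := by
          rw [mul_one_div]
          exact div_lt_div_of_pos_left ht (by positivity) (by linarith)
        rw [hs]
        linarith) (by
        have : 0 < t / (4 * Q) := by positivity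
        linarith) (by linarith) hm0 hmass
    rw [← integral_congr_ae (hfu' _ t htI)]
    refine main.trans ?_
    rw [sub_sub_cancel]
    have hB1 : (1 / 2 : ℝ) ≤ (1 - 1 / (2 * (Q : ℝ))) ^ (Q - 1) := by
      have h1 := one_add_mul_le_pow (a := -(1 / (2 * (Q : ℝ)))) (by linarith) (Q - 1)
      rw [Nat.cast_sub hQ1, Nat.cast_one] at h1
      have h2 : ((Q : ℝ) - 1) * (1 / (2 * (Q : ℝ))) ≤ 1 / 2 := by
        rw [mul_one_div, div_le_div_iff₀ (by positivity) (by norm_num)]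
        linarith
      rw [sub_eq_add_neg]
      linarith
    have hsQ : t ^ (Q - 1) / 2 ≤ s ^ (Q - 1) := by
      rw [hs, mul_pow]
      have := mul_le_mul_of_nonneg_left hB1 (pow_nonneg ht.le (Q - 1))
      linarith
    have hm2 : m ^ 2 = (24 * M) ^ (2 * Q) / (24 * Q) ^ 2 / s ^ (Q - 1) := by
      rw [hm, div_pow, div_pow, ← pow_mul, ← pow_mul, mul_comm Q 2, mul_comm (Q - 1) 2,
        pow_mul √s 2, Real.sq_sqrt hs0.le, hQk]
    have hm2' : m ^ 2 ≤ 2 * ((24 * M) ^ (2 * Q) / (24 * Q) ^ 2 / t ^ (Q - 1)) := by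
      rw [hm2]
      calc _ ≤ (24 * M) ^ (2 * Q) / (24 * Q) ^ 2 / (t ^ (Q - 1) / 2) :=
            div_le_div_of_nonneg_left (by positivity) (by positivity) hsQ
        _ = _ := by
            field_simp
    -- The exact factor is 2√Q; the cruder 2Q is what makes the recursion reproduce its form
    -- exactly.
    have hrt : 1 / √(t / (4 * Q)) ≤ 2 * Q / √t := by
      rw [Real.sqrt_div ht.le, one_div_div]
      refine div_le_div_of_nonneg_right ?_ ht0'.le
      refine Real.sqrt_le_iff.2 ⟨by positivity, ?_⟩
      nlinarith
    have hpow : √t ^ (2 ^ (k + 1) - 1) = t ^ (Q - 1) * √t := by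
      rw [show 2 ^ (k + 1) - 1 = 2 * (Q - 1) + 1 by rw [pow_succ]; omega, pow_succ, pow_mul,
        Real.sq_sqrt ht.le]
    have h2k : (2 : ℕ) ^ (k + 1) = 2 * Q := by rw [pow_succ']
    calc 3 * m ^ 2 / √(t / (4 * Q)) = 3 * m ^ 2 * (1 / √(t / (4 * Q))) := by ring
      _ ≤ 3 * (2 * ((24 * M) ^ (2 * Q) / (24 * Q) ^ 2 / t ^ (Q - 1))) * (2 * Q / √t) := by
          gcongr
      _ = (24 * M) ^ 2 ^ (k + 1) / (24 * 2 ^ (k + 1)) / √t ^ (2 ^ (k + 1) - 1) := by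
          rw [hpow, h2k, pow_succ' (2 : ℝ), ← hQk]
          field_simp
          ring

end solution

/-- Chebyshev at a level l > Λ bounds the measure of the level set by c(Λ/l)^(2^k), which tends to
0. A factor c independent of k is therefore harmless. -/
theorem ae_abs_le_of_integral_pow_le {g : ℝ → ℝ} {Λ c : ℝ} (hΛ : 0 ≤ Λ)
    (hi : ∀ k : ℕ, Integrable fun x => |g x| ^ 2 ^ k)
    (hg : ∀ k : ℕ, ∫ x, |g x| ^ 2 ^ k ≤ c * Λ ^ 2 ^ k) : ∀ᵐ x, |g x| ≤ Λ := by
  have key : ∀ l, Λ < l → volume {x | l ≤ |g x|} = 0 := by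
    intro l hl
    have hl0 : 0 < l := hΛ.trans_lt hl
    have hfin : volume {x | l ≤ |g x|} < ⊤ := by
      have h0 : Integrable fun x => |g x| := by simpa using hi 0
      have := h0.measure_norm_ge_lt_top hl0
      simpa using this
    have h1 : ∀ k : ℕ, volume.real {x | l ≤ |g x|} ≤ c * (Λ / l) ^ 2 ^ k := fun k => by
      have h2 := mul_meas_ge_le_integral_of_nonneg (μ := volume)
        (ae_of_all _ fun x => by positivity) (hi k) (l ^ 2 ^ k)
      have h3 : {x | l ^ 2 ^ k ≤ |g x| ^ 2 ^ k} = {x | l ≤ |g x|} := by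
        ext x
        exact pow_le_pow_iff_left₀ hl0.le (abs_nonneg _) (by positivity)
      rw [h3] at h2
      rw [div_pow, ← mul_div_assoc, le_div_iff₀ (by positivity)]
      linarith [hg k]
    have h4 : Tendsto (fun k : ℕ => c * (Λ / l) ^ 2 ^ k) atTop (𝓝 (c * 0)) :=
      (((tendsto_pow_atTop_nhds_zero_of_lt_one (by positivity) ((div_lt_one hl0).2 hl)).comp
        (tendsto_pow_atTop_atTop_of_one_lt (one_lt_two : 1 < 2)))).const_mul c
    rw [mul_zero] at h4
    have h5 : volume.real {x | l ≤ |g x|} = 0 :=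
      le_antisymm (ge_of_tendsto' h4 h1) measureReal_nonneg
    exact (measureReal_eq_zero_iff hfin.ne).1 h5
  have h6 : ∀ᵐ x, ∀ n : ℕ, |g x| < Λ + 1 / ((n : ℝ) + 1) := by
    refine ae_all_iff.2 fun n => ?_
    have := key (Λ + 1 / ((n : ℝ) + 1)) (by
      have : 0 < 1 / ((n : ℝ) + 1) := by positivity
      linarith)
    rw [ae_iff]
    simpa only [not_lt] using this
  filter_upwards [h6] with x hx
  have h7 : Tendsto (fun n : ℕ => Λ + 1 / ((n : ℝ) + 1)) atTop (𝓝 (Λ + 0)) :=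
    tendsto_const_nhds.add tendsto_one_div_add_atTop_nhds_zero_nat
  rw [add_zero] at h7
  exact ge_of_tendsto' h7 fun n => (hx n).le

theorem solution_ae_abs_le {u₀ : ℝ →₁[volume] ℝ} {u : ℝ → (ℝ →₁[volume] ℝ)}
    (hu : IsSolution u₀ u) {t : ℝ} (ht : 0 < t) : ∀ᵐ x, |u t x| ≤ 24 * ‖u₀‖ / √t := by
  have ht0 : 0 < √t := Real.sqrt_pos.2 ht
  -- The iteration divides by powers of the mass bound, so it is run with M > 0 and M is then
  -- lowered to ‖u₀‖; this also covers the zero datum.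
  have h1 : ∀ M : ℝ, 0 < M → ‖u₀‖ ≤ M → ∀ᵐ x, |u t x| ≤ 24 * M / √t := fun M hM hMu => by
    refine ae_abs_le_of_integral_pow_le (c := √t) (by positivity)
      (fun k => (integral_pow_solution_le hu hM hMu k t ht).1) fun k => ?_
    refine ((integral_pow_solution_le hu hM hMu k t ht).2).trans ?_
    have hk : (1 : ℝ) ≤ 24 * 2 ^ k := by
      have : (1 : ℝ) ≤ 2 ^ k := one_le_pow₀ one_le_two
      linarith
    calc _ ≤ (24 * M) ^ 2 ^ k / √t ^ (2 ^ k - 1) :=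
          div_le_div_of_nonneg_right (div_le_self (by positivity) hk) (by positivity)
      _ = √t * (24 * M / √t) ^ 2 ^ k := by
          have h2 : √t ^ 2 ^ k = √t ^ (2 ^ k - 1) * √t := by
            rw [← pow_succ, Nat.sub_add_cancel Nat.one_le_two_pow]
          rw [div_pow, h2]
          field_simp
  have h2 : ∀ᵐ x, ∀ n : ℕ, |u t x| ≤ 24 * (‖u₀‖ + 1 / ((n : ℝ) + 1)) / √t :=
    ae_all_iff.2 fun n => h1 _ (by positivity) (by
      have : 0 < 1 / ((n : ℝ) + 1) := by positivity
      linarith)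
  filter_upwards [h2] with x hx
  have h3 : Tendsto (fun n : ℕ => 24 * (‖u₀‖ + 1 / ((n : ℝ) + 1)) / √t) atTop
      (𝓝 (24 * (‖u₀‖ + 0) / √t)) :=
    ((tendsto_const_nhds.add tendsto_one_div_add_atTop_nhds_zero_nat).const_mul _).div_const _
  rw [add_zero] at h3
  exact ge_of_tendsto' h3 hx

end AugmentedBurgers

end

end

/-! ### Interpolation between the mass bound and the sup bound -/

theorem theorem2p2 (p : ℝ≥0∞) (hp : 1 ≤ p) :
    ∃ C : ℝ, 0 < C ∧
      ∀ (u₀ : ℝ →₁[volume] ℝ) (u : ℝ → (ℝ →₁[volume] ℝ)),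
        AugmentedBurgers.IsSolution u₀ u →
          ∀ t : ℝ, 0 < t →
            eLpNorm (u t) p volume
              ≤ ENNReal.ofReal (C * ‖u₀‖ * t ^ (-(1 / 2 : ℝ) * (1 - (p⁻¹).toReal))) := by
  refine ⟨24, by norm_num, fun u₀ u hu t ht => ?_⟩
  have hb := AugmentedBurgers.solution_ae_abs_le hu ht
  set Λ := 24 * ‖u₀‖ / √t with hΛ
  have hΛ0 : 0 ≤ Λ := by positivity
  have hexp : t ^ (-(1 / 2 : ℝ)) = 1 / √t := by
    rw [Real.rpow_neg ht.le, Real.sqrt_eq_rpow, one_div, one_div]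
  rcases eq_or_ne p ⊤ with rfl | hpt
  · simp only [ENNReal.inv_top, ENNReal.toReal_zero, sub_zero, mul_one]
    rw [hexp, mul_one_div, eLpNorm_exponent_top]
    exact eLpNormEssSup_le_of_ae_bound hb
  set r := p.toReal with hr
  have hr1 : 1 ≤ r := by
    have := ENNReal.toReal_mono hpt hp
    simpa using this
  have hr0 : 0 < r := by linarith
  have hm : ∫⁻ x, ‖u t x‖ₑ ≤ ENNReal.ofReal ‖u₀‖ := by
    rw [← ofReal_integral_norm_eq_lintegral_enorm (L1.integrable_coeFn (u t)),
      ← L1.norm_eq_integral_norm]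
    exact ENNReal.ofReal_le_ofReal (AugmentedBurgers.norm_solution_le hu ht)
  -- Pointwise |u|^r ≤ Λ^(r−1)|u|; the r-th root then gives Λ^(1−1/r) ‖u₀‖^(1/r), in which the
  -- powers of ‖u₀‖ add up to one. Zeros of u are treated apart because the splitting of the real
  -- power needs a nonzero base.
  have h1 : ∫⁻ x, ‖u t x‖ₑ ^ r ≤ ENNReal.ofReal (Λ ^ (r - 1) * ‖u₀‖) := by
    calc ∫⁻ x, ‖u t x‖ₑ ^ r ≤ ∫⁻ x, ENNReal.ofReal (Λ ^ (r - 1)) * ‖u t x‖ₑ := by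
          refine lintegral_mono_ae ?_
          filter_upwards [hb] with x hx
          have e1 : ‖u t x‖ₑ = ENNReal.ofReal |u t x| := (ofReal_norm _).symm
          rw [e1, ENNReal.ofReal_rpow_of_nonneg (abs_nonneg _) hr0.le,
            ← ENNReal.ofReal_mul (by positivity)]
          refine ENNReal.ofReal_le_ofReal ?_
          rcases (abs_nonneg (u t x)).eq_or_lt with h0 | h0
          · rw [← h0, Real.zero_rpow hr0.ne', mul_zero]
          · calc |u t x| ^ r = |u t x| ^ (r - 1) * |u t x| := by
                  rw [← Real.rpow_add_one h0.ne', sub_add_cancel]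
              _ ≤ Λ ^ (r - 1) * |u t x| := by
                  gcongr
      _ = ENNReal.ofReal (Λ ^ (r - 1)) * ∫⁻ x, ‖u t x‖ₑ :=
          lintegral_const_mul' _ _ ENNReal.ofReal_ne_top
      _ ≤ ENNReal.ofReal (Λ ^ (r - 1)) * ENNReal.ofReal ‖u₀‖ := by gcongr
      _ = _ := (ENNReal.ofReal_mul (by positivity)).symm
  rw [eLpNorm_eq_lintegral_rpow_enorm_toReal (by positivity) hpt, ← hr]
  refine (ENNReal.rpow_le_rpow h1 (by positivity)).trans ?_
  rw [ENNReal.ofReal_rpow_of_nonneg (by positivity) (by positivity)]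
  refine ENNReal.ofReal_le_ofReal ?_
  have hN : 0 ≤ ‖u₀‖ := norm_nonneg _
  have hθ : 0 ≤ 1 - 1 / r := by
    rw [sub_nonneg, div_le_one hr0]
    exact hr1
  have e2 : (p⁻¹).toReal = 1 / r := by rw [ENNReal.toReal_inv, one_div]
  calc (Λ ^ (r - 1) * ‖u₀‖) ^ (1 / r) = Λ ^ (1 - 1 / r) * ‖u₀‖ ^ (1 / r) := by
        rw [Real.mul_rpow (by positivity) hN, ← Real.rpow_mul hΛ0]
        congr 2
        field_simp
    _ = (24 * (1 / √t)) ^ (1 - 1 / r) * (‖u₀‖ ^ (1 - 1 / r) * ‖u₀‖ ^ (1 / r)) := by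
        rw [← mul_assoc, ← Real.mul_rpow (by positivity) hN, hΛ]
        congr 2
        ring
    _ = 24 ^ (1 - 1 / r) * ‖u₀‖ * t ^ (-(1 / 2 : ℝ) * (1 - (p⁻¹).toReal)) := by
        rw [← Real.rpow_add_of_nonneg hN hθ (by positivity), sub_add_cancel, Real.rpow_one,
          Real.mul_rpow (by norm_num) (by positivity), ← hexp, ← Real.rpow_mul ht.le, e2]
        ring
    -- Since 24^(1−1/p) ≤ 24, one constant serves all exponents.
    _ ≤ 24 * ‖u₀‖ * t ^ (-(1 / 2 : ℝ) * (1 - (p⁻¹).toReal)) := by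
        gcongr
        calc (24 : ℝ) ^ (1 - 1 / r) ≤ 24 ^ (1 : ℝ) :=
              Real.rpow_le_rpow_of_exponent_le (by norm_num) (by
                have : 0 ≤ 1 / r := by positivity
                linarith)
          _ = 24 := Real.rpow_one _
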